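/- Let $\Phi:[0,\infty)\to[0,\infty)$ be a Young's function, i.e. $\Phi(t)=\int_0^t\varphi(u)\,du$ for some nondecreasing, left continuous $\varphi:[0,\infty)\to[0,\infty)$ with $\varphi(0)=0$, and $\Phi(t)/t\to\infty$ as $t\to\infty$. Assume that $$\frac{t\log(e+t)}{\Phi(t)}\to\infty\qquad\text{as } t\to\infty.$$ For an integrable $\Omega:\mathbb S^1\to\mathbb R$ with $\int_{\mathbb S^1}\Omega\,d\theta=0$ and a Schwartz function $f:\mathbb R^2\to\mathbb C$ put $$T_\Omega f(x)=\lim_{\varepsilon\downarrow0}\int_{|x-y|>\varepsilon}\frac{1}{|x-y|^2}\,\Omega\Bigl(\frac{x-y}{|x-y|}\Bigr)f(y)\,dy .$$ Say that $T_\Omega$ is bounded on $L^p(\mathbb R^2)$ if there is $C<\infty$ with $\|T_\Omega f\|_{L^p}\le C\|f\|_{L^p}$ for all Schwartz $f$, and that $T_\Omega$ is of weak type $(1,1)$ if there is $C<\infty$ with $\lambda\,|\{x:|T_\Omega f(x)|>\lambda\}|\le C\|f\|_{L^1}$ for all Schwartz $f$ and all $\lambda>0$. Then there is an even, integrable function $\Omega:\mathbb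 S^1\to\mathbb R$ with $\int_{\mathbb S^1}\Omega\,d\theta=0$ and $\Omega\in\Phi(L)(\mathbb S^1)$, i.e. $\int_{\mathbb S^1}\Phi(|\Omega(\theta)|)\,d\theta<\infty$, such that the limit defining $T_\Omega f(x)$ exists, with absolutely convergent truncated integrals, for every Schwartz $f$ and every $x\in\mathbb R^2$, and such that for every $p\in[1,\infty]$ $$T_\Omega \text{ is bounded on } L^p(\mathbb R^2)\iff p=2 .$$ In particular, $T_\Omega$ is bounded on $L^2(\mathbb R^2)$ but is not of weak type $(1,1)$. Thus, for every such $\Phi$, membership in $\Phi(L)(\mathbb S^1)$ together with $L^2$ boundedness of $T_\Omega$ does not imply weak type $(1,1)$. -/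

import Mathlib

open MeasureTheory Filter Topology Set
open scoped NNReal ENNReal SchwartzMap

noncomputable section

namespace RoughSI

/-- The Euclidean plane. -/
abbrev Plane : Type := EuclideanSpace ℝ (Fin 2)

/-- The unit circle in the plane. -/
abbrev Circ : Type := Metric.sphere (0 : Plane) 1

/-- Arc length on the unit circle (total mass `2π`). -/
def arcLength : Measure Circ := (volume : Measure Plane).toSphere

/-- `Φ`, restricted to `[0, ∞)`, is a Young's function: `Φ t = ∫₀ᵗ φ` for a nondecreasing and
left continuous `φ : [0, ∞) → [0, ∞)` with `φ 0 = 0`, and `Φ t / t → ∞` as `t → ∞`.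
Values at negative arguments play no role. -/
def IsYoungFunction (Φ : ℝ → ℝ) : Prop :=
  (∃ φ : ℝ → ℝ,
      MonotoneOn φ (Ici 0) ∧
      (∀ t, 0 < t → ContinuousWithinAt φ (Iio t) t) ∧
      φ 0 = 0 ∧
      (∀ t, 0 ≤ t → 0 ≤ φ t) ∧
      (∀ t, 0 ≤ t → Φ t = ∫ u in (0 : ℝ)..t, φ u)) ∧
  Tendsto (fun t : ℝ => Φ t / t) atTop atTop

/-- The class `Φ(L)(S¹)`: measurable `Ω` with `∫ Φ(|Ω|) dθ < ∞`. -/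
def MemPhiL (Φ : ℝ → ℝ) (Ω : Circ → ℝ) : Prop :=
  AEStronglyMeasurable Ω arcLength ∧
    ∫⁻ θ, ENNReal.ofReal (Φ |Ω θ|) ∂arcLength < ∞

/-- The direction `z / |z|` of a nonzero vector. -/
def direction (z : Plane) (hz : z ≠ 0) : Circ :=
  ⟨‖z‖⁻¹ • z, by simp [norm_smul, hz]⟩

open scoped Classical in
/-- The kernel `K(z) = |z|⁻² Ω(z / |z|)` (set to `0` at the origin). -/
def roughKernel (Ω : Circ → ℝ) (z : Plane) : ℝ :=
  if hz : z ≠ 0 then (‖z‖ ^ 2)⁻¹ * Ω (direction z hz) else 0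

/-- The truncated integral `∫_{|x - y| > ε} K(x - y) f(y) dy`. -/
def truncSI (Ω : Circ → ℝ) (f : Plane → ℂ) (ε : ℝ) (x : Plane) : ℂ :=
  ∫ y in {y : Plane | ε < ‖x - y‖}, (roughKernel Ω (x - y) : ℂ) * f y

/-- The principal value defining `T_Ω f(x)` makes sense: the truncated integrals converge
absolutely, and they have a limit as `ε ↓ 0`. -/
def PVExists (Ω : Circ → ℝ) (f : Plane → ℂ) (x : Plane) : Prop :=
  (∀ ε : ℝ, 0 < ε →
      IntegrableOn (fun y : Plane => (roughKernel Ω (x - y) : ℂ) * f y)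
        {y : Plane | ε < ‖x - y‖}) ∧
    ∃ v : ℂ, Tendsto (fun ε : ℝ => truncSI Ω f ε x) (𝓝[>] 0) (𝓝 v)

/-- The rough singular integral `T_Ω f(x) = p.v. ∫ |x - y|⁻² Ω((x - y)/|x - y|) f(y) dy`. -/
def roughSI (Ω : Circ → ℝ) (f : Plane → ℂ) (x : Plane) : ℂ :=
  limUnder (𝓝[>] (0 : ℝ)) (fun ε : ℝ => truncSI Ω f ε x)

/-- `T_Ω` is bounded on `L^p(ℝ²)`: `‖T_Ω f‖_p ≤ C ‖f‖_p` for all Schwartz functions `f`. -/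
def BoundedOnLp (Ω : Circ → ℝ) (p : ℝ≥0∞) : Prop :=
  ∃ C : ℝ≥0, ∀ f : 𝓢(Plane, ℂ),
    eLpNorm (roughSI Ω f) p volume ≤ C * eLpNorm f p volume

/-- `T_Ω` is of weak type `(1,1)`:
`t |{x : |T_Ω f(x)| > t}| ≤ C ‖f‖₁` for all Schwartz functions `f` and all `t > 0`. -/
def WeakTypeOneOne (Ω : Circ → ℝ) : Prop :=
  ∃ C : ℝ≥0, ∀ f : 𝓢(Plane, ℂ), ∀ t : ℝ≥0, 0 < t →
    (t : ℝ≥0∞) * volume {x : Plane | (t : ℝ) < ‖roughSI Ω f x‖} ≤ C * eLpNorm f 1 volume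

end RoughSI

end

/-!
The kernel with even `Ω` of mean zero acts as the Fourier multiplier
`symb Ω ξ = ∫ Ω(θ) log (|ξ| / |⟨ξ, θ⟩|) dθ`, provided `∫ |Ω(θ)| log (|ξ| / |⟨ξ, θ⟩|) dθ` is
bounded in `ξ` (`Admissible`). This is read off from polar coordinates, and it yields the
existence of the principal value (`Admissible.pvExists`) and, by Plancherel, boundedness on `L²`
(`Admissible.boundedOnLp_two`). So the task is to find such an `Ω` in `Φ(L)` whose symbol is not
an `L^p` multiplier for any `p ≠ 2`.

The building block is an atom: the indicator of `{θ : |⟨e, θ⟩| < w}` for a unit vector `e`,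
divided by its measure times `log (1 / w)`. Its symbol is close to `1` at `e`, uniformly bounded,
and tends to `0` away from `±e` as `w → 0`. Since the atom has height about `1 / (w log (1 / w))`
on a set of measure about `w`, the assumption `t log (e + t) / Φ(t) → ∞` makes the `Φ`-integral of
every fixed multiple of it tend to `0` with `w`. Hence finitely many signed atoms, less their
mean, interpolate any signs at any finitely many directions at a bounded cost (`exists_block`),
where the bounds depend neither on the number of directions nor on the signs.

Blocks of rapidly growing size `N = 2 ^ l ^ 2`, with signs `ε_k` prescribed at the frequencies
`(R, k)`, `1 ≤ k ≤ N`, are chosen one after another (`exists_next_block`): a new block is small at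
the earlier frequencies, and its own `R` is so large that the symbols of the earlier blocks, being
continuous off the origin, are almost constant on the new frequencies. In the series of the blocks
with coefficients `2 ^ (-l)` the symbol at the frequencies of the level `l` is therefore
`A + 2 ^ (-l) ε_k + O(1 / N)` with bounded `A` (`HasLevel`, `hasLevel_tsum`). Jensen's inequality
keeps the series in `Φ(L)` (`memPhiL_tsum`).

Such a symbol cannot be an `L^p` multiplier. Take for `ε` Rudin-Shapiro signs (`FlatSigns`), so
that `P(t) = ∑ ε_k exp(2πikt)` is bounded by `√(2N)` and exceeds `√N` on a large set, and let `D`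
be the Dirichlet kernel, which is bounded away from the integers and comparable to `N` near them.
Spread out wave packets (`wavePacket`) carry the action of the multiplier to
`D ↦ A D + 2 ^ (-l) P` and `P ↦ A P + 2 ^ (-l) D`. For `p < 2` the first one and for `p > 2` the
second one increases the `L^p` norm by a positive power of `N`, up to the factor `2 ^ (-l)`, which
decays more slowly than every negative power of `N = 2 ^ l ^ 2`. Only the distribution functions
of the images enter, so the weak type `(1, 1)` bound fails as well
(`Admissible.not_distribBound`).
-/

noncomputable section

namespace RoughSI

/-! ### Bands on the circle -/

instance : IsFiniteMeasure arcLength := by unfold arcLength; infer_instance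

/-- The set of directions at angle less than `arcsin s` from the line orthogonal to the unit
vector `e`: a pair of antipodal arcs of length comparable to `s`. -/
def band (e : Plane) (s : ℝ) : Set Circ := {θ | |inner ℝ e (θ : Plane)| < s}

theorem measurable_inner_coe (e : Plane) : Measurable fun θ : Circ => inner ℝ e (θ : Plane) :=
  (continuous_const.inner continuous_subtype_val).measurable

theorem measurableSet_band (e : Plane) (s : ℝ) : MeasurableSet (band e s) :=
  measurableSet_lt (measurable_inner_coe e).abs measurable_const

theorem exists_orthonormalBasis_zero_eq {e : Plane} (he : ‖e‖ = 1) :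
    ∃ b : OrthonormalBasis (Fin 2) ℝ Plane, b 0 = e := by
  have h := Orthonormal.exists_orthonormalBasis_extension_of_card_eq (𝕜 := ℝ) (E := Plane)
    (ι := Fin 2) (by simp) (v := fun _ => e) (s := {0}) (by
      rw [orthonormal_iff_ite]
      rintro ⟨i, hi⟩ ⟨j, hj⟩
      simp only [mem_singleton_iff] at hi hj
      subst hi hj
      simp [Set.domRestrict, he])
  obtain ⟨b, hb⟩ := h
  exact ⟨b, hb 0 rfl⟩

theorem volume_box (b : OrthonormalBasis (Fin 2) ℝ Plane) (I J : Set ℝ) :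
    volume {x : Plane | inner ℝ (b 0) x ∈ I ∧ inner ℝ (b 1) x ∈ J} = volume I * volume J := by
  have h1 : MeasurePreserving (fun x : Plane => (WithLp.ofLp (b.repr x) : Fin 2 → ℝ)) :=
    (PiLp.volume_preserving_ofLp (Fin 2)).comp b.measurePreserving_repr
  have h2 : MeasurableEmbedding (fun x : Plane => (WithLp.ofLp (b.repr x) : Fin 2 → ℝ)) :=
    (MeasurableEquiv.toLp 2 (Fin 2 → ℝ)).symm.measurableEmbedding.comp
      b.repr.toHomeomorph.measurableEmbedding
  have h3 := h1.measure_preimage_emb h2 (Set.univ.pi ![I, J])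
  rw [volume_pi_pi] at h3
  simp only [Fin.prod_univ_two] at h3
  simp only [Matrix.cons_val_zero, Matrix.cons_val_one] at h3
  rw [← h3]
  congr 1
  ext x
  simp [OrthonormalBasis.repr_apply_apply]

theorem norm_sq_eq_inner_basis (b : OrthonormalBasis (Fin 2) ℝ Plane) (x : Plane) :
    ‖x‖ ^ 2 = inner ℝ (b 0) x ^ 2 + inner ℝ (b 1) x ^ 2 := by
  rw [← b.sum_sq_norm_inner_right x]
  simp

theorem finrank_plane : Module.finrank ℝ Plane = 2 := by simp

open scoped Pointwise in
theorem arcLength_apply {s : Set Circ} (hs : MeasurableSet s) :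
    arcLength s = 2 * volume (Ioo (0 : ℝ) 1 • ((↑) '' s : Set Plane)) := by
  unfold arcLength
  rw [Measure.toSphere_apply' _ hs, finrank_plane]
  rfl

open scoped Pointwise in
theorem arcLength_band_le {e : Plane} (he : ‖e‖ = 1) {s : ℝ} (hs : 0 ≤ s) :
    arcLength (band e s) ≤ ENNReal.ofReal (8 * s) := by
  obtain ⟨b, rfl⟩ := exists_orthonormalBasis_zero_eq he
  rw [arcLength_apply (measurableSet_band _ _)]
  have hsub : Ioo (0 : ℝ) 1 • ((↑) '' band (b 0) s : Set Plane) ⊆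
      {x : Plane | inner ℝ (b 0) x ∈ Ioo (-s) s ∧ inner ℝ (b 1) x ∈ Icc (-1 : ℝ) 1} := by
    rintro _ ⟨r, ⟨hr0, hr1⟩, _, ⟨θ, hθ, rfl⟩, rfl⟩
    have hθ1 : ‖(θ : Plane)‖ = 1 := by simp
    have hn := norm_sq_eq_inner_basis b (θ : Plane)
    rw [hθ1] at hn
    have hθ2 : |inner ℝ (b 0) (θ : Plane)| < s := hθ
    simp only [mem_ofPred_eq, inner_smul_right, mem_Ioo, mem_Icc]
    refine ⟨abs_lt.1 ?_, abs_le.1 ?_⟩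
    · rw [abs_mul, abs_of_pos hr0]
      nlinarith [abs_nonneg (inner ℝ (b 0) (θ : Plane))]
    · rw [abs_mul, abs_of_pos hr0]
      have : |inner ℝ (b 1) (θ : Plane)| ≤ 1 := by
        rw [← sq_le_one_iff_abs_le_one]
        nlinarith [sq_nonneg (inner ℝ (b 0) (θ : Plane))]
      nlinarith [abs_nonneg (inner ℝ (b 1) (θ : Plane))]
  calc _ ≤ 2 * volume {x : Plane | inner ℝ (b 0) x ∈ Ioo (-s) s ∧
        inner ℝ (b 1) x ∈ Icc (-1 : ℝ) 1} := by gcongr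
    _ = 2 * (ENNReal.ofReal (s - -s) * ENNReal.ofReal (1 - -1)) := by
        rw [volume_box, Real.volume_Ioo, Real.volume_Icc]
    _ = ENNReal.ofReal (8 * s) := by
        rw [← ENNReal.ofReal_mul (by linarith), show (2 : ℝ≥0∞) = ENNReal.ofReal 2 by simp,
          ← ENNReal.ofReal_mul (by norm_num)]
        congr 1; ring

open scoped Pointwise in
theorem le_arcLength_band {e : Plane} (he : ‖e‖ = 1) {s : ℝ} (hs : 0 < s) (hs1 : s ≤ 1) :
    ENNReal.ofReal (s / 2) ≤ arcLength (band e s) := by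
  obtain ⟨b, rfl⟩ := exists_orthonormalBasis_zero_eq he
  rw [arcLength_apply (measurableSet_band _ _)]
  have hsub : {x : Plane | inner ℝ (b 0) x ∈ Ioo (-(s / 2)) (s / 2) ∧
      inner ℝ (b 1) x ∈ Ioo (1 / 2 : ℝ) (3 / 4)} ⊆
      Ioo (0 : ℝ) 1 • ((↑) '' band (b 0) s : Set Plane) := by
    rintro x ⟨hx0, hx1⟩
    have hn := norm_sq_eq_inner_basis b x
    have h0 : |inner ℝ (b 0) x| < s / 2 := abs_lt.2 hx0
    have hlow : 1 / 2 < ‖x‖ := by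
      nlinarith [norm_nonneg x, hx1.1, sq_nonneg (inner ℝ (b 0) x)]
    have hup : ‖x‖ < 1 := by
      have : inner ℝ (b 0) x ^ 2 ≤ 1 / 4 := by
        rw [← sq_abs]
        nlinarith [abs_nonneg (inner ℝ (b 0) x)]
      nlinarith [norm_nonneg x, hx1.1, hx1.2]
    have hxne : x ≠ 0 := by
      rintro rfl
      norm_num at hlow
    refine ⟨‖x‖, ⟨by linarith, hup⟩, ‖x‖⁻¹ • x, ⟨direction x hxne, ?_, rfl⟩, ?_⟩
    · show |inner ℝ (b 0) (‖x‖⁻¹ • x)| < s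
      rw [inner_smul_right, abs_mul, abs_of_pos (by positivity), inv_mul_lt_iff₀ (by linarith)]
      nlinarith
    · simp [smul_smul, hxne]
  calc ENNReal.ofReal (s / 2)
      = 2 * (ENNReal.ofReal (s / 2 - -(s / 2)) * ENNReal.ofReal (3 / 4 - 1 / 2)) := by
        rw [← ENNReal.ofReal_mul (by linarith), show (2 : ℝ≥0∞) = ENNReal.ofReal 2 by simp,
          ← ENNReal.ofReal_mul (by norm_num)]
        congr 1; ring
    _ = 2 * volume {x : Plane | inner ℝ (b 0) x ∈ Ioo (-(s / 2)) (s / 2) ∧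
          inner ℝ (b 1) x ∈ Ioo (1 / 2 : ℝ) (3 / 4)} := by
        rw [volume_box, Real.volume_Ioo, Real.volume_Ioo]
    _ ≤ _ := by gcongr

/-- Layer-cake estimate: the part of `log (1 / |⟨e, θ⟩|)` above the level `log (1 / w)` has
integral `O(w)`. -/
theorem lintegral_log_sub_log_le {e : Plane} (he : ‖e‖ = 1) {w : ℝ} (hw : 0 < w) :
    ∫⁻ θ, ENNReal.ofReal (Real.log w - Real.log |inner ℝ e (θ : Plane)|) ∂arcLength ≤
      ENNReal.ofReal (8 * w) := by
  have hmeas : Measurable fun θ : Circ =>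
      max (Real.log w - Real.log |inner ℝ e (θ : Plane)|) 0 :=
    (measurable_const.sub (Real.measurable_log.comp (measurable_inner_coe e).abs)).max
      measurable_const
  have h1 : ∀ θ : Circ, ENNReal.ofReal (Real.log w - Real.log |inner ℝ e (θ : Plane)|) =
      ENNReal.ofReal (max (Real.log w - Real.log |inner ℝ e (θ : Plane)|) 0) := fun θ => by
    simp [ENNReal.ofReal, Real.toNNReal]
  simp_rw [h1]
  rw [lintegral_eq_lintegral_meas_lt
    (f := fun θ : Circ => max (Real.log w - Real.log |inner ℝ e (θ : Plane)|) 0) _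
    (ae_of_all _ fun θ => le_max_right _ _) hmeas.aemeasurable]
  have h2 : ∀ t ∈ Ioi (0 : ℝ),
      arcLength {θ : Circ | t < max (Real.log w - Real.log |inner ℝ e (θ : Plane)|) 0} ≤
        ENNReal.ofReal (8 * w * Real.exp (-t)) := by
    intro t ht
    have ht0 : 0 < t := ht
    calc _ ≤ arcLength (band e (w * Real.exp (-t))) := by
          refine measure_mono fun θ hθ => ?_
          simp only [mem_ofPred_eq, lt_max_iff] at hθ
          rcases hθ with hθ | hθ
          swap
          · linarith
          show |inner ℝ e (θ : Plane)| < w * Real.exp (-t)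
          rcases (abs_nonneg (inner ℝ e (θ : Plane))).eq_or_lt with h0 | h0
          · rw [← h0]; positivity
          rw [← Real.log_lt_log_iff h0 (by positivity), Real.log_mul hw.ne' (Real.exp_pos _).ne',
            Real.log_exp]
          linarith
      _ ≤ _ := by
          refine (arcLength_band_le he (by positivity)).trans_eq ?_
          rw [mul_assoc]
  refine (setLIntegral_mono (by fun_prop) h2).trans_eq ?_
  rw [← ofReal_integral_eq_lintegral_ofReal, integral_const_mul, integral_exp_neg_Ioi]
  · simp
  · exact (integrableOn_exp_neg_Ioi 0).const_mul _
  · exact ae_of_all _ fun t => by positivity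

/-- The logarithmic kernel `log (|ξ| / |⟨ξ, θ⟩|)`. It vanishes by convention when `⟨ξ, θ⟩ = 0`,
in particular for `ξ = 0`. -/
def logKer (ξ : Plane) (θ : Circ) : ℝ := -Real.log |inner ℝ (‖ξ‖⁻¹ • ξ) (θ : Plane)|

/-- The function `m(ξ) = ∫ Ω(θ) log (|ξ| / |⟨ξ, θ⟩|) dθ`, which is the Fourier multiplier of `T_Ω`
for even `Ω` of mean zero. -/
def symb (Ω : Circ → ℝ) (ξ : Plane) : ℝ := ∫ θ, Ω θ * logKer ξ θ ∂arcLength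

theorem norm_coe_circ (θ : Circ) : ‖(θ : Plane)‖ = 1 := by simp

theorem logKer_eq {e : Plane} (he : ‖e‖ = 1) (θ : Circ) :
    logKer e θ = -Real.log |inner ℝ e (θ : Plane)| := by
  simp [logKer, he]

theorem logKer_smul {c : ℝ} (hc : 0 < c) (ξ : Plane) (θ : Circ) :
    logKer (c • ξ) θ = logKer ξ θ := by
  have : ‖c • ξ‖⁻¹ • c • ξ = ‖ξ‖⁻¹ • ξ := by
    rw [norm_smul, smul_smul, Real.norm_of_nonneg hc.le, mul_inv, mul_right_comm,
      inv_mul_cancel₀ hc.ne', one_mul]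
  unfold logKer
  rw [this]

theorem symb_smul (Ω : Circ → ℝ) {c : ℝ} (hc : 0 < c) (ξ : Plane) :
    symb Ω (c • ξ) = symb Ω ξ := by
  simp only [symb, logKer_smul hc]

theorem norm_normalize {ξ : Plane} (hξ : ξ ≠ 0) : ‖‖ξ‖⁻¹ • ξ‖ = 1 := by
  simp [norm_smul, hξ]

theorem logKer_normalize (ξ : Plane) (θ : Circ) : logKer (‖ξ‖⁻¹ • ξ) θ = logKer ξ θ := by
  rcases eq_or_ne ξ 0 with rfl | h
  · simp
  · exact logKer_smul (by positivity) _ _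

theorem symb_normalize (Ω : Circ → ℝ) (ξ : Plane) : symb Ω (‖ξ‖⁻¹ • ξ) = symb Ω ξ := by
  simp only [symb, logKer_normalize]

theorem logKer_zero (θ : Circ) : logKer 0 θ = 0 := by simp [logKer]

theorem abs_inner_coe_le {e : Plane} (he : ‖e‖ = 1) (θ : Circ) :
    |inner ℝ e (θ : Plane)| ≤ 1 := by
  have := abs_real_inner_le_norm e (θ : Plane)
  rwa [he, norm_coe_circ, one_mul] at this

theorem logKer_nonneg (ξ : Plane) (θ : Circ) : 0 ≤ logKer ξ θ := by
  rcases eq_or_ne ξ 0 with rfl | h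
  · simp [logKer]
  · unfold logKer
    have := Real.log_nonpos (abs_nonneg _) (abs_inner_coe_le (norm_normalize h) θ)
    linarith

theorem measurable_logKer : Measurable fun p : Plane × Circ => logKer p.1 p.2 := by
  unfold logKer
  have h1 : Measurable fun p : Plane × Circ => ‖p.1‖⁻¹ • p.1 := by fun_prop
  have h2 : Measurable fun p : Plane × Circ => (p.2 : Plane) := by fun_prop
  have h3 : Measurable fun p : Plane × Circ => inner ℝ (‖p.1‖⁻¹ • p.1) (p.2 : Plane) :=
    h1.inner h2
  exact (Real.measurable_log.comp h3.abs).neg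

theorem measurable_logKer_right (ξ : Plane) : Measurable (logKer ξ) :=
  (Real.measurable_log.comp (measurable_inner_coe (‖ξ‖⁻¹ • ξ)).abs).neg

theorem lintegral_logKer_le (ξ : Plane) :
    ∫⁻ θ, ENNReal.ofReal (logKer ξ θ) ∂arcLength ≤ ENNReal.ofReal 8 := by
  rcases eq_or_ne ξ 0 with rfl | h
  · simp [logKer]
  · simpa [logKer] using lintegral_log_sub_log_le (norm_normalize h) one_pos

theorem integrable_logKer (ξ : Plane) : Integrable (logKer ξ) arcLength := by
  refine ⟨(measurable_logKer_right ξ).aestronglyMeasurable, ?_⟩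
  rw [hasFiniteIntegral_iff_ofReal (ae_of_all _ (logKer_nonneg ξ))]
  exact (lintegral_logKer_le ξ).trans_lt ENNReal.ofReal_lt_top

theorem integral_logKer_le (ξ : Plane) : ∫ θ, logKer ξ θ ∂arcLength ≤ 8 := by
  rw [integral_eq_lintegral_of_nonneg_ae (ae_of_all _ (logKer_nonneg ξ))
    (measurable_logKer_right ξ).aestronglyMeasurable]
  exact ENNReal.toReal_le_of_le_ofReal (by norm_num) (lintegral_logKer_le ξ)

theorem ae_inner_ne_zero {ξ : Plane} (hξ : ξ ≠ 0) :
    ∀ᵐ θ : Circ ∂arcLength, inner ℝ ξ (θ : Plane) ≠ 0 := by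
  rw [ae_iff]
  refine le_antisymm (ENNReal.le_of_forall_pos_le_add fun δ hδ _ => ?_) zero_le
  have h := arcLength_band_le (norm_normalize hξ) (s := δ / 8) (by positivity)
  rw [zero_add]
  have hsub : {θ : Circ | ¬inner ℝ ξ (θ : Plane) ≠ 0} ⊆ band (‖ξ‖⁻¹ • ξ) (δ / 8) := by
    intro θ hθ
    simp only [ne_eq, not_not, mem_ofPred_eq] at hθ
    show |inner ℝ (‖ξ‖⁻¹ • ξ) (θ : Plane)| < δ / 8
    rw [inner_smul_left, hθ]
    simp [hδ]
  refine ((measure_mono hsub).trans h).trans_eq ?_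
  rw [mul_div_cancel₀ _ (by norm_num)]
  simp

/-! ### Young functions -/

section Young

variable {Φ : ℝ → ℝ} (hΦ : IsYoungFunction Φ)

include hΦ

theorem IsYoungFunction.map_zero : Φ 0 = 0 := by
  obtain ⟨⟨φ, -, -, -, -, h⟩, -⟩ := hΦ
  simpa using h 0 le_rfl

/-- A Young function has a nonnegative subgradient at every point of `[0, ∞)`. -/
theorem IsYoungFunction.exists_subgradient {x : ℝ} (hx : 0 ≤ x) :
    ∃ d, 0 ≤ d ∧ ∀ y, 0 ≤ y → Φ x + d * (y - x) ≤ Φ y := by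
  obtain ⟨⟨φ, hmono, -, -, hpos, h⟩, -⟩ := hΦ
  refine ⟨φ x, hpos x hx, fun y hy => ?_⟩
  have hint : ∀ a b : ℝ, 0 ≤ a → 0 ≤ b → IntervalIntegrable φ volume a b := fun a b ha hb =>
    MonotoneOn.intervalIntegrable (hmono.mono fun t ht => by
      rcases le_total a b with hab | hab
      · rw [uIcc_of_le hab] at ht; exact ha.trans ht.1
      · rw [uIcc_of_ge hab] at ht; exact hb.trans ht.1)
  have hadd : Φ x + ∫ u in x..y, φ u = Φ y := by
    rw [h x hx, h y hy]
    exact intervalIntegral.integral_add_adjacent_intervals (hint _ _ le_rfl hx) (hint _ _ hx hy)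
  rw [← hadd]
  gcongr
  rcases le_total x y with hxy | hxy
  · have := intervalIntegral.integral_mono_on (f := fun _ => φ x) hxy (by simp)
      (hint x y hx hy) (fun u hu => hmono (mem_Ici.2 hx) (mem_Ici.2 (hx.trans hu.1)) hu.1)
    simp only [intervalIntegral.integral_const, smul_eq_mul] at this
    linarith
  · have := intervalIntegral.integral_mono_on (g := fun _ => φ x) hxy (hint y x hy hx) (by simp)
      (fun u hu => hmono (mem_Ici.2 (hy.trans hu.1)) (mem_Ici.2 hx) hu.2)
    simp only [intervalIntegral.integral_const, smul_eq_mul] at this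
    rw [intervalIntegral.integral_symm]
    linarith

theorem IsYoungFunction.mono {x y : ℝ} (hx : 0 ≤ x) (hxy : x ≤ y) : Φ x ≤ Φ y := by
  obtain ⟨d, hd, h⟩ := hΦ.exists_subgradient hx
  have := h y (hx.trans hxy)
  nlinarith [mul_nonneg hd (sub_nonneg.2 hxy)]

theorem IsYoungFunction.nonneg {x : ℝ} (hx : 0 ≤ x) : 0 ≤ Φ x := by
  simpa [hΦ.map_zero] using hΦ.mono le_rfl hx

theorem IsYoungFunction.measurable_comp_abs : Measurable fun t => Φ |t| := by
  have h : Monotone fun t => Φ (max t 0) := fun s t hst =>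
    hΦ.mono (le_max_right _ _) (max_le_max_right 0 hst)
  have := h.measurable.comp (measurable_id.abs : Measurable fun t : ℝ => |t|)
  have heq : (fun t => Φ |t|) = (fun t => Φ (max t 0)) ∘ fun t => |t| := by
    funext t
    simp
  rw [heq]
  exact this

/-- Jensen's inequality for countable subconvex combinations. -/
theorem IsYoungFunction.ofReal_le_tsum {ι : Type*} {c x : ι → ℝ} {C X : ℝ}
    (hc : ∀ i, 0 ≤ c i) (hx : ∀ i, 0 ≤ x i) (hC : HasSum c C) (hC1 : C ≤ 1)
    (hX : HasSum (fun i => c i * x i) X) :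
    ENNReal.ofReal (Φ X) ≤ ∑' i, ENNReal.ofReal (c i * Φ (x i)) := by
  by_cases htop : ∑' i, ENNReal.ofReal (c i * Φ (x i)) = ∞
  · simp [htop]
  have hX0 : 0 ≤ X := hX.nonneg fun i => mul_nonneg (hc i) (hx i)
  have hnn : ∀ i, 0 ≤ c i * Φ (x i) := fun i => mul_nonneg (hc i) (hΦ.nonneg (hx i))
  have hsum : Summable fun i => c i * Φ (x i) := by
    refine (ENNReal.summable_toReal htop).congr fun i => ?_
    rw [ENNReal.toReal_ofReal (hnn i)]
  rw [← ENNReal.ofReal_tsum_of_nonneg hnn hsum]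
  refine ENNReal.ofReal_le_ofReal ?_
  obtain ⟨d, hd, h⟩ := hΦ.exists_subgradient hX0
  have h0 := h 0 le_rfl
  rw [hΦ.map_zero] at h0
  have hs : HasSum (fun i => c i * Φ X + (d * (c i * x i) - c i * (d * X)))
      (C * Φ X + (d * X - C * (d * X))) :=
    (hC.mul_right _).add ((hX.mul_left _).sub (hC.mul_right _))
  have hle := hasSum_le (fun i => ?_) hs hsum.hasSum
  · refine le_trans ?_ hle
    nlinarith
  · have := mul_le_mul_of_nonneg_left (h (x i) (hx i)) (hc i)
    linarith

theorem IsYoungFunction.eventually_le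
    (hΨ : Tendsto (fun t : ℝ => t * Real.log (Real.exp 1 + t) / Φ t) atTop atTop)
    {δ : ℝ} (hδ : 0 < δ) :
    ∀ᶠ t in atTop, Φ t ≤ δ * (t * Real.log (Real.exp 1 + t)) := by
  filter_upwards [hΨ.eventually_ge_atTop δ⁻¹, hΦ.2.eventually_gt_atTop 0, eventually_gt_atTop 0]
    with t h1 h2 h3
  have hp : 0 < Φ t := by
    by_contra hn
    exact h2.not_ge (div_nonpos_of_nonpos_of_nonneg (not_lt.1 hn) h3.le)
  rw [le_div_iff₀ hp, inv_mul_le_iff₀ hδ] at h1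
  exact h1

/-- A function of mass `c / log (1 / w)` spread evenly over a set of measure `μ` comparable to `w`
has a `Φ`-integral at most `1` if `w` is small. Its height is `V = O(1 / w)`, so that
`μ Φ(V) ≤ δ μ V log (e + V) ≤ 2 δ c` for small `w`; this is where `Φ(t) = o(t log t)` enters. -/
theorem IsYoungFunction.eventually_mul_le_one
    (hΨ : Tendsto (fun t : ℝ => t * Real.log (Real.exp 1 + t) / Φ t) atTop atTop)
    {c : ℝ} (hc : 0 < c) :
    ∀ᶠ w in 𝓝[>] (0 : ℝ), ∀ μ : ℝ, w / 2 ≤ μ → μ ≤ 8 * w →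
      μ * Φ (c * (μ * -Real.log w)⁻¹) ≤ 1 := by
  obtain ⟨V₀, hV₀⟩ := eventually_atTop.1 (hΦ.eventually_le hΨ (δ := 1 / (2 * c)) (by positivity))
  have hL : Tendsto (fun w : ℝ => -Real.log w) (𝓝[>] 0) atTop :=
    tendsto_neg_atBot_atTop.comp Real.tendsto_log_nhdsGT_zero
  have hwL : Tendsto (fun w : ℝ => Real.log w * w) (𝓝[>] 0) (𝓝 0) := by
    simpa using tendsto_log_mul_rpow_nhdsGT_zero one_pos
  have hwL' : ∀ᶠ w in 𝓝[>] (0 : ℝ), (max V₀ 1) * (-(8 * (Real.log w * w))) ≤ c := by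
    have : Tendsto (fun w : ℝ => (max V₀ 1) * (-(8 * (Real.log w * w)))) (𝓝[>] 0)
        (𝓝 ((max V₀ 1) * (-(8 * 0)))) := ((hwL.const_mul _).neg).const_mul _
    simp only [mul_zero, neg_zero] at this
    exact this.eventually_le_const hc
  filter_upwards [hwL', hL.eventually_ge_atTop 1, hL.eventually_ge_atTop (Real.log (3 + 2 * c)),
    self_mem_nhdsWithin] with w h1 h2 h3 hw μ hμ1 hμ2
  replace hw : 0 < w := hw
  set L := -Real.log w with hLdef
  have hμ : 0 < μ := by linarith
  have hV : V₀ ≤ c * (μ * L)⁻¹ := by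
    refine (le_max_left V₀ 1).trans ?_
    rw [← div_eq_mul_inv, le_div_iff₀ (by positivity)]
    refine le_trans ?_ h1
    gcongr
    nlinarith
  have hΦV := hV₀ _ hV
  set V := c * (μ * L)⁻¹ with hVdef
  have hVpos : 0 < V := by positivity
  have hμV : μ * V = c / L := by
    rw [hVdef]; field_simp
  have hVw : V ≤ 2 * c / w := by
    have h5 : w ≤ 2 * (μ * L) := by nlinarith
    rw [hVdef, ← div_eq_mul_inv, div_le_div_iff₀ (by positivity) hw]
    nlinarith
  have hw1 : w ≤ 1 := by
    by_contra hn
    have := Real.log_pos (not_le.1 hn)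
    linarith
  have hlog : Real.log (Real.exp 1 + V) ≤ 2 * L := by
    calc _ ≤ Real.log ((3 + 2 * c) / w) := by
          refine Real.log_le_log (by positivity) ?_
          have : Real.exp 1 ≤ 3 / w := by
            rw [le_div_iff₀ hw]
            nlinarith [Real.exp_one_lt_d9, Real.exp_pos 1]
          rw [add_div]
          linarith
      _ ≤ 2 * L := by
          rw [Real.log_div (by positivity) hw.ne']
          linarith
  calc μ * Φ V ≤ μ * (1 / (2 * c) * (V * Real.log (Real.exp 1 + V))) := by gcongr
    _ = 1 / (2 * c) * (c / L) * Real.log (Real.exp 1 + V) := by rw [← hμV]; ring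
    _ ≤ 1 / (2 * c) * (c / L) * (2 * L) := by gcongr
    _ = 1 := by field_simp

end Young

/-! ### Concentrated atoms -/

/-- The determinant of two plane vectors, whose vanishing expresses that they are parallel. -/
def cross (x y : Plane) : ℝ := x 0 * y 1 - x 1 * y 0

theorem inner_plane (x y : Plane) : inner ℝ x y = x 0 * y 0 + x 1 * y 1 := by
  simp [PiLp.inner_apply, mul_comm]

theorem norm_sq_plane (x : Plane) : ‖x‖ ^ 2 = x 0 ^ 2 + x 1 ^ 2 := by
  simp [EuclideanSpace.norm_sq_eq]

/-- A unit vector close to parallel to two unit vectors forces these to be close to parallel. -/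
theorem abs_cross_le_add {ξ e e' : Plane} (hξ : ‖ξ‖ = 1) (he : ‖e‖ = 1) (he' : ‖e'‖ = 1) :
    |cross e e'| ≤ |cross ξ e| + |cross ξ e'| := by
  have h1 := norm_sq_plane ξ
  rw [hξ] at h1
  have key : cross e e' = -(cross ξ e * inner ℝ ξ e') + inner ℝ ξ e * cross ξ e' := by
    rw [inner_plane, inner_plane]
    unfold cross
    linear_combination (e 0 * e' 1 - e 1 * e' 0) * h1
  rw [key]
  have a1 := abs_real_inner_le_norm ξ e
  have a2 := abs_real_inner_le_norm ξ e'
  rw [hξ, he, one_mul] at a1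
  rw [hξ, he', one_mul] at a2
  refine (abs_add_le _ _).trans ?_
  rw [abs_neg, abs_mul, abs_mul]
  nlinarith [abs_nonneg (cross ξ e), abs_nonneg (cross ξ e')]

/-- The directions in a thin band around the normal of `e` stay away from the normal of `ξ`, if `ξ`
is not nearly parallel to `e`. -/
theorem half_le_abs_inner_of_mem_band {ξ e : Plane} (hξ : ‖ξ‖ = 1) (he : ‖e‖ = 1) {d w : ℝ}
    (hw : w ≤ d / 4) (hd1 : d ≤ 1) (hd : d ≤ |cross ξ e|) {θ : Circ} (hθ : θ ∈ band e w) :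
    d / 2 ≤ |inner ℝ ξ (θ : Plane)| := by
  have h1 := norm_sq_plane e
  have h2 := norm_sq_plane (θ : Plane)
  rw [he] at h1
  rw [norm_coe_circ] at h2
  have hθ' : |inner ℝ e (θ : Plane)| < w := hθ
  have hw0 : 0 ≤ w := (abs_nonneg _).trans hθ'.le
  have key : inner ℝ ξ (θ : Plane) =
      inner ℝ ξ e * inner ℝ e (θ : Plane) + cross ξ e * cross (θ : Plane) e := by
    simp only [inner_plane]
    unfold cross
    linear_combination (ξ 0 * (θ : Plane) 0 + ξ 1 * (θ : Plane) 1) * h1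
  have key2 : cross (θ : Plane) e ^ 2 + inner ℝ e (θ : Plane) ^ 2 = 1 := by
    have : cross (θ : Plane) e ^ 2 + inner ℝ e (θ : Plane) ^ 2 =
      (e 0 ^ 2 + e 1 ^ 2) * ((θ : Plane) 0 ^ 2 + (θ : Plane) 1 ^ 2) := by
      rw [inner_plane]; unfold cross; ring
    rw [this, ← h1, ← h2]; norm_num
  have hsq : inner ℝ e (θ : Plane) ^ 2 ≤ 1 / 16 := by
    rw [← sq_abs]
    nlinarith [abs_nonneg (inner ℝ e (θ : Plane))]
  have hc : 3 / 4 ≤ |cross (θ : Plane) e| := by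
    refine abs_le_of_sq_le_sq' ?_ (abs_nonneg _) |>.2
    rw [sq_abs]
    linarith
  have a1 := abs_real_inner_le_norm ξ e
  rw [hξ, he, one_mul] at a1
  have h3 : |cross ξ e * cross (θ : Plane) e| - |inner ℝ ξ e * inner ℝ e (θ : Plane)| ≤
      |inner ℝ ξ (θ : Plane)| := by
    rw [key, add_comm]
    have := abs_sub_abs_le_abs_sub (cross ξ e * cross (θ : Plane) e)
      (-(inner ℝ ξ e * inner ℝ e (θ : Plane)))
    rwa [abs_neg, sub_neg_eq_add] at this
  rw [abs_mul, abs_mul] at h3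
  have h4 : |inner ℝ ξ e| * |inner ℝ e (θ : Plane)| ≤ d / 4 := by
    nlinarith [abs_nonneg (inner ℝ ξ e), abs_nonneg (inner ℝ e (θ : Plane))]
  have h5 : d * (3 / 4) ≤ |cross ξ e| * |cross (θ : Plane) e| := by
    refine mul_le_mul hd hc (by norm_num) (abs_nonneg _)
  linarith

/-- The normalized indicator of a thin band, of mass `1 / log (1 / w)`. -/
def atom (e : Plane) (w : ℝ) : Circ → ℝ :=
  (band e w).indicator fun _ => (arcLength.real (band e w) * -Real.log w)⁻¹

theorem measurable_atom (e : Plane) (w : ℝ) : Measurable (atom e w) :=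
  measurable_const.indicator (measurableSet_band e w)

theorem atom_neg (e : Plane) (w : ℝ) (θ : Circ) : atom e w (-θ) = atom e w θ := by
  have : -θ ∈ band e w ↔ θ ∈ band e w := by simp [band]
  by_cases h : θ ∈ band e w <;> simp [atom, this, h]

theorem neg_log_pos {w : ℝ} (hw : 0 < w) (hw1 : w < 1) : 0 < -Real.log w :=
  neg_pos.2 (Real.log_neg hw hw1)

section Atom

variable {e ξ : Plane} {w : ℝ} (he : ‖e‖ = 1) (hw : 0 < w) (hw1 : w < 1)

theorem atom_nonneg (hw : 0 < w) (hw1 : w < 1) (θ : Circ) : 0 ≤ atom e w θ :=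
  indicator_nonneg (fun _ _ => by
    have := neg_log_pos hw hw1
    positivity) θ

include he hw hw1

theorem le_real_band : w / 2 ≤ arcLength.real (band e w) := by
  have h := ENNReal.toReal_mono (measure_ne_top _ _) (le_arcLength_band he hw hw1.le)
  rwa [ENNReal.toReal_ofReal (by positivity)] at h

omit hw1 in
theorem real_band_le : arcLength.real (band e w) ≤ 8 * w :=
  ENNReal.toReal_le_of_le_ofReal (by positivity) (arcLength_band_le he hw.le)

theorem real_band_pos : 0 < arcLength.real (band e w) := by
  have := le_real_band he hw hw1
  linarith

theorem integral_atom : ∫ θ, atom e w θ ∂arcLength = (-Real.log w)⁻¹ := by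
  have h := real_band_pos he hw hw1
  have hL := neg_log_pos hw hw1
  unfold atom
  rw [integral_indicator_const _ (measurableSet_band e w), smul_eq_mul]
  field_simp

omit he hw hw1 in
theorem integrable_atom : Integrable (atom e w) arcLength :=
  (integrable_const _).indicator (measurableSet_band e w)

omit he hw hw1 in
theorem atom_mul_logKer (θ : Circ) : atom e w θ * logKer ξ θ =
    (arcLength.real (band e w) * -Real.log w)⁻¹ * (band e w).indicator (logKer ξ) θ := by
  unfold atom
  by_cases h : θ ∈ band e w <;> simp [h]

omit he hw hw1 in
theorem integrable_atom_mul_logKer :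
    Integrable (fun θ => atom e w θ * logKer ξ θ) arcLength := by
  simp_rw [atom_mul_logKer]
  exact ((integrable_logKer ξ).indicator (measurableSet_band e w)).const_mul _

omit he hw hw1 in
theorem symb_atom : symb (atom e w) ξ = (arcLength.real (band e w) * -Real.log w)⁻¹ *
    ∫ θ in band e w, logKer ξ θ ∂arcLength := by
  unfold symb
  simp_rw [atom_mul_logKer]
  rw [integral_const_mul, integral_indicator (measurableSet_band e w)]

omit he in
theorem symb_atom_nonneg : 0 ≤ symb (atom e w) ξ :=
  integral_nonneg fun θ => mul_nonneg (atom_nonneg hw hw1 θ) (logKer_nonneg ξ θ)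

theorem symb_atom_le_of_forall {B : ℝ} (h : ∀ θ ∈ band e w, logKer ξ θ ≤ B) :
    symb (atom e w) ξ ≤ B / -Real.log w := by
  have hb := real_band_pos he hw hw1
  have hL := neg_log_pos hw hw1
  have h1 : ∫ θ in band e w, logKer ξ θ ∂arcLength ≤ ∫ θ in band e w, B ∂arcLength :=
    setIntegral_mono_on (integrable_logKer ξ).integrableOn (integrable_const _).integrableOn
      (measurableSet_band e w) h
  rw [setIntegral_const, smul_eq_mul] at h1
  rw [symb_atom, inv_mul_le_iff₀ (by positivity)]
  refine h1.trans_eq ?_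
  generalize -Real.log w = L at hL
  field_simp

theorem symb_atom_far (hξ : ‖ξ‖ = 1) {d : ℝ} (hwd : w ≤ d / 4) (hd1 : d ≤ 1)
    (hd : d ≤ |cross ξ e|) : symb (atom e w) ξ ≤ Real.log (2 / d) / -Real.log w := by
  have hd0 : 0 < d := by linarith
  refine symb_atom_le_of_forall he hw hw1 fun θ hθ => ?_
  rw [logKer_eq hξ, ← Real.log_inv]
  have h := half_le_abs_inner_of_mem_band hξ he hwd hd1 hd hθ
  refine Real.log_le_log (inv_pos.2 (by linarith)) ?_
  rw [inv_le_comm₀ (by linarith) (by positivity), inv_div]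
  exact h

theorem one_le_symb_atom : 1 ≤ symb (atom e w) e := by
  have hb := real_band_pos he hw hw1
  have hL := neg_log_pos hw hw1
  have hne : e ≠ 0 := fun h => by simp [h] at he
  have h1 : ∫ θ in band e w, -Real.log w ∂arcLength ≤ ∫ θ in band e w, logKer e θ ∂arcLength := by
    refine setIntegral_mono_on_ae (integrable_const _).integrableOn
      (integrable_logKer e).integrableOn (measurableSet_band e w) ?_
    filter_upwards [ae_inner_ne_zero hne] with θ h0 hθ
    rw [logKer_eq he]
    exact neg_le_neg (Real.log_le_log (abs_pos.2 h0) (le_of_lt hθ))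
  rw [setIntegral_const, smul_eq_mul] at h1
  rw [symb_atom, ← div_eq_inv_mul, le_div_iff₀ (by positivity), one_mul]
  exact h1

/-- Among all directions the symbol of an atom is essentially largest at its own direction. -/
theorem symb_atom_le (hξ : ‖ξ‖ = 1) : symb (atom e w) ξ ≤ 1 + 16 / -Real.log w := by
  have hb := real_band_pos he hw hw1
  have hL := neg_log_pos hw hw1
  have hlow := le_real_band he hw hw1
  set G : Circ → ℝ := fun θ => max (Real.log w - Real.log |inner ℝ ξ (θ : Plane)|) 0
  have hGm : Measurable G :=
    (measurable_const.sub (Real.measurable_log.comp (measurable_inner_coe ξ).abs)).max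
      measurable_const
  have hGl : ∫⁻ θ, ENNReal.ofReal (G θ) ∂arcLength ≤ ENNReal.ofReal (8 * w) := by
    refine le_trans (lintegral_mono fun θ => ?_) (lintegral_log_sub_log_le hξ hw)
    simp [G, ENNReal.ofReal, Real.toNNReal]
  have hG0 : 0 ≤ᵐ[arcLength] G := ae_of_all _ fun θ => le_max_right _ _
  have hGi : Integrable G arcLength := by
    refine ⟨hGm.aestronglyMeasurable, ?_⟩
    rw [hasFiniteIntegral_iff_ofReal hG0]
    exact hGl.trans_lt ENNReal.ofReal_lt_top
  have hGint : ∫ θ, G θ ∂arcLength ≤ 8 * w := by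
    rw [integral_eq_lintegral_of_nonneg_ae hG0 hGm.aestronglyMeasurable]
    exact ENNReal.toReal_le_of_le_ofReal (by positivity) hGl
  have h1 : ∫ θ in band e w, logKer ξ θ ∂arcLength ≤
      ∫ θ in band e w, (-Real.log w + G θ) ∂arcLength := by
    refine setIntegral_mono_on (integrable_logKer ξ).integrableOn
      ((integrable_const _).add hGi).integrableOn (measurableSet_band e w) fun θ _ => ?_
    rw [logKer_eq hξ]
    have := le_max_left (Real.log w - Real.log |inner ℝ ξ (θ : Plane)|) 0
    linarith
  rw [integral_add (integrable_const _).integrableOn hGi.integrableOn, setIntegral_const,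
    smul_eq_mul] at h1
  have h2 : ∫ θ in band e w, G θ ∂arcLength ≤ 8 * w :=
    (setIntegral_le_integral hGi hG0).trans hGint
  rw [symb_atom, inv_mul_le_iff₀ (by positivity)]
  refine (h1.trans (add_le_add_right h2 _)).trans ?_
  have : arcLength.real (band e w) * -Real.log w * (1 + 16 / -Real.log w) =
      arcLength.real (band e w) * -Real.log w + 16 * arcLength.real (band e w) := by
    generalize -Real.log w = L at hL
    field_simp
  rw [this]
  linarith

omit he hw hw1 in
theorem lintegral_young_atom {Φ : ℝ → ℝ} (hΦ : IsYoungFunction Φ) (c : ℝ) :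
    ∫⁻ θ, ENNReal.ofReal (Φ (c * atom e w θ)) ∂arcLength =
      ENNReal.ofReal (arcLength.real (band e w) *
        Φ (c * (arcLength.real (band e w) * -Real.log w)⁻¹)) := by
  have h : ∀ θ, ENNReal.ofReal (Φ (c * atom e w θ)) = (band e w).indicator (fun _ =>
      ENNReal.ofReal (Φ (c * (arcLength.real (band e w) * -Real.log w)⁻¹))) θ := by
    intro θ
    unfold atom
    by_cases hθ : θ ∈ band e w <;> simp [hθ, hΦ.map_zero]
  simp_rw [h]
  rw [lintegral_indicator_const (measurableSet_band e w),
    ENNReal.ofReal_mul measureReal_nonneg, ofReal_measureReal, mul_comm]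

end Atom

/-! ### Blocks of atoms -/

/-- The symbol of a bounded function is continuous away from the origin: cutting the logarithm off
at height `log (1 / w)` changes it by `O(w)`, uniformly in the direction. -/
theorem continuousAt_symb {Ω : Circ → ℝ} (hΩ : Measurable Ω) {B : ℝ} (hB : ∀ θ, |Ω θ| ≤ B)
    {ξ : Plane} (hξ : ξ ≠ 0) : ContinuousAt (symb Ω) ξ := by
  have hB0 : 0 ≤ B := (abs_nonneg _).trans (hB (direction ξ hξ))
  set F : ℝ → Plane → ℝ := fun w ζ => ∫ θ, Ω θ *
    -Real.log (max |inner ℝ (‖ζ‖⁻¹ • ζ) (θ : Plane)| w) ∂arcLength with hF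
  have happrox : ∀ w, 0 < w → w < 1 → ∀ ζ : Plane, ζ ≠ 0 → |symb Ω ζ - F w ζ| ≤ B * (8 * w) := by
    intro w hw hw1 ζ hζ
    have he := norm_normalize hζ
    set e := ‖ζ‖⁻¹ • ζ
    set G : Circ → ℝ := fun θ => max (Real.log w - Real.log |inner ℝ e (θ : Plane)|) 0
    have hGm : Measurable G :=
      (measurable_const.sub (Real.measurable_log.comp (measurable_inner_coe e).abs)).max
        measurable_const
    have hGl : ∫⁻ θ, ENNReal.ofReal (G θ) ∂arcLength ≤ ENNReal.ofReal (8 * w) := by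
      refine le_trans (lintegral_mono fun θ => ?_) (lintegral_log_sub_log_le he hw)
      simp [G, ENNReal.ofReal, Real.toNNReal]
    have hG0 : 0 ≤ᵐ[arcLength] G := ae_of_all _ fun θ => le_max_right _ _
    have hGi : Integrable G arcLength := by
      refine ⟨hGm.aestronglyMeasurable, ?_⟩
      rw [hasFiniteIntegral_iff_ofReal hG0]
      exact hGl.trans_lt ENNReal.ofReal_lt_top
    have hGint : ∫ θ, G θ ∂arcLength ≤ 8 * w := by
      rw [integral_eq_lintegral_of_nonneg_ae hG0 hGm.aestronglyMeasurable]
      exact ENNReal.toReal_le_of_le_ofReal (by positivity) hGl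
    have hdiff : symb Ω ζ - F w ζ = ∫ θ, Ω θ * G θ ∂arcLength := by
      have hi1 : Integrable (fun θ => Ω θ * logKer ζ θ) arcLength :=
        (integrable_logKer ζ).bdd_mul hΩ.aestronglyMeasurable (c := B) (ae_of_all _ hB)
      have hi3 : Integrable (fun θ => Ω θ * G θ) arcLength :=
        hGi.bdd_mul hΩ.aestronglyMeasurable (c := B) (ae_of_all _ hB)
      have hae : ∀ᵐ θ ∂arcLength, Ω θ * -Real.log (max |inner ℝ e (θ : Plane)| w) =
          Ω θ * logKer ζ θ - Ω θ * G θ := by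
        filter_upwards [ae_inner_ne_zero hζ] with θ h0
        have h1 : 0 < |inner ℝ e (θ : Plane)| := by
          rw [abs_pos, inner_smul_left]
          simpa [hζ] using h0
        rw [← mul_sub]
        congr 1
        simp only [G, logKer]
        rcases le_total w |inner ℝ e (θ : Plane)| with h | h
        · rw [max_eq_left h, max_eq_right (sub_nonpos.2 (Real.log_le_log hw h)), sub_zero]
        · rw [max_eq_right h, max_eq_left (sub_nonneg.2 (Real.log_le_log h1 h))]
          ring
      simp only [symb, hF]
      rw [integral_congr_ae hae, integral_sub hi1 hi3]
      ring
    rw [hdiff]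
    calc |∫ θ, Ω θ * G θ ∂arcLength| ≤ ∫ θ, B * G θ ∂arcLength := by
          rw [← Real.norm_eq_abs]
          refine norm_integral_le_of_norm_le (hGi.const_mul B) (ae_of_all _ fun θ => ?_)
          rw [norm_mul, Real.norm_of_nonneg (le_max_right _ _ : 0 ≤ G θ)]
          exact mul_le_mul_of_nonneg_right (hB θ) (le_max_right _ _)
      _ ≤ B * (8 * w) := by
          rw [integral_const_mul]
          gcongr
  have hFc : ∀ w, 0 < w → w < 1 → ContinuousAt (F w) ξ := by
    intro w hw hw1
    refine continuousAt_of_dominated (bound := fun _ => B * (-Real.log w)) ?_ ?_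
      (integrable_const _) ?_
    · refine Eventually.of_forall fun ζ => (hΩ.mul ?_).aestronglyMeasurable
      exact (Real.measurable_log.comp ((measurable_inner_coe _).abs.max measurable_const)).neg
    · filter_upwards [isOpen_ne.mem_nhds hξ] with ζ hζ
      refine ae_of_all _ fun θ => ?_
      have h1 := abs_inner_coe_le (norm_normalize hζ) θ
      have h2 : w ≤ max |inner ℝ (‖ζ‖⁻¹ • ζ) (θ : Plane)| w := le_max_right _ _
      have h3 : max |inner ℝ (‖ζ‖⁻¹ • ζ) (θ : Plane)| w ≤ 1 := max_le h1 hw1.le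
      have h4 := Real.log_le_log hw h2
      have h5 := Real.log_nonpos (hw.le.trans h2) h3
      rw [norm_mul, norm_neg, Real.norm_of_nonpos h5]
      exact mul_le_mul (hB θ) (by linarith) (by linarith) hB0
    · refine ae_of_all _ fun θ => ?_
      have hin : ContinuousAt (fun ζ : Plane => inner ℝ (‖ζ‖⁻¹ • ζ) (θ : Plane)) ξ := by
        have : ContinuousAt (fun ζ : Plane => ‖ζ‖⁻¹ • ζ) ξ :=
          (continuousAt_id.norm.inv₀ (by simpa using hξ)).smul continuousAt_id
        exact this.inner continuousAt_const
      refine ContinuousAt.mul continuousAt_const (ContinuousAt.neg ?_)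
      exact (hin.abs.max continuousAt_const).log (by positivity)
  rw [Metric.continuousAt_iff']
  intro δ hδ
  obtain ⟨w, hw, hw1, hwδ⟩ : ∃ w, 0 < w ∧ w < 1 ∧ B * (8 * w) ≤ δ / 4 := by
    refine ⟨min (1 / 2) (δ / (32 * (B + 1))), by positivity, ?_, ?_⟩
    · exact (min_le_left _ _).trans_lt (by norm_num)
    · calc B * (8 * min (1 / 2) (δ / (32 * (B + 1)))) ≤ (B + 1) * (8 * (δ / (32 * (B + 1)))) := by
            gcongr
            · linarith
            · exact min_le_right _ _
        _ = δ / 4 := by field_simp; norm_num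
  have hc := Metric.continuousAt_iff'.1 (hFc w hw hw1) (δ / 4) (by positivity)
  filter_upwards [hc, isOpen_ne.mem_nhds hξ] with ζ h1 hζ
  have h2 := happrox w hw hw1 ζ hζ
  have h3 := happrox w hw hw1 ξ hξ
  rw [Real.dist_eq] at h1 ⊢
  have : symb Ω ζ - symb Ω ξ = (symb Ω ζ - F w ζ) + (F w ζ - F w ξ) - (symb Ω ξ - F w ξ) := by ring
  rw [this]
  have h4 := abs_sub ((symb Ω ζ - F w ζ) + (F w ζ - F w ξ)) (symb Ω ξ - F w ξ)
  have h5 := abs_add_le (symb Ω ζ - F w ζ) (F w ζ - F w ξ)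
  linarith

theorem half_le_real_univ : 1 / 2 ≤ arcLength.real univ := by
  obtain ⟨e, he⟩ : ∃ e : Plane, ‖e‖ = 1 := ⟨EuclideanSpace.single 0 1, by simp⟩
  have h := ENNReal.toReal_mono (measure_ne_top _ _) (le_arcLength_band he one_pos le_rfl)
  rw [ENNReal.toReal_ofReal (by norm_num)] at h
  exact h.trans (measureReal_mono (subset_univ _))

/-- Given finitely many pairwise nonparallel directions `e i` with signs `ε i`, there is a function
`Ω` of `L¹` norm at most `1` and controlled `Φ`-integral, whose symbol is bounded by an absolute
constant, is close to `ε i` at `e i`, and is small at finitely many further directions. -/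
theorem exists_block {Φ : ℝ → ℝ} (hΦ : IsYoungFunction Φ)
    (hΨ : Tendsto (fun t : ℝ => t * Real.log (Real.exp 1 + t) / Φ t) atTop atTop)
    {ι : Type} [Fintype ι] [Nonempty ι] {e : ι → Plane} (he : ∀ i, ‖e i‖ = 1)
    (hsep : ∀ i j, i ≠ j → cross (e i) (e j) ≠ 0) {ε : ι → ℝ} (hε : ∀ i, |ε i| = 1)
    {E : Finset Plane} (hE : ∀ ξ ∈ E, ‖ξ‖ = 1 ∧ ∀ i, cross ξ (e i) ≠ 0) {τ : ℝ} (hτ : 0 < τ) :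
    ∃ Ω : Circ → ℝ, Measurable Ω ∧ (∃ B, ∀ θ, |Ω θ| ≤ B) ∧ (∀ θ, Ω (-θ) = Ω θ) ∧
      ∫ θ, Ω θ ∂arcLength = 0 ∧ ∫ θ, |Ω θ| ∂arcLength ≤ 1 ∧
      (∀ ξ, ∫ θ, |Ω θ| * logKer ξ θ ∂arcLength ≤ 4) ∧
      ∫⁻ θ, ENNReal.ofReal (Φ |Ω θ|) ∂arcLength ≤
        ENNReal.ofReal (1 + Φ 1 * arcLength.real univ) ∧
      (∀ i, |symb Ω (e i) - ε i| ≤ τ) ∧ ∀ ξ ∈ E, |symb Ω ξ| ≤ τ := by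
  classical
  obtain ⟨N, hN⟩ : ∃ N : ℝ, N = (Fintype.card ι : ℝ) := ⟨_, rfl⟩
  have hN0 : 0 < N := by rw [hN]; exact_mod_cast Fintype.card_pos
  -- The number `d` bounds the angles between the given lines from below, with a factor `2` to spare
  -- among the `e i`: no `ξ` is then within angle `d` of two of them.
  obtain ⟨d, hd0, hd1, hdsep, hdE⟩ : ∃ d : ℝ, 0 < d ∧ d ≤ 1 ∧
      (∀ i j, i ≠ j → 2 * d ≤ |cross (e i) (e j)|) ∧ ∀ ξ ∈ E, ∀ i, d ≤ |cross ξ (e i)| := by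
    have h0 : ∀ᶠ d : ℝ in 𝓝[>] 0, 0 < d := self_mem_nhdsWithin
    have hc : ∀ a : ℝ, 0 < a → ∀ᶠ d : ℝ in 𝓝[>] 0, 2 * d ≤ a := fun a ha => by
      have : Tendsto (fun d : ℝ => 2 * d) (𝓝[>] 0) (𝓝 (2 * 0)) :=
        (tendsto_id.mono_left nhdsWithin_le_nhds).const_mul 2
      exact this.eventually_le_const (by simpa using ha)
    have h2 : ∀ᶠ d : ℝ in 𝓝[>] 0, ∀ i j, i ≠ j → 2 * d ≤ |cross (e i) (e j)| := by
      refine eventually_all.2 fun i => eventually_all.2 fun j => ?_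
      by_cases hij : i = j
      · exact Eventually.of_forall fun d h => absurd hij h
      · filter_upwards [hc _ (abs_pos.2 (hsep i j hij))] with d hd _ using hd
    have h3 : ∀ᶠ d : ℝ in 𝓝[>] 0, ∀ ξ ∈ E, ∀ i, 2 * d ≤ |cross ξ (e i)| := by
      refine (Finset.eventually_all E).2 fun ξ hξ => eventually_all.2 fun i => ?_
      exact hc _ (abs_pos.2 ((hE ξ hξ).2 i))
    obtain ⟨d, a, b, c, f⟩ := (h0.and ((hc 1 one_pos).and (h2.and h3))).exists
    exact ⟨d, a, by linarith, c, fun ξ hξ i => by linarith [f ξ hξ i]⟩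
  have hlogd : 0 ≤ Real.log (2 / d) := Real.log_nonneg (by rw [le_div_iff₀ hd0]; linarith)
  -- The width `w` of the atoms is so small that, summed over the `N` directions, both the
  -- interaction `log (2 / d) / log (1 / w)` of different atoms and their masses `1 / log (1 / w)`
  -- are negligible.
  set t := min (τ / 4) (1 / 16) with ht
  have ht0 : 0 < t := by positivity
  have ht1 : t ≤ τ / 4 := min_le_left _ _
  have ht2 : t ≤ 1 / 16 := min_le_right _ _
  obtain ⟨w, hw, hw1, hwd, hL1, hL2, hL3, hwΦ⟩ : ∃ w : ℝ, 0 < w ∧ w < 1 ∧ w ≤ d / 4 ∧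
      N * Real.log (2 / d) / -Real.log w ≤ t ∧ 16 / -Real.log w ≤ t ∧
      16 * N / -Real.log w ≤ t ∧ ∀ μ : ℝ, w / 2 ≤ μ → μ ≤ 8 * w →
      μ * Φ (2 * N * (μ * -Real.log w)⁻¹) ≤ 1 := by
    have hL : Tendsto (fun w : ℝ => -Real.log w) (𝓝[>] 0) atTop :=
      tendsto_neg_atBot_atTop.comp Real.tendsto_log_nhdsGT_zero
    have hc : ∀ c : ℝ, ∀ᶠ w : ℝ in 𝓝[>] 0, c / -Real.log w ≤ t := fun c =>
      (hL.const_div_atTop c).eventually_le_const ht0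
    have hs : ∀ a : ℝ, 0 < a → ∀ᶠ w : ℝ in 𝓝[>] 0, w < a := fun a ha =>
      nhdsWithin_le_nhds (gt_mem_nhds ha)
    have h0 : ∀ᶠ w : ℝ in 𝓝[>] 0, 0 < w := self_mem_nhdsWithin
    obtain ⟨w, a1, a2, a3, a4, a5, a6, a7⟩ := (h0.and ((hs 1 one_pos).and ((hs (d / 4)
      (by positivity)).and ((hc (N * Real.log (2 / d))).and ((hc 16).and ((hc (16 * N)).and
      (hΦ.eventually_mul_le_one hΨ (c := 2 * N) (by positivity)))))))).exists
    exact ⟨w, a1, a2, a3.le, a4, a5, a6, a7⟩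
  set L := -Real.log w with hLdef
  have hL : 0 < L := neg_log_pos hw hw1
  set T := Real.log (2 / d) / L with hT
  have hT0 : 0 ≤ T := by positivity
  have hNT : N * T ≤ t := by rw [hT, ← mul_div_assoc]; exact hL1
  have hNL : N / L ≤ t / 16 := by
    have : 16 * N / L = 16 * (N / L) := by ring
    rw [this] at hL3
    linarith
  -- Subtracting `a` makes the mean zero. It is negligible too, since all the masses are.
  set a : ℝ := (∑ i, ε i) * L⁻¹ / arcLength.real univ with ha
  have hσ := half_le_real_univ
  have hsε : |∑ i, ε i| ≤ N := by
    refine (Finset.abs_sum_le_sum_abs _ _).trans ?_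
    simp [hε, hN]
  have haσ : |a| * arcLength.real univ ≤ N / L := by
    rw [ha, abs_div, abs_mul, abs_of_pos (inv_pos.2 hL),
      abs_of_nonneg (measureReal_nonneg : 0 ≤ arcLength.real univ),
      div_mul_cancel₀ _ (by linarith), ← div_eq_mul_inv]
    gcongr
  have ha8 : |a| ≤ t / 8 := by nlinarith [abs_nonneg a]
  set A : Circ → ℝ := fun θ => ∑ i, atom (e i) w θ with hA
  set Ω : Circ → ℝ := fun θ => (∑ i, ε i * atom (e i) w θ) - a with hΩ
  have hat0 : ∀ i θ, 0 ≤ atom (e i) w θ := fun i θ => atom_nonneg hw hw1 θ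
  have hΩA : ∀ θ, |Ω θ| ≤ A θ + |a| := fun θ => by
    refine (abs_sub _ _).trans (add_le_add ?_ le_rfl)
    refine (Finset.abs_sum_le_sum_abs _ _).trans (Finset.sum_le_sum fun i _ => ?_)
    rw [abs_mul, hε, one_mul, abs_of_nonneg (hat0 i θ)]
  have hAi : Integrable A arcLength := integrable_finsetSum _ fun i _ => integrable_atom
  have hAint : ∫ θ, A θ ∂arcLength = N / L := by
    simp only [hA]
    rw [integral_finsetSum _ fun i _ => integrable_atom]
    simp only [integral_atom (he _) hw hw1]
    simp [hN, hLdef, div_eq_mul_inv]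
  have hΩm : Measurable Ω :=
    (Finset.measurable_sum _ fun i _ => (measurable_atom (e i) w).const_mul _).sub measurable_const
  have hΩi : Integrable Ω arcLength :=
    (integrable_finsetSum _ fun i _ => integrable_atom.const_mul _).sub (integrable_const _)
  have hAki : ∀ ξ, Integrable (fun θ => A θ * logKer ξ θ) arcLength := fun ξ => by
    simp only [hA, Finset.sum_mul]
    exact integrable_finsetSum _ fun i _ => integrable_atom_mul_logKer
  have hsymA : ∀ ξ, ∫ θ, A θ * logKer ξ θ ∂arcLength = ∑ i, symb (atom (e i) w) ξ := fun ξ => by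
    simp only [hA, Finset.sum_mul, symb]
    rw [integral_finsetSum _ fun i _ => integrable_atom_mul_logKer]
  have hsymΩ : ∀ ξ, symb Ω ξ = (∑ i, ε i * symb (atom (e i) w) ξ) -
      a * ∫ θ, logKer ξ θ ∂arcLength := fun ξ => by
    unfold symb
    simp only [hΩ, sub_mul, Finset.sum_mul, mul_assoc]
    rw [integral_sub (integrable_finsetSum _ fun i _ => integrable_atom_mul_logKer.const_mul _)
      ((integrable_logKer ξ).const_mul _),
      integral_finsetSum _ fun i _ => integrable_atom_mul_logKer.const_mul _]
    simp only [integral_const_mul]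
  have hmean : ∀ ξ, |a * ∫ θ, logKer ξ θ ∂arcLength| ≤ t := fun ξ => by
    rw [abs_mul, abs_of_nonneg (integral_nonneg (logKer_nonneg ξ))]
    calc |a| * ∫ θ, logKer ξ θ ∂arcLength ≤ t / 8 * 8 := by
          refine mul_le_mul ha8 (integral_logKer_le ξ) (integral_nonneg (logKer_nonneg ξ)) ?_
          positivity
      _ = t := by ring
  have hfar : ∀ ξ, ‖ξ‖ = 1 → ∀ i, d ≤ |cross ξ (e i)| → symb (atom (e i) w) ξ ≤ T :=
    fun ξ hξ i h => symb_atom_far (he i) hw hw1 hξ hwd hd1 h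
  have hnn : ∀ ξ i, 0 ≤ symb (atom (e i) w) ξ := fun ξ i => symb_atom_nonneg hw hw1
  have hsumT : ∀ s : Finset ι, ∑ _i ∈ s, T ≤ t := fun s => by
    rw [Finset.sum_const, nsmul_eq_mul]
    refine le_trans ?_ hNT
    gcongr
    rw [hN]
    exact_mod_cast Finset.card_le_univ s
  have hup : ∀ ξ, ‖ξ‖ = 1 → ∑ i, symb (atom (e i) w) ξ ≤ 1 + 16 / L + t := by
    intro ξ hξ
    by_cases h : ∃ i, |cross ξ (e i)| < d
    · obtain ⟨i, hi⟩ := h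
      rw [← Finset.add_sum_erase _ _ (Finset.mem_univ i)]
      refine add_le_add (symb_atom_le (he i) hw hw1 hξ)
        ((Finset.sum_le_sum fun j hj => ?_).trans (hsumT (Finset.univ.erase i)))
      refine hfar ξ hξ j ?_
      have h1 := hdsep i j (Finset.ne_of_mem_erase hj).symm
      have h2 := abs_cross_le_add hξ (he i) (he j)
      linarith
    · push Not at h
      have h1 : ∑ i, symb (atom (e i) w) ξ ≤ t :=
        (Finset.sum_le_sum fun j _ => hfar ξ hξ j (h j)).trans (hsumT _)
      have : 0 ≤ 16 / L := by positivity
      linarith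
  refine ⟨Ω, hΩm, ⟨N * (∑ i, (arcLength.real (band (e i) w) * L)⁻¹) + |a|, fun θ => ?_⟩,
    fun θ => ?_, ?_, ?_, fun ξ => ?_, ?_, fun i => ?_, fun ξ hξ => ?_⟩
  · refine (hΩA θ).trans (add_le_add ?_ le_rfl)
    have hN1 : (1 : ℝ) ≤ N := by rw [hN]; exact_mod_cast Fintype.card_pos
    have hnn' : ∀ i, 0 ≤ (arcLength.real (band (e i) w) * L)⁻¹ := fun i => by positivity
    have h1 : A θ ≤ ∑ i, (arcLength.real (band (e i) w) * L)⁻¹ :=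
      Finset.sum_le_sum fun i _ => indicator_le_self' (fun _ _ => hnn' i) θ
    nlinarith [Finset.sum_nonneg fun i (_ : i ∈ Finset.univ) => hnn' i]
  · simp only [hΩ, atom_neg]
  · simp only [hΩ]
    rw [integral_sub (integrable_finsetSum _ fun i _ => integrable_atom.const_mul _)
      (integrable_const _), integral_finsetSum _ fun i _ => integrable_atom.const_mul _]
    simp only [integral_const_mul, integral_atom (he _) hw hw1, integral_const, smul_eq_mul]
    rw [← Finset.sum_mul, ha, mul_div_cancel₀ _ (by linarith), sub_self]
  · calc ∫ θ, |Ω θ| ∂arcLength ≤ ∫ θ, (A θ + |a|) ∂arcLength :=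
          integral_mono hΩi.abs (hAi.add (integrable_const _)) hΩA
      _ = N / L + |a| * arcLength.real univ := by
          rw [integral_add hAi (integrable_const _), hAint, integral_const, smul_eq_mul, mul_comm]
      _ ≤ 1 := by linarith
  · rcases eq_or_ne ξ 0 with rfl | hξ
    · simp [logKer_zero]
    calc ∫ θ, |Ω θ| * logKer ξ θ ∂arcLength
        ≤ ∫ θ, (A θ * logKer ξ θ + |a| * logKer ξ θ) ∂arcLength := by
          refine integral_mono_of_nonneg
            (ae_of_all _ fun θ => mul_nonneg (abs_nonneg _) (logKer_nonneg ξ θ))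
            ((hAki ξ).add ((integrable_logKer ξ).const_mul _)) (ae_of_all _ fun θ => ?_)
          show _ ≤ A θ * logKer ξ θ + |a| * logKer ξ θ
          rw [← add_mul]
          exact mul_le_mul_of_nonneg_right (hΩA θ) (logKer_nonneg ξ θ)
      _ = (∑ i, symb (atom (e i) w) (‖ξ‖⁻¹ • ξ)) + |a| * ∫ θ, logKer ξ θ ∂arcLength := by
          rw [integral_add (hAki ξ) ((integrable_logKer ξ).const_mul _), hsymA,
            integral_const_mul]
          simp only [symb_normalize]
      _ ≤ (1 + 16 / L + t) + t := by
          refine add_le_add (hup _ (norm_normalize hξ)) ?_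
          have := hmean ξ
          rwa [abs_mul, abs_of_nonneg (integral_nonneg (logKer_nonneg ξ))] at this
      _ ≤ 4 := by linarith
  · -- Jensen's inequality for the convex combination `A + |a| = ∑ (2N)⁻¹ (2N atom) + 2⁻¹ (2|a|)`
    -- bounds the `Φ`-integral independently of `N`.
    have hpt : ∀ θ, ENNReal.ofReal (Φ |Ω θ|) ≤
        ENNReal.ofReal (1 / 2 * Φ (2 * |a|)) +
          ∑ i, ENNReal.ofReal ((2 * N)⁻¹ * Φ (2 * N * atom (e i) w θ)) := by
      intro θ
      have hC : HasSum (fun o : Option ι => o.elim (1 / 2 : ℝ) fun _ => (2 * N)⁻¹) 1 := by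
        convert! hasSum_fintype (fun o : Option ι => o.elim (1 / 2 : ℝ) fun _ => (2 * N)⁻¹) using 1
        rw [Fintype.sum_option]
        simp only [Option.elim_none, Option.elim_some, Finset.sum_const, Finset.card_univ,
          nsmul_eq_mul, ← hN]
        field_simp
        norm_num
      have hX : HasSum (fun o : Option ι => (o.elim (1 / 2 : ℝ) fun _ => (2 * N)⁻¹) *
          (o.elim (2 * |a|) fun i => 2 * N * atom (e i) w θ)) (A θ + |a|) := by
        convert! hasSum_fintype (fun o : Option ι => (o.elim (1 / 2 : ℝ) fun _ => (2 * N)⁻¹) *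
          (o.elim (2 * |a|) fun i => 2 * N * atom (e i) w θ)) using 1
        rw [Fintype.sum_option]
        simp only [Option.elim_none, Option.elim_some, hA]
        rw [add_comm]
        congr 1
        · ring
        · refine Finset.sum_congr rfl fun i _ => ?_
          field_simp
      have hJ := hΦ.ofReal_le_tsum (by
          rintro (_ | i) <;> simp
          positivity)
        (by rintro (_ | i)
            · simp
            · exact mul_nonneg (by positivity) (hat0 i θ)) hC le_rfl hX
      refine (ENNReal.ofReal_le_ofReal (hΦ.mono (abs_nonneg _) (hΩA θ))).trans (hJ.trans_eq ?_)
      rw [tsum_fintype, Fintype.sum_option]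
      simp only [Option.elim_none, Option.elim_some]
    have hmeas : ∀ i, Measurable fun θ =>
        ENNReal.ofReal ((2 * N)⁻¹ * Φ (2 * N * atom (e i) w θ)) := fun i => by
      have h1 : Measurable fun θ => Φ |2 * N * atom (e i) w θ| :=
        hΦ.measurable_comp_abs.comp ((measurable_atom (e i) w).const_mul _)
      have h2 : (fun θ => ENNReal.ofReal ((2 * N)⁻¹ * Φ (2 * N * atom (e i) w θ))) =
          fun θ => ENNReal.ofReal ((2 * N)⁻¹ * Φ |2 * N * atom (e i) w θ|) := by
        funext θ
        rw [abs_of_nonneg (mul_nonneg (by positivity) (hat0 i θ))]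
      rw [h2]
      exact (h1.const_mul _).ennreal_ofReal
    have hone : ∀ i, ∫⁻ θ, ENNReal.ofReal ((2 * N)⁻¹ * Φ (2 * N * atom (e i) w θ)) ∂arcLength ≤
        ENNReal.ofReal (2 * N)⁻¹ := fun i => by
      simp_rw [ENNReal.ofReal_mul (by positivity : 0 ≤ (2 * N)⁻¹)]
      rw [lintegral_const_mul' _ _ ENNReal.ofReal_ne_top, lintegral_young_atom hΦ]
      refine mul_le_of_le_one_right zero_le ?_
      rw [ENNReal.ofReal_le_one]
      exact hwΦ _ (le_real_band (he i) hw hw1) (real_band_le (he i) hw)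
    calc ∫⁻ θ, ENNReal.ofReal (Φ |Ω θ|) ∂arcLength
        ≤ ∫⁻ θ, (ENNReal.ofReal (1 / 2 * Φ (2 * |a|)) +
          ∑ i, ENNReal.ofReal ((2 * N)⁻¹ * Φ (2 * N * atom (e i) w θ))) ∂arcLength :=
          lintegral_mono hpt
      _ = ENNReal.ofReal (1 / 2 * Φ (2 * |a|)) * arcLength univ +
          ∑ i, ∫⁻ θ, ENNReal.ofReal ((2 * N)⁻¹ * Φ (2 * N * atom (e i) w θ)) ∂arcLength := by
          rw [lintegral_add_left measurable_const, lintegral_const,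
            lintegral_finsetSum _ fun i _ => hmeas i]
      _ ≤ ENNReal.ofReal (Φ 1) * arcLength univ + ∑ _i : ι, ENNReal.ofReal (2 * N)⁻¹ := by
          gcongr with i
          · have := hΦ.mono (x := 2 * |a|) (y := 1) (by positivity) (by linarith)
            have h0 := hΦ.nonneg (x := 2 * |a|) (by positivity)
            linarith
          · exact hone i
      _ = ENNReal.ofReal (Φ 1 * arcLength.real univ) + ENNReal.ofReal (1 / 2) := by
          rw [ENNReal.ofReal_mul (hΦ.nonneg zero_le_one), ofReal_measureReal,
            ← ENNReal.ofReal_sum_of_nonneg (fun _ _ => by positivity)]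
          congr 2
          simp only [Finset.sum_const, Finset.card_univ, nsmul_eq_mul, ← hN]
          field_simp
      _ ≤ ENNReal.ofReal (1 + Φ 1 * arcLength.real univ) := by
          rw [← ENNReal.ofReal_add (mul_nonneg (hΦ.nonneg zero_le_one) measureReal_nonneg)
            (by norm_num)]
          exact ENNReal.ofReal_le_ofReal (by linarith)
  · rw [hsymΩ, ← Finset.add_sum_erase _ _ (Finset.mem_univ i)]
    have h1 := one_le_symb_atom (he i) hw hw1
    have h2 := symb_atom_le (he i) hw hw1 (he i)
    rw [← hLdef] at h2
    have h3 : |∑ j ∈ Finset.univ.erase i, ε j * symb (atom (e j) w) (e i)| ≤ t := by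
      refine (Finset.abs_sum_le_sum_abs _ _).trans ((Finset.sum_le_sum fun j hj => ?_).trans
        (hsumT (Finset.univ.erase i)))
      rw [abs_mul, hε, one_mul, abs_of_nonneg (hnn _ _)]
      refine hfar _ (he i) j ?_
      have := hdsep i j (Finset.ne_of_mem_erase hj).symm
      linarith
    have h4 := hmean (e i)
    have h5 : |ε i * symb (atom (e i) w) (e i) - ε i| ≤ t := by
      have : ε i * symb (atom (e i) w) (e i) - ε i = ε i * (symb (atom (e i) w) (e i) - 1) := by
        ring
      rw [this, abs_mul, hε, one_mul, abs_of_nonneg (by linarith)]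
      linarith
    rw [abs_le] at h3 h4 h5 ⊢
    constructor <;> linarith [h3.1, h3.2, h4.1, h4.2, h5.1, h5.2]
  · rw [hsymΩ]
    have h3 : |∑ j, ε j * symb (atom (e j) w) ξ| ≤ t := by
      refine (Finset.abs_sum_le_sum_abs _ _).trans ((Finset.sum_le_sum fun j hj => ?_).trans
        (hsumT Finset.univ))
      rw [abs_mul, hε, one_mul, abs_of_nonneg (hnn _ _)]
      exact hfar _ (hE ξ hξ).1 j (hdE ξ hξ j)
    have h4 := hmean ξ
    refine (abs_sub _ _).trans ?_
    linarith

/-! ### Polar coordinates -/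

theorem roughKernel_smul (Ω : Circ → ℝ) {r : ℝ} (hr : 0 < r) (θ : Circ) :
    roughKernel Ω (r • (θ : Plane)) = (r ^ 2)⁻¹ * Ω θ := by
  have hθ := norm_coe_circ θ
  have hn : ‖r • (θ : Plane)‖ = r := by rw [norm_smul, hθ, mul_one, Real.norm_of_nonneg hr.le]
  have hne : r • (θ : Plane) ≠ 0 := by
    rw [← norm_ne_zero_iff, hn]
    exact hr.ne'
  have hdir : direction (r • (θ : Plane)) hne = θ := by
    apply Subtype.ext
    show ‖r • (θ : Plane)‖⁻¹ • r • (θ : Plane) = θ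
    rw [hn, smul_smul, inv_mul_cancel₀ hr.ne', one_smul]
  rw [roughKernel, dif_pos hne, hdir, hn]

theorem roughKernel_neg {Ω : Circ → ℝ} (heven : ∀ θ, Ω (-θ) = Ω θ) (z : Plane) :
    roughKernel Ω (-z) = roughKernel Ω z := by
  unfold roughKernel
  by_cases h : z = 0
  · simp [h]
  · have h' : -z ≠ 0 := neg_ne_zero.2 h
    have : direction (-z) h' = -direction z h := by
      apply Subtype.ext
      simp [direction]
    rw [dif_pos h', dif_pos h, this, heven, norm_neg]

/-- The homeomorphism `z ↦ (z / |z|, |z|)` is measure preserving from the punctured plane to the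
circle times the half-line with density `r`. -/
theorem measurePreserving_polar : MeasurePreserving (homeomorphUnitSphereProd Plane)
    ((volume : Measure Plane).comap (↑)) (arcLength.prod (Measure.volumeIoiPow 1)) := by
  have h := (volume : Measure Plane).measurePreserving_homeomorphUnitSphereProd
  rw [finrank_plane] at h
  exact h

theorem coe_smul_homeomorphUnitSphereProd (z : ({0}ᶜ : Set Plane)) :
    ((homeomorphUnitSphereProd Plane z).2 : ℝ) • ((homeomorphUnitSphereProd Plane z).1 : Plane) =
      z := by
  rw [← homeomorphUnitSphereProd_symm_apply_coe, Homeomorph.symm_apply_apply]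

theorem integrable_iff_polar {F : Plane → ℝ} : Integrable F ↔
    Integrable (fun p : Circ × Ioi (0 : ℝ) => F ((p.2 : ℝ) • (p.1 : Plane)))
      (arcLength.prod (Measure.volumeIoiPow 1)) := by
  have h : Integrable F ↔ IntegrableOn F {0}ᶜ := by
    rw [IntegrableOn, restrict_compl_singleton]
  rw [h, ← measurePreserving_polar.integrable_comp_emb (Homeomorph.measurableEmbedding _),
    integrableOn_iff_comap_subtypeVal (measurableSet_singleton _).compl]
  refine integrable_congr (ae_of_all _ fun z => ?_)
  simp only [Function.comp_apply, coe_smul_homeomorphUnitSphereProd]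

theorem integral_volumeIoiPow_one (f : ℝ → ℝ) :
    ∫ r : Ioi (0 : ℝ), f r ∂(Measure.volumeIoiPow 1) = ∫ r in Ioi (0 : ℝ), r * f r := by
  simp only [Measure.volumeIoiPow, ENNReal.ofReal]
  rw [integral_withDensity_eq_integral_smul
      (measurable_subtype_coe.pow_const _).real_toNNReal (fun r : Ioi (0 : ℝ) => f r),
    integral_subtype_comap measurableSet_Ioi fun a => Real.toNNReal (a ^ 1) • f a]
  refine setIntegral_congr_fun measurableSet_Ioi fun r hr => ?_
  rw [NNReal.smul_def, Real.coe_toNNReal _ (pow_nonneg (le_of_lt hr) _), pow_one, smul_eq_mul]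

theorem integral_polar {F : Plane → ℝ} (hF : Integrable F) :
    ∫ z, F z = ∫ θ : Circ, (∫ r in Ioi (0 : ℝ), r * F (r • (θ : Plane))) ∂arcLength := by
  calc ∫ z, F z = ∫ z : ({0}ᶜ : Set Plane), F z ∂((volume : Measure Plane).comap (↑)) := by
        rw [integral_subtype_comap (measurableSet_singleton _).compl, restrict_compl_singleton]
    _ = ∫ p : Circ × Ioi (0 : ℝ), F ((p.2 : ℝ) • (p.1 : Plane))
          ∂(arcLength.prod (Measure.volumeIoiPow 1)) := by
        rw [← measurePreserving_polar.integral_comp (Homeomorph.measurableEmbedding _)]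
        simp only [coe_smul_homeomorphUnitSphereProd]
    _ = ∫ θ : Circ, ∫ r : Ioi (0 : ℝ), F ((r : ℝ) • (θ : Plane))
          ∂(Measure.volumeIoiPow 1) ∂arcLength :=
        integral_prod _ (integrable_iff_polar.1 hF)
    _ = _ := by
        refine integral_congr_ae (ae_of_all _ fun θ => ?_)
        exact integral_volumeIoiPow_one fun r => F (r • (θ : Plane))

theorem integrable_volumeIoiPow_one {f : ℝ → ℝ} (hf : IntegrableOn (fun r => r * f r) (Ioi 0)) :
    Integrable (fun r : Ioi (0 : ℝ) => f r) (Measure.volumeIoiPow 1) := by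
  rw [Measure.volumeIoiPow, integrable_withDensity_iff_integrable_smul' (by fun_prop) (by simp)]
  rw [integrableOn_iff_comap_subtypeVal measurableSet_Ioi] at hf
  refine hf.congr (ae_of_all _ fun r => ?_)
  simp [ENNReal.toReal_ofReal (le_of_lt r.2)]

theorem integrable_roughKernel_mul_norm {Ω : Circ → ℝ} (hΩ : Integrable Ω arcLength) {h : ℝ → ℝ}
    (hh : IntegrableOn (fun r => r⁻¹ * h r) (Ioi 0)) :
    Integrable fun z : Plane => roughKernel Ω z * h ‖z‖ := by
  rw [integrable_iff_polar]
  have h1 : Integrable (fun r : Ioi (0 : ℝ) => ((r : ℝ) ^ 2)⁻¹ * h r) (Measure.volumeIoiPow 1) := by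
    refine integrable_volumeIoiPow_one (f := fun r => (r ^ 2)⁻¹ * h r) (hh.congr_fun ?_
      measurableSet_Ioi)
    intro r hr
    have : r ≠ 0 := ne_of_gt hr
    simp only
    field_simp
  refine (hΩ.mul_prod h1).congr (ae_of_all _ fun p => ?_)
  have hp : 0 < (p.2 : ℝ) := p.2.2
  simp only [roughKernel_smul Ω hp, norm_smul, norm_coe_circ, mul_one, Real.norm_of_nonneg hp.le]
  ring

/-- The kernel truncated to an annulus is integrable. -/
theorem integrableOn_roughKernel_annulus {Ω : Circ → ℝ} (hΩ : Integrable Ω arcLength) {ε R : ℝ}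
    (hε : 0 < ε) : IntegrableOn (roughKernel Ω) {z : Plane | ε < ‖z‖ ∧ ‖z‖ ≤ R} := by
  have hm : MeasurableSet {z : Plane | ε < ‖z‖ ∧ ‖z‖ ≤ R} :=
    (measurableSet_lt measurable_const measurable_norm).inter
      (measurableSet_le measurable_norm measurable_const)
  rw [← integrable_indicator_iff hm]
  have h1 : IntegrableOn (fun r : ℝ => r⁻¹ * (Ioc ε R).indicator (fun _ => 1) r) (Ioi 0) := by
    have h2 : IntegrableOn (fun r : ℝ => r⁻¹) (Ioc ε R) := by
      refine (ContinuousOn.integrableOn_Icc (f := fun r : ℝ => r⁻¹) (a := ε) (b := R) ?_).mono_set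
        Ioc_subset_Icc_self
      exact continuousOn_id.inv₀ fun r hr => (hε.trans_le hr.1).ne'
    refine (((integrable_indicator_iff measurableSet_Ioc).2 h2).integrableOn).congr_fun ?_
      measurableSet_Ioi
    intro r _
    by_cases hr : r ∈ Ioc ε R <;> simp [hr]
  refine (integrable_roughKernel_mul_norm hΩ h1).congr (ae_of_all _ fun z => ?_)
  simp only
  by_cases hz : ε < ‖z‖ ∧ ‖z‖ ≤ R
  · rw [indicator_of_mem (show ‖z‖ ∈ Ioc ε R from hz), indicator_of_mem (by exact hz), mul_one]
  · rw [indicator_of_notMem (show ‖z‖ ∉ Ioc ε R from hz), indicator_of_notMem (by exact hz),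
      mul_zero]

theorem integrableOn_roughKernel_mul_inv_norm {Ω : Circ → ℝ} (hΩ : Integrable Ω arcLength) {ε : ℝ}
    (hε : 0 < ε) : IntegrableOn (fun z => roughKernel Ω z * ‖z‖⁻¹) {z : Plane | ε < ‖z‖} := by
  have hm : MeasurableSet {z : Plane | ε < ‖z‖} := measurableSet_lt measurable_const measurable_norm
  rw [← integrable_indicator_iff hm]
  have h1 : IntegrableOn (fun r : ℝ => r⁻¹ * (Ioi ε).indicator (fun r => r⁻¹) r) (Ioi 0) := by
    have h2 := integrableOn_Ioi_rpow_of_lt (a := -2) (by norm_num) hε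
    refine (((integrable_indicator_iff measurableSet_Ioi).2 h2).integrableOn).congr_fun ?_
      measurableSet_Ioi
    intro r hr0
    by_cases hr : r ∈ Ioi ε
    · simp only [indicator_of_mem hr]
      rw [Real.rpow_neg (le_of_lt hr0), Real.rpow_two]
      have : r ≠ 0 := ne_of_gt hr0
      field_simp
    · simp [hr]
  refine (integrable_roughKernel_mul_norm hΩ h1).congr (ae_of_all _ fun z => ?_)
  simp only
  by_cases hz : ε < ‖z‖
  · rw [indicator_of_mem (show ‖z‖ ∈ Ioi ε from hz), indicator_of_mem (by exact hz)]
  · rw [indicator_of_notMem (show ‖z‖ ∉ Ioi ε from hz), indicator_of_notMem (by exact hz),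
      mul_zero]

/-! ### An oscillatory integral -/

/-- The integral `∫_s^b cos(2πtv) dv / v`, which interpolates between `log (b / s)` at `t = 0` and
`0` at `t = ∞`. -/
def oscLog (s b t : ℝ) : ℝ := ∫ v in s..b, Real.cos (2 * Real.pi * (t * v)) / v

theorem intervalIntegrable_cos_div (c : ℝ) {a b : ℝ} (ha : 0 < a) (hb : 0 < b) :
    IntervalIntegrable (fun v => Real.cos (2 * Real.pi * (c * v)) / v) volume a b := by
  refine ContinuousOn.intervalIntegrable fun v hv => ?_
  have hv0 : 0 < v := (lt_min ha hb).trans_le hv.1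
  exact ((by fun_prop : Continuous fun v => Real.cos (2 * Real.pi * (c * v))).continuousAt.div
    continuousAt_id hv0.ne').continuousWithinAt

theorem intervalIntegrable_one_div {a b : ℝ} (ha : 0 < a) (hb : 0 < b) :
    IntervalIntegrable (fun v : ℝ => 1 / v) volume a b := by
  have h := intervalIntegrable_cos_div 0 ha hb
  simp only [zero_mul, mul_zero, Real.cos_zero] at h
  exact h

theorem oscLog_eq_integral_one {s b t : ℝ} (ht : 0 < t) :
    oscLog s b t = ∫ u in (t * s)..(t * b), Real.cos (2 * Real.pi * u) / u := by
  have h := intervalIntegral.mul_integral_comp_mul_left (a := s) (b := b)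
    (f := fun u => Real.cos (2 * Real.pi * u) / u) t
  rw [← h, oscLog, ← intervalIntegral.integral_const_mul]
  refine intervalIntegral.integral_congr fun v _ => ?_
  field_simp

theorem oscLog_sub_oscLog {s b ε R : ℝ} (hs : 0 < s) (hb : 0 < b) (hε : 0 < ε) (hR : 0 < R) :
    oscLog ε R s - oscLog ε R b = oscLog s b ε - oscLog s b R := by
  rw [oscLog_eq_integral_one hs, oscLog_eq_integral_one hb, oscLog_eq_integral_one hε,
    oscLog_eq_integral_one hR, mul_comm ε s, mul_comm ε b, mul_comm R s, mul_comm R b]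
  have hi : ∀ x y : ℝ, 0 < x → 0 < y →
      IntervalIntegrable (fun u => Real.cos (2 * Real.pi * u) / u) volume x y := fun x y hx hy => by
    simpa using intervalIntegrable_cos_div 1 hx hy
  have p1 : 0 < s * ε := by positivity
  have p2 : 0 < s * R := by positivity
  have p3 : 0 < b * ε := by positivity
  have p4 : 0 < b * R := by positivity
  have e1 := intervalIntegral.integral_add_adjacent_intervals (hi _ _ p1 p3) (hi _ _ p3 p4)
  have e2 := intervalIntegral.integral_add_adjacent_intervals (hi _ _ p1 p2) (hi _ _ p2 p4)
  linarith

theorem oscLog_abs (s b t : ℝ) : oscLog s b |t| = oscLog s b t := by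
  rcases abs_choice t with h | h
  · rw [h]
  · rw [h]
    simp [oscLog]

theorem abs_oscLog_le {s b : ℝ} (t : ℝ) (hs : 0 < s) (hsb : s ≤ b) :
    |oscLog s b t| ≤ Real.log (b / s) := by
  rw [← integral_one_div_of_pos hs (hs.trans_le hsb), ← Real.norm_eq_abs]
  refine intervalIntegral.norm_integral_le_of_norm_le hsb (ae_of_all _ fun v hv => ?_) ?_
  · have hv0 : 0 < v := hs.trans hv.1
    rw [norm_div, Real.norm_of_nonneg hv0.le, Real.norm_eq_abs]
    gcongr
    exact Real.abs_cos_le_one _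
  · exact intervalIntegrable_one_div hs (hs.trans_le hsb)

theorem continuous_oscLog {s b : ℝ} (hs : 0 < s) (hsb : s ≤ b) : Continuous (oscLog s b) := by
  refine continuous_iff_continuousAt.2 fun t₀ => ?_
  refine intervalIntegral.continuousAt_of_dominated_interval (bound := fun v => 1 / v) ?_ ?_ ?_ ?_
  · refine Eventually.of_forall fun t => ?_
    exact (by fun_prop : Measurable fun v => Real.cos (2 * Real.pi * (t * v)) / v)
      |>.aestronglyMeasurable
  · refine Eventually.of_forall fun t => ae_of_all _ fun v hv => ?_
    rw [uIoc_of_le hsb] at hv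
    have hv0 : 0 < v := hs.trans hv.1
    rw [norm_div, Real.norm_of_nonneg hv0.le, Real.norm_eq_abs]
    gcongr
    exact Real.abs_cos_le_one _
  · exact intervalIntegrable_one_div hs (hs.trans_le hsb)
  · refine ae_of_all _ fun v _ => ?_
    exact (by fun_prop : Continuous fun t => Real.cos (2 * Real.pi * (t * v)) / v).continuousAt

theorem tendsto_oscLog_zero {s b : ℝ} (hs : 0 < s) (hsb : s ≤ b) :
    Tendsto (oscLog s b) (𝓝[>] 0) (𝓝 (Real.log (b / s))) := by
  have h0 : oscLog s b 0 = Real.log (b / s) := by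
    rw [← integral_one_div_of_pos hs (hs.trans_le hsb)]
    simp [oscLog]
  rw [← h0]
  exact ((continuous_oscLog hs hsb).tendsto 0).mono_left nhdsWithin_le_nhds

/-- The Riemann-Lebesgue lemma for `oscLog`. -/
theorem tendsto_oscLog_atTop {s b : ℝ} (hs : 0 < s) (hsb : s ≤ b) :
    Tendsto (oscLog s b) atTop (𝓝 0) := by
  have h := (Real.tendsto_integral_exp_smul_cocompact
    ((Ioc s b).indicator fun v : ℝ => ((v⁻¹ : ℝ) : ℂ))).mono_left atTop_le_cocompact
  have h2 := (Complex.continuous_re.tendsto 0).comp h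
  rw [Complex.zero_re] at h2
  refine h2.congr fun t => ?_
  have hcont : ContinuousOn (fun v : ℝ => Real.fourierChar (-(v * t)) • ((v⁻¹ : ℝ) : ℂ))
      (Icc s b) := by
    have h3 : ContinuousOn (fun v : ℝ => ((v⁻¹ : ℝ) : ℂ)) (Icc s b) :=
      Complex.continuous_ofReal.comp_continuousOn
        (continuousOn_id.inv₀ fun v hv => (hs.trans_le hv.1).ne')
    have h4 : Continuous fun v : ℝ => Real.fourierChar (-(v * t)) :=
      Real.continuous_fourierChar.comp (by fun_prop)
    exact h4.continuousOn.smul h3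
  have hi : IntegrableOn (fun v : ℝ => Real.fourierChar (-(v * t)) • ((v⁻¹ : ℝ) : ℂ))
      (Ioc s b) := hcont.integrableOn_Icc.mono_set Ioc_subset_Icc_self
  have e1 : (fun v : ℝ => Real.fourierChar (-(v * t)) •
      (Ioc s b).indicator (fun v : ℝ => ((v⁻¹ : ℝ) : ℂ)) v) =
      (Ioc s b).indicator fun v : ℝ => Real.fourierChar (-(v * t)) • ((v⁻¹ : ℝ) : ℂ) := by
    funext v
    by_cases hv : v ∈ Ioc s b <;> simp [hv]
  simp only [Function.comp_apply]
  rw [e1, integral_indicator measurableSet_Ioc]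
  have e2 := integral_re hi
  simp only [RCLike.re_to_complex] at e2
  rw [← e2, oscLog, intervalIntegral.integral_of_le hsb]
  refine setIntegral_congr_fun measurableSet_Ioc fun v _ => ?_
  simp only [Circle.smul_def, Real.fourierChar_apply, smul_eq_mul, Complex.re_mul_ofReal]
  rw [Complex.exp_ofReal_mul_I_re, div_eq_mul_inv, mul_neg, Real.cos_neg, mul_comm v t]

/-! ### The multiplier formula -/

/-- The hypotheses on `Ω` that make `T_Ω` a Fourier multiplier operator with bounded symbol: the
logarithmic potential of `|Ω|` is bounded by `M`. -/
structure Admissible (Ω : Circ → ℝ) (M : ℝ) : Prop where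
  even : ∀ θ, Ω (-θ) = Ω θ
  integrable : Integrable Ω arcLength
  integral_eq_zero : ∫ θ, Ω θ ∂arcLength = 0
  integrable_mul : ∀ ξ, Integrable (fun θ => |Ω θ| * logKer ξ θ) arcLength
  integral_le : ∀ ξ, ∫ θ, |Ω θ| * logKer ξ θ ∂arcLength ≤ M

theorem logKer_eq_log_div {ξ : Plane} (hξ : ξ ≠ 0) (θ : Circ) :
    logKer ξ θ = Real.log (‖ξ‖ / |inner ℝ ξ (θ : Plane)|) := by
  unfold logKer
  rw [← Real.log_inv, inner_smul_left, abs_mul, mul_inv]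
  have : 0 < ‖ξ‖ := norm_pos_iff.2 hξ
  simp [div_eq_mul_inv]

theorem abs_inner_coe_le_norm (ξ : Plane) (θ : Circ) : |inner ℝ ξ (θ : Plane)| ≤ ‖ξ‖ := by
  have := abs_real_inner_le_norm ξ (θ : Plane)
  rwa [norm_coe_circ, mul_one] at this

theorem measurableSet_annulus (ε R : ℝ) : MeasurableSet {z : Plane | ε < ‖z‖ ∧ ‖z‖ ≤ R} :=
  (measurableSet_lt measurable_const measurable_norm).inter
    (measurableSet_le measurable_norm measurable_const)

/-- The multiplier of the kernel truncated to the annulus `ε < |z| ≤ R`, written with the cosine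
since the kernel is even. -/
def annulusSymb (Ω : Circ → ℝ) (ε R : ℝ) (ξ : Plane) : ℝ :=
  ∫ z in {z : Plane | ε < ‖z‖ ∧ ‖z‖ ≤ R}, roughKernel Ω z * Real.cos (2 * Real.pi * inner ℝ z ξ)

section Multiplier

variable {Ω : Circ → ℝ} {M : ℝ}

theorem integrableOn_roughKernel_mul_cos (hΩ : Integrable Ω arcLength) {ε : ℝ} (R : ℝ) (hε : 0 < ε)
    (ξ : Plane) : IntegrableOn (fun z => roughKernel Ω z * Real.cos (2 * Real.pi * inner ℝ z ξ))
      {z : Plane | ε < ‖z‖ ∧ ‖z‖ ≤ R} := by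
  have hc : Continuous fun z : Plane => Real.cos (2 * Real.pi * inner ℝ z ξ) := by fun_prop
  refine ((integrableOn_roughKernel_annulus hΩ hε (R := R)).integrable.bdd_mul
    hc.aestronglyMeasurable (c := 1) (ae_of_all _ fun z => Real.abs_cos_le_one _)).congr
    (ae_of_all _ fun z => mul_comm _ _)

theorem annulusSymb_eq (hΩ : Integrable Ω arcLength) {ε R : ℝ} (hε : 0 < ε) (hR : ε ≤ R)
    (ξ : Plane) : annulusSymb Ω ε R ξ =
      ∫ θ : Circ, Ω θ * oscLog ε R (inner ℝ ξ (θ : Plane)) ∂arcLength := by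
  have hi := (integrable_indicator_iff (measurableSet_annulus ε R)).2
    (integrableOn_roughKernel_mul_cos hΩ R hε ξ)
  rw [annulusSymb, ← integral_indicator (measurableSet_annulus ε R), integral_polar hi]
  refine integral_congr_ae (ae_of_all _ fun θ => ?_)
  simp only
  rw [oscLog, intervalIntegral.integral_of_le hR, ← integral_const_mul,
    ← integral_indicator measurableSet_Ioc, ← integral_indicator measurableSet_Ioi]
  congr 1
  funext r
  by_cases hr : r ∈ Ioc ε R
  · have hr0 : 0 < r := hε.trans hr.1
    have hn : ‖r • (θ : Plane)‖ = r := by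
      rw [norm_smul, norm_coe_circ, mul_one, Real.norm_of_nonneg hr0.le]
    rw [indicator_of_mem (mem_Ioi.2 hr0), indicator_of_mem hr, indicator_of_mem (by
      rw [mem_ofPred_eq, hn]; exact hr), roughKernel_smul Ω hr0, inner_smul_left, real_inner_comm]
    simp only [conj_trivial]
    rw [mul_comm (inner ℝ ξ (θ : Plane)) r]
    field_simp
  · rw [indicator_of_notMem hr]
    by_cases hr0 : 0 < r
    · have hn : ‖r • (θ : Plane)‖ = r := by
        rw [norm_smul, norm_coe_circ, mul_one, Real.norm_of_nonneg hr0.le]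
      rw [indicator_of_mem (mem_Ioi.2 hr0), indicator_of_notMem (by
        rw [mem_ofPred_eq, hn]; exact hr), mul_zero]
    · rw [indicator_of_notMem (show r ∉ Ioi (0 : ℝ) from hr0)]

theorem continuous_annulusSymb (hΩ : Integrable Ω arcLength) {ε : ℝ} (R : ℝ) (hε : 0 < ε) :
    Continuous (annulusSymb Ω ε R) := by
  refine continuous_of_dominated (bound := fun z => ‖roughKernel Ω z‖)
    (fun ξ => (integrableOn_roughKernel_mul_cos hΩ R hε ξ).aestronglyMeasurable)
    (fun ξ => ae_of_all _ fun z => ?_)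
    (integrableOn_roughKernel_annulus hΩ hε (R := R)).integrable.norm
    (ae_of_all _ fun z => by fun_prop)
  rw [norm_mul]
  exact mul_le_of_le_one_right (norm_nonneg _) (Real.abs_cos_le_one _)

variable (h : Admissible Ω M)

include h

theorem Admissible.integrable_mul_osc {ε R : ℝ} (hε : 0 < ε) (hR : ε ≤ R) (ξ : Plane) :
    Integrable (fun θ : Circ => Ω θ * oscLog ε R (inner ℝ ξ (θ : Plane))) arcLength := by
  have hm : Measurable fun θ : Circ => oscLog ε R (inner ℝ ξ (θ : Plane)) :=
    (continuous_oscLog hε hR).measurable.comp (measurable_inner_coe ξ)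
  exact (h.integrable.bdd_mul hm.aestronglyMeasurable (c := Real.log (R / ε))
    (ae_of_all _ fun θ => abs_oscLog_le _ hε hR)).congr (ae_of_all _ fun θ => mul_comm _ _)

/-- Since `Ω` has mean zero, the scale of `ξ` may be subtracted. -/
theorem Admissible.annulusSymb_eq_sub {ε R : ℝ} (hε : 0 < ε) (hR : ε ≤ R) (ξ : Plane) :
    annulusSymb Ω ε R ξ = ∫ θ : Circ, Ω θ *
      (oscLog ε R (inner ℝ ξ (θ : Plane)) - oscLog ε R ‖ξ‖) ∂arcLength := by
  simp only [mul_sub]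
  rw [annulusSymb_eq h.integrable hε hR, integral_sub (h.integrable_mul_osc hε hR ξ)
    (h.integrable.mul_const _), integral_mul_const, h.integral_eq_zero, zero_mul, sub_zero]

omit h in
theorem osc_sub_osc_eq {ε R : ℝ} (hε : 0 < ε) (hR : ε ≤ R) {ξ : Plane} (hξ : ξ ≠ 0) {θ : Circ}
    (h0 : inner ℝ ξ (θ : Plane) ≠ 0) :
    oscLog ε R (inner ℝ ξ (θ : Plane)) - oscLog ε R ‖ξ‖ =
      oscLog |inner ℝ ξ (θ : Plane)| ‖ξ‖ ε - oscLog |inner ℝ ξ (θ : Plane)| ‖ξ‖ R := by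
  rw [← oscLog_abs ε R (inner ℝ ξ (θ : Plane))]
  exact oscLog_sub_oscLog (abs_pos.2 h0) (norm_pos_iff.2 hξ) hε (hε.trans_le hR)

omit h in
theorem abs_oscLog_le_logKer {ξ : Plane} (hξ : ξ ≠ 0) {θ : Circ}
    (h0 : inner ℝ ξ (θ : Plane) ≠ 0) (t : ℝ) :
    |oscLog |inner ℝ ξ (θ : Plane)| ‖ξ‖ t| ≤ logKer ξ θ := by
  rw [logKer_eq_log_div hξ θ]
  exact abs_oscLog_le t (abs_pos.2 h0) (abs_inner_coe_le_norm ξ θ)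

omit h in
theorem norm_mul_osc_le {ε R : ℝ} (hε : 0 < ε) (hR : ε ≤ R) {ξ : Plane} (hξ : ξ ≠ 0) {θ : Circ}
    (h0 : inner ℝ ξ (θ : Plane) ≠ 0) :
    ‖Ω θ * (oscLog ε R (inner ℝ ξ (θ : Plane)) - oscLog ε R ‖ξ‖)‖ ≤
      2 * (|Ω θ| * logKer ξ θ) := by
  rw [osc_sub_osc_eq hε hR hξ h0, norm_mul, Real.norm_eq_abs, Real.norm_eq_abs]
  have h1 := abs_oscLog_le_logKer hξ h0 ε
  have h2 := abs_oscLog_le_logKer hξ h0 R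
  have h3 := abs_sub (oscLog |inner ℝ ξ (θ : Plane)| ‖ξ‖ ε)
    (oscLog |inner ℝ ξ (θ : Plane)| ‖ξ‖ R)
  calc _ ≤ |Ω θ| * (2 * logKer ξ θ) := by
        gcongr
        linarith
    _ = _ := by ring

theorem Admissible.abs_annulusSymb_le {ε R : ℝ} (hε : 0 < ε) (hR : ε ≤ R) {ξ : Plane}
    (hξ : ξ ≠ 0) : |annulusSymb Ω ε R ξ| ≤ 2 * M := by
  rw [h.annulusSymb_eq_sub hε hR, ← Real.norm_eq_abs]
  refine (norm_integral_le_of_norm_le ((h.integrable_mul ξ).const_mul 2) ?_).trans ?_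
  · filter_upwards [ae_inner_ne_zero hξ] with θ h0
    exact norm_mul_osc_le hε hR hξ h0
  · rw [integral_const_mul]
    exact mul_le_mul_of_nonneg_left (h.integral_le ξ) (by norm_num)

omit h in
/-- The multiplier of the kernel truncated to `|z| > ε`: the limit of `annulusSymb Ω ε R` as `R → ∞`
(`Admissible.tendsto_annulusSymb`). As `ε → 0` the inner integral tends to
`log (|ξ| / |⟨ξ, θ⟩|)`. -/
def truncSymb (Ω : Circ → ℝ) (ε : ℝ) (ξ : Plane) : ℝ :=
  ∫ θ : Circ, Ω θ * oscLog |inner ℝ ξ (θ : Plane)| ‖ξ‖ ε ∂arcLength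

theorem Admissible.aestronglyMeasurable_osc {ε R : ℝ} (hε : 0 < ε) (hR : ε ≤ R) (ξ : Plane) :
    AEStronglyMeasurable (fun θ : Circ => Ω θ *
      (oscLog ε R (inner ℝ ξ (θ : Plane)) - oscLog ε R ‖ξ‖)) arcLength := by
  have hm : Measurable fun θ : Circ => oscLog ε R (inner ℝ ξ (θ : Plane)) - oscLog ε R ‖ξ‖ :=
    ((continuous_oscLog hε hR).measurable.comp (measurable_inner_coe ξ)).sub measurable_const
  exact h.integrable.aestronglyMeasurable.mul hm.aestronglyMeasurable

omit h in
theorem ae_tendsto_osc {ε : ℝ} (hε : 0 < ε) {ξ : Plane} (hξ : ξ ≠ 0) :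
    ∀ᵐ θ : Circ ∂arcLength, Tendsto (fun n : ℕ => Ω θ *
      (oscLog ε (ε + n) (inner ℝ ξ (θ : Plane)) - oscLog ε (ε + n) ‖ξ‖)) atTop
      (𝓝 (Ω θ * oscLog |inner ℝ ξ (θ : Plane)| ‖ξ‖ ε)) := by
  filter_upwards [ae_inner_ne_zero hξ] with θ h0
  have h1 : ∀ n : ℕ, oscLog ε (ε + n) (inner ℝ ξ (θ : Plane)) - oscLog ε (ε + n) ‖ξ‖ =
      oscLog |inner ℝ ξ (θ : Plane)| ‖ξ‖ ε - oscLog |inner ℝ ξ (θ : Plane)| ‖ξ‖ (ε + n) :=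
    fun n => osc_sub_osc_eq hε (by simp) hξ h0
  simp only [h1]
  have h2 : Tendsto (fun n : ℕ => ε + (n : ℝ)) atTop atTop :=
    tendsto_atTop_add_const_left _ _ tendsto_natCast_atTop_atTop
  have h3 := (tendsto_oscLog_atTop (abs_pos.2 h0) (abs_inner_coe_le_norm ξ θ)).comp h2
  simpa using (h3.const_sub (oscLog |inner ℝ ξ (θ : Plane)| ‖ξ‖ ε)).const_mul (Ω θ)

theorem Admissible.tendsto_annulusSymb {ε : ℝ} (hε : 0 < ε) {ξ : Plane} (hξ : ξ ≠ 0) :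
    Tendsto (fun n : ℕ => annulusSymb Ω ε (ε + n) ξ) atTop (𝓝 (truncSymb Ω ε ξ)) := by
  have hR : ∀ n : ℕ, ε ≤ ε + n := fun n => by simp
  simp only [fun n : ℕ => h.annulusSymb_eq_sub hε (hR n) ξ]
  refine tendsto_integral_of_dominated_convergence (fun θ => 2 * (|Ω θ| * logKer ξ θ))
    (fun n => h.aestronglyMeasurable_osc hε (hR n) ξ) ((h.integrable_mul ξ).const_mul 2)
    (fun n => ?_) (ae_tendsto_osc hε hξ)
  filter_upwards [ae_inner_ne_zero hξ] with θ h0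
  exact norm_mul_osc_le hε (hR n) hξ h0

theorem Admissible.abs_truncSymb_le {ε : ℝ} {ξ : Plane} (hξ : ξ ≠ 0) :
    |truncSymb Ω ε ξ| ≤ M := by
  rw [← Real.norm_eq_abs]
  refine (norm_integral_le_of_norm_le (h.integrable_mul ξ) ?_).trans (h.integral_le ξ)
  filter_upwards [ae_inner_ne_zero hξ] with θ h0
  rw [norm_mul, Real.norm_eq_abs, Real.norm_eq_abs]
  exact mul_le_mul_of_nonneg_left (abs_oscLog_le_logKer hξ h0 ε) (abs_nonneg _)

theorem Admissible.tendsto_truncSymb {ξ : Plane} (hξ : ξ ≠ 0) :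
    Tendsto (fun ε : ℝ => truncSymb Ω ε ξ) (𝓝[>] 0) (𝓝 (symb Ω ξ)) := by
  refine tendsto_integral_filter_of_dominated_convergence (fun θ => |Ω θ| * logKer ξ θ) ?_ ?_
    (h.integrable_mul ξ) ?_
  · filter_upwards [self_mem_nhdsWithin] with ε hε
    exact aestronglyMeasurable_of_tendsto_ae atTop
      (fun n : ℕ => h.aestronglyMeasurable_osc hε (R := ε + n) (by simp) ξ) (ae_tendsto_osc hε hξ)
  · refine Eventually.of_forall fun ε => ?_
    filter_upwards [ae_inner_ne_zero hξ] with θ h0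
    rw [norm_mul, Real.norm_eq_abs, Real.norm_eq_abs]
    exact mul_le_mul_of_nonneg_left (abs_oscLog_le_logKer hξ h0 ε) (abs_nonneg _)
  · filter_upwards [ae_inner_ne_zero hξ] with θ h0
    rw [logKer_eq_log_div hξ θ]
    exact (tendsto_oscLog_zero (abs_pos.2 h0) (abs_inner_coe_le_norm ξ θ)).const_mul _

theorem Admissible.abs_symb_le (ξ : Plane) : |symb Ω ξ| ≤ M := by
  rw [← Real.norm_eq_abs]
  refine (norm_integral_le_of_norm_le (h.integrable_mul ξ) ?_).trans (h.integral_le ξ)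
  refine ae_of_all _ fun θ => ?_
  rw [norm_mul, Real.norm_eq_abs, Real.norm_of_nonneg (logKer_nonneg ξ θ)]

end Multiplier

/-- The character `x ↦ exp(2πi ⟨x, ξ⟩)`. -/
def char (x ξ : Plane) : ℂ := Complex.exp ((2 * Real.pi * inner ℝ x ξ : ℝ) * Complex.I)

theorem norm_char (x ξ : Plane) : ‖char x ξ‖ = 1 := Complex.norm_exp_ofReal_mul_I _

theorem measurable_char {X : Type*} [MeasurableSpace X] {u v : X → Plane} (hu : Measurable u)
    (hv : Measurable v) : Measurable fun t => char (u t) (v t) := by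
  have h : Measurable fun t => inner ℝ (u t) (v t) := hu.inner hv
  unfold char
  fun_prop

theorem char_sub_left (x z ξ : Plane) : char (x - z) ξ = char x ξ * char (-z) ξ := by
  rw [char, char, char, ← Complex.exp_add, sub_eq_add_neg, inner_add_left]
  congr 1
  push_cast
  ring

theorem integral_roughKernel_mul_char {Ω : Circ → ℝ} (hΩ : Integrable Ω arcLength)
    (heven : ∀ θ, Ω (-θ) = Ω θ) {ε R : ℝ} (hε : 0 < ε) (ξ : Plane) :
    ∫ z in {z : Plane | ε < ‖z‖ ∧ ‖z‖ ≤ R}, (roughKernel Ω z : ℂ) * char (-z) ξ =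
      annulusSymb Ω ε R ξ := by
  set S := {z : Plane | ε < ‖z‖ ∧ ‖z‖ ≤ R}
  have hS : MeasurableSet S := measurableSet_annulus ε R
  have hc : Continuous fun z : Plane => Real.sin (2 * Real.pi * inner ℝ z ξ) := by fun_prop
  have his : IntegrableOn (fun z => roughKernel Ω z * Real.sin (2 * Real.pi * inner ℝ z ξ)) S :=
    ((integrableOn_roughKernel_annulus hΩ hε (R := R)).integrable.bdd_mul
      hc.aestronglyMeasurable (c := 1) (ae_of_all _ fun z => Real.abs_sin_le_one _)).congr
      (ae_of_all _ fun z => mul_comm _ _)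
  have hsin : ∫ z in S, roughKernel Ω z * Real.sin (2 * Real.pi * inner ℝ z ξ) = 0 := by
    rw [← integral_indicator hS]
    set G := S.indicator fun z => roughKernel Ω z * Real.sin (2 * Real.pi * inner ℝ z ξ)
    have hodd : ∀ z, G (-z) = -G z := fun z => by
      have hmem : -z ∈ S ↔ z ∈ S := by simp [S]
      by_cases hz : z ∈ S
      · simp only [G, indicator_of_mem hz, indicator_of_mem (hmem.2 hz), roughKernel_neg heven,
          inner_neg_left, mul_neg, Real.sin_neg]
      · simp only [G, indicator_of_notMem hz, indicator_of_notMem (fun h => hz (hmem.1 h)),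
          neg_zero]
    have h1 := integral_neg_eq_self G (volume : Measure Plane)
    simp only [hodd, integral_neg] at h1
    linarith
  have hpt : ∀ z, (roughKernel Ω z : ℂ) * char (-z) ξ =
      ((roughKernel Ω z * Real.cos (2 * Real.pi * inner ℝ z ξ) : ℝ) : ℂ) -
        ((roughKernel Ω z * Real.sin (2 * Real.pi * inner ℝ z ξ) : ℝ) : ℂ) * Complex.I := by
    intro z
    rw [char, Complex.exp_mul_I, inner_neg_left, ← Complex.ofReal_cos, ← Complex.ofReal_sin,
      mul_neg, Real.cos_neg, Real.sin_neg]
    push_cast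
    ring
  simp only [hpt]
  rw [integral_sub (integrableOn_roughKernel_mul_cos hΩ R hε ξ).integrable.ofReal
    (his.integrable.ofReal.mul_const _), integral_mul_const, integral_complex_ofReal,
    integral_complex_ofReal, hsin, annulusSymb]
  simp only [Complex.ofReal_zero, zero_mul, sub_zero]
  rfl

theorem integrableOn_roughKernel_mul_schwartz {Ω : Circ → ℝ} (hΩ : Integrable Ω arcLength)
    (f : 𝓢(Plane, ℂ)) (x : Plane) {ε : ℝ} (hε : 0 < ε) :
    IntegrableOn (fun z => (roughKernel Ω z : ℂ) * f (x - z)) {z : Plane | ε < ‖z‖} := by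
  obtain ⟨C0, -, hC0⟩ := f.decay 0 0
  obtain ⟨C1, -, hC1⟩ := f.decay 1 0
  simp only [pow_zero, one_mul, norm_iteratedFDeriv_zero, pow_one] at hC0 hC1
  have hS : MeasurableSet {z : Plane | ε < ‖z‖} := measurableSet_lt measurable_const measurable_norm
  have hg : AEStronglyMeasurable (fun z => ((‖z‖ : ℝ) : ℂ) * f (x - z))
      (volume.restrict {z : Plane | ε < ‖z‖}) := by
    have : Continuous fun z => ((‖z‖ : ℝ) : ℂ) * f (x - z) :=
      (Complex.continuous_ofReal.comp continuous_norm).mul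
        (f.continuous.comp (continuous_const.sub continuous_id))
    exact this.aestronglyMeasurable
  refine ((integrableOn_roughKernel_mul_inv_norm hΩ hε).integrable.ofReal.bdd_mul hg
    (c := ‖x‖ * C0 + C1) (ae_of_all _ fun z => ?_)).congr ?_
  · rw [norm_mul, Complex.norm_real, norm_norm]
    have h1 : ‖z‖ ≤ ‖x‖ + ‖x - z‖ := by
      have := norm_sub_le x (x - z)
      simpa using this
    calc ‖z‖ * ‖f (x - z)‖ ≤ (‖x‖ + ‖x - z‖) * ‖f (x - z)‖ := by gcongr
      _ = ‖x‖ * ‖f (x - z)‖ + ‖x - z‖ * ‖f (x - z)‖ := by ring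
      _ ≤ _ := by
        gcongr
        · exact hC0 _
        · exact hC1 _
  · refine (ae_restrict_iff' hS).2 (ae_of_all _ fun z hz => ?_)
    have hz0 : (‖z‖ : ℂ) ≠ 0 := by
      have : 0 < ‖z‖ := hε.trans hz
      exact_mod_cast this.ne'
    simp only [Complex.coe_algebraMap, RCLike.ofReal_mul, RCLike.ofReal_inv]
    field_simp

theorem truncSI_eq (Ω : Circ → ℝ) (f : Plane → ℂ) (ε : ℝ) (x : Plane) :
    truncSI Ω f ε x = ∫ z in {z : Plane | ε < ‖z‖}, (roughKernel Ω z : ℂ) * f (x - z) := by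
  have hS : MeasurableSet {z : Plane | ε < ‖z‖} := measurableSet_lt measurable_const measurable_norm
  have hS' : MeasurableSet {y : Plane | ε < ‖x - y‖} :=
    measurableSet_lt measurable_const (by fun_prop)
  rw [truncSI, ← integral_indicator hS, ← integral_indicator hS', ← integral_sub_left_eq_self _ _ x]
  congr 1
  funext y
  simp [indicator]

theorem integrableOn_truncSI {Ω : Circ → ℝ} (hΩ : Integrable Ω arcLength) (f : 𝓢(Plane, ℂ))
    (x : Plane) {ε : ℝ} (hε : 0 < ε) :
    IntegrableOn (fun y : Plane => (roughKernel Ω (x - y) : ℂ) * f y)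
      {y : Plane | ε < ‖x - y‖} := by
  have hS : MeasurableSet {z : Plane | ε < ‖z‖} := measurableSet_lt measurable_const measurable_norm
  have hS' : MeasurableSet {y : Plane | ε < ‖x - y‖} :=
    measurableSet_lt measurable_const (by fun_prop)
  have h1 := ((integrable_indicator_iff hS).2
    (integrableOn_roughKernel_mul_schwartz hΩ f x hε)).comp_sub_left x
  rw [← integrable_indicator_iff hS']
  refine h1.congr (ae_of_all _ fun y => ?_)
  simp [indicator]

section Superposition

variable {Ω : Circ → ℝ} {M : ℝ} (h : Admissible Ω M) {f : 𝓢(Plane, ℂ)} {a : Plane → ℂ}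
  (ha : Integrable a) {γ : Plane → Plane} (hγ : Measurable γ) (hγ0 : ∀ᵐ η, γ η ≠ 0)
  (hf : ∀ x, f x = ∫ η, a η * char x (γ η))

include h ha hγ hf

theorem Admissible.annulus_eq {ε R : ℝ} (hε : 0 < ε) (x : Plane) :
    ∫ z in {z : Plane | ε < ‖z‖ ∧ ‖z‖ ≤ R}, (roughKernel Ω z : ℂ) * f (x - z) =
      ∫ η, a η * char x (γ η) * annulusSymb Ω ε R (γ η) := by
  simp only [hf, ← integral_const_mul]
  rw [integral_integral_swap]
  · refine integral_congr_ae (ae_of_all _ fun η => ?_)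
    simp only
    rw [← integral_roughKernel_mul_char h.integrable h.even hε, ← integral_const_mul]
    congr 1
    funext z
    rw [char_sub_left]
    ring
  · have hK : IntegrableOn (fun z => (roughKernel Ω z : ℂ)) {z : Plane | ε < ‖z‖ ∧ ‖z‖ ≤ R} :=
      (integrableOn_roughKernel_annulus h.integrable hε (R := R)).integrable.ofReal
    have h1 := hK.integrable.mul_prod ha
    have hm : Measurable fun p : Plane × Plane => char (x - p.1) (γ p.2) :=
      measurable_char (measurable_const.sub measurable_fst) (hγ.comp measurable_snd)
    have h2 := h1.bdd_mul (hm.aestronglyMeasurable (μ := _)) (c := 1)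
      (ae_of_all _ fun p => (norm_char (x - p.1) (γ p.2)).le)
    refine h2.congr (ae_of_all _ fun p => ?_)
    simp only [Function.uncurry_def]
    ring

omit hf in
theorem Admissible.aestronglyMeasurable_annulus {ε : ℝ} (R : ℝ) (hε : 0 < ε) (x : Plane) :
    AEStronglyMeasurable (fun η => a η * char x (γ η) * annulusSymb Ω ε R (γ η)) := by
  have h1 : Measurable fun η => char x (γ η) :=
    measurable_char measurable_const hγ
  have h2 : Measurable fun η => (annulusSymb Ω ε R (γ η) : ℂ) :=
    Complex.measurable_ofReal.comp
      ((continuous_annulusSymb h.integrable R hε).measurable.comp hγ)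
  have h3 : AEStronglyMeasurable fun η => a η * char x (γ η) :=
    ha.aestronglyMeasurable.mul h1.aestronglyMeasurable
  exact h3.mul h2.aestronglyMeasurable

include hγ0

omit ha hγ hf in
theorem Admissible.ae_tendsto_annulus {ε : ℝ} (hε : 0 < ε) (x : Plane) :
    ∀ᵐ η, Tendsto (fun n : ℕ => a η * char x (γ η) * annulusSymb Ω ε (ε + n) (γ η)) atTop
      (𝓝 (a η * char x (γ η) * truncSymb Ω ε (γ η))) := by
  filter_upwards [hγ0] with η h0
  exact ((Complex.continuous_ofReal.tendsto _).comp (h.tendsto_annulusSymb hε h0)).const_mul _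

theorem Admissible.truncSI_eq_integral {ε : ℝ} (hε : 0 < ε) (x : Plane) :
    truncSI Ω f ε x = ∫ η, a η * char x (γ η) * truncSymb Ω ε (γ η) := by
  have hi := (integrableOn_roughKernel_mul_schwartz h.integrable f x hε)
  set S := {z : Plane | ε < ‖z‖}
  have hS : MeasurableSet S := measurableSet_lt measurable_const measurable_norm
  have hleft : Tendsto (fun n : ℕ => ∫ z in {z : Plane | ε < ‖z‖ ∧ ‖z‖ ≤ ε + n},
      (roughKernel Ω z : ℂ) * f (x - z)) atTop (𝓝 (truncSI Ω f ε x)) := by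
    rw [truncSI_eq]
    have hU : S = ⋃ n : ℕ, {z : Plane | ε < ‖z‖ ∧ ‖z‖ ≤ ε + n} := by
      ext z
      simp only [S, mem_ofPred_eq, mem_iUnion]
      refine ⟨fun hz => ?_, fun ⟨n, hn⟩ => hn.1⟩
      obtain ⟨n, hn⟩ := exists_nat_ge ‖z‖
      exact ⟨n, hz, by linarith⟩
    have := tendsto_setIntegral_of_monotone (μ := (volume : Measure Plane))
      (s := fun n : ℕ => {z : Plane | ε < ‖z‖ ∧ ‖z‖ ≤ ε + n})
      (f := fun z => (roughKernel Ω z : ℂ) * f (x - z)) (fun n => measurableSet_annulus ε _)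
      (fun m n hmn z hz => ⟨hz.1, hz.2.trans (by gcongr)⟩) (by rw [← hU]; exact hi)
    rwa [← hU] at this
  simp only [h.annulus_eq ha hγ hf hε] at hleft
  refine tendsto_nhds_unique hleft ?_
  refine tendsto_integral_of_dominated_convergence (fun η => ‖a η‖ * (2 * M))
    (fun n => h.aestronglyMeasurable_annulus ha hγ _ hε x) (ha.norm.mul_const _)
    (fun n => ?_) (h.ae_tendsto_annulus hγ0 hε x)
  filter_upwards [hγ0] with η h0
  rw [norm_mul, norm_mul, norm_char, mul_one, Complex.norm_real]
  exact mul_le_mul_of_nonneg_left (h.abs_annulusSymb_le hε (by simp) h0) (norm_nonneg _)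

/-- If `f` is a superposition of the characters `char · (γ η)`, then `T_Ω f` is the superposition of
the same characters weighted by `symb Ω (γ η)`. -/
theorem Admissible.tendsto_truncSI (x : Plane) :
    Tendsto (fun ε : ℝ => truncSI Ω f ε x) (𝓝[>] 0)
      (𝓝 (∫ η, a η * char x (γ η) * symb Ω (γ η))) := by
  have heq : ∀ᶠ ε in 𝓝[>] (0 : ℝ), ∫ η, a η * char x (γ η) * truncSymb Ω ε (γ η) =
      truncSI Ω f ε x := by
    filter_upwards [self_mem_nhdsWithin] with ε hε
    rw [h.truncSI_eq_integral ha hγ hγ0 hf hε]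
  refine Tendsto.congr' heq ?_
  refine tendsto_integral_filter_of_dominated_convergence (fun η => ‖a η‖ * M) ?_ ?_
    (ha.norm.mul_const _) ?_
  · filter_upwards [self_mem_nhdsWithin] with ε hε
    exact aestronglyMeasurable_of_tendsto_ae atTop
      (fun n : ℕ => h.aestronglyMeasurable_annulus ha hγ (ε + n) hε x)
      (h.ae_tendsto_annulus hγ0 hε x)
  · refine Eventually.of_forall fun ε => ?_
    filter_upwards [hγ0] with η h0
    rw [norm_mul, norm_mul, norm_char, mul_one, Complex.norm_real]
    exact mul_le_mul_of_nonneg_left (h.abs_truncSymb_le h0) (norm_nonneg _)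
  · filter_upwards [hγ0] with η h0
    exact ((Complex.continuous_ofReal.tendsto _).comp (h.tendsto_truncSymb h0)).const_mul _

end Superposition

theorem measurable_symb {Ω : Circ → ℝ} (hΩ : AEStronglyMeasurable Ω arcLength) :
    Measurable (symb Ω) := by
  have h1 : symb Ω = symb (hΩ.mk Ω) := by
    funext ξ
    refine integral_congr_ae ?_
    filter_upwards [hΩ.ae_eq_mk] with θ hθ
    rw [hθ]
  rw [h1]
  have h2 : StronglyMeasurable fun p : Plane × Circ => hΩ.mk Ω p.2 * logKer p.1 p.2 :=
    (hΩ.stronglyMeasurable_mk.comp_measurable measurable_snd).mul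
      measurable_logKer.stronglyMeasurable
  exact (h2.integral_prod_right' (ν := arcLength)).measurable

theorem fourierInv_eq_integral_char (u : Plane → ℂ) (x : Plane) :
    FourierTransformInv.fourierInv u x = ∫ ξ, u ξ * char x ξ := by
  rw [Real.fourierInv_eq']
  refine integral_congr_ae (ae_of_all _ fun ξ => ?_)
  simp only [char, smul_eq_mul, real_inner_comm]
  rw [mul_comm]

theorem schwartz_eq_integral_char (f : 𝓢(Plane, ℂ)) (x : Plane) :
    f x = ∫ ξ, (FourierTransform.fourier f : 𝓢(Plane, ℂ)) ξ * char x ξ := by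
  rw [← fourierInv_eq_integral_char, ← SchwartzMap.fourierInv_coe]
  simp

section Main

variable {Ω : Circ → ℝ} {M : ℝ} (h : Admissible Ω M)

include h

theorem Admissible.tendsto_truncSI_schwartz (f : 𝓢(Plane, ℂ)) (x : Plane) :
    Tendsto (fun ε : ℝ => truncSI Ω f ε x) (𝓝[>] 0)
      (𝓝 (∫ ξ, (FourierTransform.fourier f : 𝓢(Plane, ℂ)) ξ * char x ξ * symb Ω ξ)) :=
  h.tendsto_truncSI (SchwartzMap.integrable _) measurable_id
    (Measure.ae_ne volume (0 : Plane)) (schwartz_eq_integral_char f) x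

theorem Admissible.pvExists (f : 𝓢(Plane, ℂ)) (x : Plane) : PVExists Ω f x :=
  ⟨fun _ hε => integrableOn_truncSI h.integrable f x hε, _, h.tendsto_truncSI_schwartz f x⟩

theorem Admissible.tendsto_roughSI (f : 𝓢(Plane, ℂ)) (x : Plane) :
    Tendsto (fun ε : ℝ => truncSI Ω f ε x) (𝓝[>] 0) (𝓝 (roughSI Ω f x)) :=
  tendsto_nhds_limUnder ⟨_, h.tendsto_truncSI_schwartz f x⟩

theorem Admissible.roughSI_eq_fourierInv (f : 𝓢(Plane, ℂ)) :
    roughSI Ω f = FourierTransformInv.fourierInv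
      fun ξ => (FourierTransform.fourier f : 𝓢(Plane, ℂ)) ξ * symb Ω ξ := by
  funext x
  rw [fourierInv_eq_integral_char]
  refine ((h.tendsto_truncSI_schwartz f x).limUnder_eq).trans ?_
  refine integral_congr_ae (ae_of_all _ fun ξ => ?_)
  ring

end Main

/-! ### Boundedness on `L²` -/

theorem char_comm (x ξ : Plane) : char x ξ = char ξ x := by
  rw [char, char, real_inner_comm]

theorem integral_mul_fourierInv {u g : Plane → ℂ} (hu : Integrable u) (hg : Integrable g) :
    ∫ x, g x * FourierTransformInv.fourierInv u x =
      ∫ ξ, FourierTransformInv.fourierInv g ξ * u ξ := by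
  simp only [fourierInv_eq_integral_char, ← integral_const_mul, ← integral_mul_const]
  rw [integral_integral_swap]
  · refine integral_congr_ae (ae_of_all _ fun ξ => integral_congr_ae (ae_of_all _ fun x => ?_))
    simp only [char_comm x ξ]
    ring
  · have h1 := hg.mul_prod hu
    have hm : Measurable fun p : Plane × Plane => char p.1 p.2 :=
      measurable_char measurable_fst measurable_snd
    have h2 := h1.bdd_mul (hm.aestronglyMeasurable (μ := _)) (c := 1)
      (ae_of_all _ fun p => (norm_char p.1 p.2).le)
    refine h2.congr (ae_of_all _ fun p => ?_)
    simp only [Function.uncurry_def]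
    ring

theorem continuous_fourierInv {u : Plane → ℂ} (hu : Integrable u) :
    Continuous (FourierTransformInv.fourierInv u) := by
  have h1 : FourierTransformInv.fourierInv u = fun x => FourierTransform.fourier u (-x) := by
    funext x
    exact Real.fourierInv_eq_fourier_neg u x
  rw [h1]
  have h2 : Continuous (FourierTransform.fourier u) :=
    VectorFourier.fourierIntegral_continuous Real.continuous_fourierChar
      (by exact continuous_inner) hu
  exact h2.comp continuous_neg

/-- On `L¹ ∩ L²` the integral formula for the inverse Fourier transform agrees with its extension to
`L²`, and thus preserves the `L²` norm. -/
theorem eLpNorm_fourierInv {u : Plane → ℂ} (hu : Integrable u) (hu2 : MemLp u 2) :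
    eLpNorm (FourierTransformInv.fourierInv u) 2 volume = eLpNorm u 2 volume := by
  set U : Lp ℂ 2 (volume : Measure Plane) := hu2.toLp u
  set V : Lp ℂ 2 (volume : Measure Plane) := FourierTransformInv.fourierInv U
  have hcont := continuous_fourierInv hu
  have hae : ∀ᵐ x, V x = FourierTransformInv.fourierInv u x := by
    refine ae_eq_of_integral_contDiff_smul_eq
      ((Lp.memLp V).locallyIntegrable (by norm_num)) hcont.locallyIntegrable fun g hg hgs => ?_
    have hgs' : HasCompactSupport fun x => (g x : ℂ) :=
      hgs.comp_left (g := fun t : ℝ => (t : ℂ)) Complex.ofReal_zero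
    set G : 𝓢(Plane, ℂ) := hgs'.toSchwartzMap (Complex.ofRealCLM.contDiff.comp hg)
    have hG : ∀ x, G x = (g x : ℂ) := fun x => rfl
    have e1 := Lp.fourierInv_toTemperedDistribution_eq U
    have e2 := congrArg (fun D => D G) e1
    simp only [TemperedDistribution.fourierInv_apply, Lp.toTemperedDistribution_apply] at e2
    have e3 := integral_mul_fourierInv hu (SchwartzMap.integrable G)
    have e4 : ∫ x, (FourierTransformInv.fourierInv G : 𝓢(Plane, ℂ)) x • U x =
        ∫ ξ, FourierTransformInv.fourierInv (G : Plane → ℂ) ξ * u ξ := by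
      refine integral_congr_ae ?_
      filter_upwards [hu2.coeFn_toLp] with x hx
      rw [smul_eq_mul, hx, SchwartzMap.fourierInv_coe]
    calc ∫ x, g x • V x = ∫ x, G x • V x := by simp only [hG, Complex.real_smul, smul_eq_mul]
      _ = ∫ x, G x * FourierTransformInv.fourierInv u x := by rw [← e2, e4, e3]
      _ = _ := by simp only [hG, Complex.real_smul]
  have hn : ‖V‖ = ‖U‖ := (Lp.fourierTransformₗᵢ Plane ℂ).symm.norm_map U
  rw [← eLpNorm_congr_ae hae, ← eLpNorm_congr_ae hu2.coeFn_toLp]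
  rw [Lp.norm_def, Lp.norm_def, ENNReal.toReal_eq_toReal_iff' (Lp.eLpNorm_ne_top V)
    (Lp.eLpNorm_ne_top U)] at hn
  exact hn

theorem Admissible.norm_symb_le {Ω : Circ → ℝ} {M : ℝ} (h : Admissible Ω M) (ξ : Plane) :
    ‖(symb Ω ξ : ℂ)‖ ≤ M := by
  rw [Complex.norm_real]
  exact h.abs_symb_le ξ

theorem Admissible.integrable_mul_symb {Ω : Circ → ℝ} {M : ℝ} (h : Admissible Ω M)
    (F : 𝓢(Plane, ℂ)) : Integrable fun ξ => F ξ * symb Ω ξ := by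
  have hm : Measurable fun ξ => (symb Ω ξ : ℂ) :=
    Complex.measurable_ofReal.comp (measurable_symb h.integrable.aestronglyMeasurable)
  exact ((SchwartzMap.integrable F).bdd_mul hm.aestronglyMeasurable
    (ae_of_all _ h.norm_symb_le)).congr (ae_of_all _ fun ξ => mul_comm _ _)

theorem Admissible.continuous_roughSI {Ω : Circ → ℝ} {M : ℝ} (h : Admissible Ω M)
    (f : 𝓢(Plane, ℂ)) : Continuous (roughSI Ω f) := by
  rw [h.roughSI_eq_fourierInv]
  exact continuous_fourierInv (h.integrable_mul_symb _)

theorem Admissible.boundedOnLp_two {Ω : Circ → ℝ} {M : ℝ} (h : Admissible Ω M) :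
    BoundedOnLp Ω 2 := by
  refine ⟨M.toNNReal, fun f => ?_⟩
  set F : 𝓢(Plane, ℂ) := FourierTransform.fourier f with hF
  have hb := h.norm_symb_le
  have hi := h.integrable_mul_symb F
  have hle : eLpNorm (fun ξ => F ξ * symb Ω ξ) 2 volume ≤
      ENNReal.ofReal M * eLpNorm F 2 volume := by
    refine eLpNorm_le_mul_eLpNorm_of_ae_le_mul (ae_of_all _ fun ξ => ?_) 2
    rw [norm_mul, mul_comm]
    exact mul_le_mul_of_nonneg_right (hb ξ) (norm_nonneg _)
  have hF2 : MemLp F 2 volume := SchwartzMap.memLp F 2 volume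
  have h2 : MemLp (fun ξ => F ξ * symb Ω ξ) 2 volume :=
    ⟨hi.aestronglyMeasurable, hle.trans_lt (ENNReal.mul_lt_top ENNReal.ofReal_lt_top hF2.2)⟩
  rw [h.roughSI_eq_fourierInv, eLpNorm_fourierInv hi h2]
  refine hle.trans_eq ?_
  congr 1
  rw [← eLpNorm_fourierInv (SchwartzMap.integrable F) hF2, ← SchwartzMap.fourierInv_coe, hF]
  simp

/-! ### Modulated bumps -/

/-- A smooth bump that is `1` on the ball of radius `2` and vanishes off the ball of radius `3`. -/
def bumpFn : ContDiffBump (0 : Plane) := ⟨2, 3, by norm_num, by norm_num⟩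

theorem contDiff_char (ξ : Plane) : ContDiff ℝ (⊤ : ℕ∞) fun x => char x ξ := by
  unfold char
  have h1 : ContDiff ℝ (⊤ : ℕ∞) fun x : Plane => 2 * Real.pi * inner ℝ x ξ :=
    contDiff_const.mul (contDiff_id.inner ℝ contDiff_const)
  exact ((Complex.ofRealCLM.contDiff.comp h1).mul contDiff_const).cexp

theorem contDiff_modBump (L : ℝ) (ξ : Plane) :
    ContDiff ℝ (⊤ : ℕ∞) fun x : Plane => (bumpFn (L⁻¹ • x) : ℂ) * char x ξ := by
  have h1 : ContDiff ℝ (⊤ : ℕ∞) fun x : Plane => bumpFn (L⁻¹ • x) :=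
    bumpFn.contDiff.comp (contDiff_id.const_smul L⁻¹)
  exact (Complex.ofRealCLM.contDiff.comp h1).mul (contDiff_char ξ)

theorem hasCompactSupport_modBump {L : ℝ} (hL : L ≠ 0) (ξ : Plane) :
    HasCompactSupport fun x : Plane => (bumpFn (L⁻¹ • x) : ℂ) * char x ξ := by
  have h1 : HasCompactSupport fun x : Plane => bumpFn (L⁻¹ • x) :=
    bumpFn.hasCompactSupport.comp_homeomorph (Homeomorph.smulOfNeZero L⁻¹ (inv_ne_zero hL))
  have h2 : HasCompactSupport fun x : Plane => (bumpFn (L⁻¹ • x) : ℂ) :=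
    h1.comp_left (g := fun t : ℝ => (t : ℂ)) Complex.ofReal_zero
  exact h2.mul_right

/-- The Schwartz function `x ↦ bump(x / (n + 1)) exp(2πi ⟨x, ξ⟩)`. -/
def modBump (n : ℕ) (ξ : Plane) : 𝓢(Plane, ℂ) :=
  (hasCompactSupport_modBump (L := (n : ℝ) + 1) (by positivity) ξ).toSchwartzMap
    (contDiff_modBump _ ξ)

theorem modBump_apply (n : ℕ) (ξ x : Plane) :
    modBump n ξ x = (bumpFn (((n : ℝ) + 1)⁻¹ • x) : ℂ) * char x ξ := rfl

/-- The bump as a Schwartz function. -/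
def bump : 𝓢(Plane, ℂ) := modBump 0 0

theorem bump_apply (x : Plane) : bump x = (bumpFn x : ℂ) := by
  simp [bump, modBump_apply, char]

theorem char_smul_right (c : ℝ) (x ξ : Plane) : char x (c • ξ) = char (c • x) ξ := by
  simp only [char, inner_smul_left, inner_smul_right, conj_trivial]

theorem char_add_right (x ξ η : Plane) : char x (ξ + η) = char x ξ * char x η := by
  rw [char, char, char, ← Complex.exp_add, inner_add_right]
  congr 1
  push_cast
  ring

theorem modBump_eq_integral (n : ℕ) (ξ x : Plane) :
    modBump n ξ x = ∫ η, (FourierTransform.fourier bump : 𝓢(Plane, ℂ)) η *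
      char x (ξ + ((n : ℝ) + 1)⁻¹ • η) := by
  rw [modBump_apply, ← bump_apply, schwartz_eq_integral_char, ← integral_mul_const]
  refine integral_congr_ae (ae_of_all _ fun η => ?_)
  simp only [char_add_right, char_smul_right]
  ring

theorem ae_add_smul_ne_zero {c : ℝ} (hc : c ≠ 0) (ξ : Plane) : ∀ᵐ η : Plane, ξ + c • η ≠ 0 := by
  filter_upwards [Measure.ae_ne volume (-(c⁻¹ • ξ))] with η hη h0
  apply hη
  have : c • η = -ξ := by rw [eq_neg_iff_add_eq_zero, add_comm]; exact h0
  rw [← smul_neg, ← this, smul_smul, inv_mul_cancel₀ hc, one_smul]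

/-- The mean oscillation of the symbol at `ξ` on the scale `1 / (n + 1)`, with respect to the weight
given by the modulus of the Fourier transform of the bump. -/
def symbOsc (Ω : Circ → ℝ) (n : ℕ) (ξ : Plane) : ℝ :=
  ∫ η, ‖(FourierTransform.fourier bump : 𝓢(Plane, ℂ)) η‖ *
    |symb Ω (ξ + ((n : ℝ) + 1)⁻¹ • η) - symb Ω ξ|

section Test

variable {Ω : Circ → ℝ} {M : ℝ} (h : Admissible Ω M)

include h

theorem Admissible.tendsto_truncSI_modBump (n : ℕ) (ξ x : Plane) :
    Tendsto (fun ε : ℝ => truncSI Ω (modBump n ξ) ε x) (𝓝[>] 0)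
      (𝓝 (∫ η, (FourierTransform.fourier bump : 𝓢(Plane, ℂ)) η *
        char x (ξ + ((n : ℝ) + 1)⁻¹ • η) * symb Ω (ξ + ((n : ℝ) + 1)⁻¹ • η))) :=
  h.tendsto_truncSI (SchwartzMap.integrable _)
    (measurable_const.add (measurable_id.const_smul ((n : ℝ) + 1)⁻¹))
    (ae_add_smul_ne_zero (by positivity) ξ) (modBump_eq_integral n ξ) x

theorem Admissible.norm_roughSI_modBump_sub_le (n : ℕ) (ξ x : Plane) :
    ‖roughSI Ω (modBump n ξ) x - symb Ω ξ * modBump n ξ x‖ ≤ symbOsc Ω n ξ := by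
  set B : 𝓢(Plane, ℂ) := FourierTransform.fourier bump with hB
  set γ : Plane → Plane := fun η => ξ + ((n : ℝ) + 1)⁻¹ • η with hγ
  have hγm : Measurable γ := measurable_const.add (measurable_id.const_smul ((n : ℝ) + 1)⁻¹)
  have hsm : Measurable fun η => (symb Ω (γ η) : ℂ) :=
    Complex.measurable_ofReal.comp
      ((measurable_symb h.integrable.aestronglyMeasurable).comp hγm)
  have hi : Integrable fun η => B η * char x (γ η) :=
    ((SchwartzMap.integrable B).bdd_mul
      (measurable_char (measurable_const (a := x)) hγm).aestronglyMeasurable (c := 1)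
      (ae_of_all _ fun η => (norm_char _ _).le)).congr (ae_of_all _ fun η => mul_comm _ _)
  have hi2 : Integrable fun η => B η * char x (γ η) * symb Ω (γ η) :=
    (hi.bdd_mul hsm.aestronglyMeasurable (c := M) (ae_of_all _ fun η => by
      rw [Complex.norm_real]; exact h.abs_symb_le _)).congr (ae_of_all _ fun η => mul_comm _ _)
  have e1 : roughSI Ω (modBump n ξ) x = ∫ η, B η * char x (γ η) * symb Ω (γ η) :=
    (h.tendsto_truncSI_modBump n ξ x).limUnder_eq
  have e2 : symb Ω ξ * modBump n ξ x = ∫ η, symb Ω ξ * (B η * char x (γ η)) := by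
    rw [modBump_eq_integral, integral_const_mul]
  rw [e1, e2, ← integral_sub hi2 (hi.const_mul _)]
  refine (norm_integral_le_integral_norm _).trans_eq (integral_congr_ae (ae_of_all _ fun η => ?_))
  simp only
  have : B η * char x (γ η) * symb Ω (γ η) - symb Ω ξ * (B η * char x (γ η)) =
      B η * char x (γ η) * ((symb Ω (γ η) - symb Ω ξ : ℝ) : ℂ) := by
    push_cast
    ring
  rw [this, norm_mul, norm_mul, norm_char, mul_one, Complex.norm_real, Real.norm_eq_abs]

theorem Admissible.tendsto_symbOsc {ξ : Plane} (hξ : ContinuousAt (symb Ω) ξ) :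
    Tendsto (fun n => symbOsc Ω n ξ) atTop (𝓝 0) := by
  have hsm := measurable_symb h.integrable.aestronglyMeasurable
  have hlim : Tendsto (fun n : ℕ => symbOsc Ω n ξ) atTop (𝓝 (∫ _η : Plane, (0 : ℝ))) := by
    refine tendsto_integral_of_dominated_convergence
      (fun η => ‖(FourierTransform.fourier bump : 𝓢(Plane, ℂ)) η‖ * (2 * M)) (fun n => ?_)
      ((SchwartzMap.integrable _).norm.mul_const _) (fun n => ae_of_all _ fun η => ?_)
      (ae_of_all _ fun η => ?_)
    · have h1 : Measurable fun η => |symb Ω (ξ + ((n : ℝ) + 1)⁻¹ • η) - symb Ω ξ| :=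
        ((hsm.comp (measurable_const.add (measurable_id.const_smul ((n : ℝ) + 1)⁻¹))).sub
          measurable_const).abs
      exact ((SchwartzMap.integrable _).norm.aestronglyMeasurable).mul h1.aestronglyMeasurable
    · rw [norm_mul, norm_norm, Real.norm_eq_abs, abs_abs]
      have h1 := abs_sub (symb Ω (ξ + ((n : ℝ) + 1)⁻¹ • η)) (symb Ω ξ)
      have h2 := h.abs_symb_le (ξ + ((n : ℝ) + 1)⁻¹ • η)
      have h3 := h.abs_symb_le ξ
      exact mul_le_mul_of_nonneg_left (by linarith) (norm_nonneg _)
    · have h1 : Tendsto (fun n : ℕ => ((n : ℝ) + 1)⁻¹) atTop (𝓝 0) := by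
        simpa [one_div] using tendsto_one_div_add_atTop_nhds_zero_nat (𝕜 := ℝ)
      have h2 : Tendsto (fun n : ℕ => ξ + ((n : ℝ) + 1)⁻¹ • η) atTop (𝓝 ξ) := by
        simpa using (h1.smul_const η).const_add ξ
      have h3 := ((hξ.tendsto.comp h2).sub_const (symb Ω ξ)).abs.const_mul
        ‖(FourierTransform.fourier bump : 𝓢(Plane, ℂ)) η‖
      simpa using h3
  simpa using hlim

theorem Admissible.roughSI_sum {ι : Type*} (s : Finset ι) (b : ι → ℂ) (f : ι → 𝓢(Plane, ℂ))
    (x : Plane) : roughSI Ω (∑ k ∈ s, b k • f k : 𝓢(Plane, ℂ)) x =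
      ∑ k ∈ s, b k * roughSI Ω (f k) x := by
  have h1 : Tendsto (fun ε => ∑ k ∈ s, b k * truncSI Ω (f k) ε x) (𝓝[>] 0)
      (𝓝 (∑ k ∈ s, b k * roughSI Ω (f k) x)) :=
    tendsto_finsetSum _ fun k _ => (h.tendsto_roughSI (f k) x).const_mul _
  refine Tendsto.limUnder_eq (h1.congr' ?_)
  filter_upwards [self_mem_nhdsWithin] with ε hε
  simp only [truncSI, ← integral_const_mul]
  rw [← integral_finsetSum _ fun k _ =>
    (integrableOn_truncSI h.integrable (f k) x hε).integrable.const_mul _]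
  refine integral_congr_ae (ae_of_all _ fun y => ?_)
  simp only [sum_apply, smul_apply, smul_eq_mul, Finset.mul_sum]
  refine Finset.sum_congr rfl fun k _ => ?_
  ring

/-- On a superposition of modulated bumps `T_Ω` acts, up to a uniformly small error, by multiplying
each bump with the value of the symbol at its frequency. -/
theorem Admissible.eventually_norm_roughSI_sub_le {ι : Type*} (s : Finset ι) (b : ι → ℂ)
    {ξ : ι → Plane} (hξ : ∀ k ∈ s, ContinuousAt (symb Ω) (ξ k)) {δ : ℝ} (hδ : 0 < δ) :
    ∀ᶠ n : ℕ in atTop, ∀ x, ‖roughSI Ω (∑ k ∈ s, b k • modBump n (ξ k) : 𝓢(Plane, ℂ)) x -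
      ∑ k ∈ s, b k * (symb Ω (ξ k) * modBump n (ξ k) x)‖ ≤ δ := by
  have h1 : Tendsto (fun n : ℕ => ∑ k ∈ s, ‖b k‖ * symbOsc Ω n (ξ k)) atTop
      (𝓝 (∑ k ∈ s, ‖b k‖ * 0)) :=
    tendsto_finsetSum _ fun k hk => (h.tendsto_symbOsc (hξ k hk)).const_mul _
  simp only [mul_zero, Finset.sum_const_zero] at h1
  filter_upwards [h1.eventually_le_const hδ] with n hn x
  rw [h.roughSI_sum, ← Finset.sum_sub_distrib]
  refine ((norm_sum_le _ _).trans (Finset.sum_le_sum fun k _ => ?_)).trans hn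
  rw [← mul_sub, norm_mul]
  exact mul_le_mul_of_nonneg_left (h.norm_roughSI_modBump_sub_le n (ξ k) x) (norm_nonneg _)

end Test

/-! ### Trigonometric polynomials -/

/-- The point `exp(2πit)` of the unit circle. -/
def unitExp (t : ℝ) : ℂ := Complex.exp ((2 * Real.pi * t : ℝ) * Complex.I)

theorem norm_unitExp (t : ℝ) : ‖unitExp t‖ = 1 := Complex.norm_exp_ofReal_mul_I _

theorem continuous_unitExp : Continuous unitExp := by unfold unitExp; fun_prop

theorem unitExp_periodic : Function.Periodic unitExp 1 := fun t => by
  unfold unitExp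
  rw [Complex.exp_eq_exp_iff_exists_int]
  exact ⟨1, by push_cast; ring⟩

theorem unitExp_pow (t : ℝ) (k : ℕ) : unitExp t ^ k = unitExp (k * t) := by
  unfold unitExp
  rw [← Complex.exp_nat_mul]
  congr 1
  push_cast
  ring

/-- The trigonometric polynomial `∑_{k < N} b_k exp(2πikt)`. -/
def trigPoly (N : ℕ) (b : ℕ → ℂ) (t : ℝ) : ℂ := ∑ k ∈ Finset.range N, b k * unitExp t ^ k

theorem continuous_trigPoly (N : ℕ) (b : ℕ → ℂ) : Continuous (trigPoly N b) :=
  continuous_finsetSum _ fun k _ => continuous_const.mul (continuous_unitExp.pow k)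

theorem trigPoly_periodic (N : ℕ) (b : ℕ → ℂ) : Function.Periodic (trigPoly N b) 1 := fun t => by
  unfold trigPoly
  rw [unitExp_periodic t]

/-- The Rudin-Shapiro polynomials: the recursion `(p, q) ↦ (p + z ^ 2 ^ n q, p - z ^ 2 ^ n q)`
doubles `|p|² + |q|²` by the parallelogram law. -/
theorem exists_rudinShapiro (n : ℕ) : ∃ p q : ℕ → ℝ, (∀ k, |p k| = 1) ∧ (∀ k, |q k| = 1) ∧
    ∀ t, ‖trigPoly (2 ^ n) (fun k => p k) t‖ ^ 2 + ‖trigPoly (2 ^ n) (fun k => q k) t‖ ^ 2 =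
      2 ^ (n + 1) := by
  induction n with
  | zero =>
    refine ⟨fun _ => 1, fun _ => 1, by simp, by simp, fun t => ?_⟩
    simp [trigPoly]
    norm_num
  | succ n ih =>
    obtain ⟨p, q, hp, hq, h⟩ := ih
    refine ⟨fun k => if k < 2 ^ n then p k else q (k - 2 ^ n),
      fun k => if k < 2 ^ n then p k else -q (k - 2 ^ n), fun k => ?_, fun k => ?_, fun t => ?_⟩
    · dsimp only
      split_ifs <;> simp [hp, hq]
    · dsimp only
      split_ifs <;> simp [hp, hq]
    · have e1 : trigPoly (2 ^ (n + 1))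
          (fun k => ((if k < 2 ^ n then p k else q (k - 2 ^ n) : ℝ) : ℂ)) t =
          trigPoly (2 ^ n) (fun k => p k) t +
            unitExp t ^ (2 ^ n) * trigPoly (2 ^ n) (fun k => q k) t := by
        rw [trigPoly, pow_succ, mul_two, Finset.sum_range_add, trigPoly, trigPoly, Finset.mul_sum]
        congr 1
        · refine Finset.sum_congr rfl fun k hk => ?_
          rw [if_pos (Finset.mem_range.1 hk)]
        · refine Finset.sum_congr rfl fun k _ => ?_
          rw [if_neg (by omega), Nat.add_sub_cancel_left, pow_add]
          ring
      have e2 : trigPoly (2 ^ (n + 1))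
          (fun k => ((if k < 2 ^ n then p k else -q (k - 2 ^ n) : ℝ) : ℂ)) t =
          trigPoly (2 ^ n) (fun k => p k) t -
            unitExp t ^ (2 ^ n) * trigPoly (2 ^ n) (fun k => q k) t := by
        rw [trigPoly, pow_succ, mul_two, Finset.sum_range_add, trigPoly, trigPoly, Finset.mul_sum,
          sub_eq_add_neg, ← Finset.sum_neg_distrib]
        congr 1
        · refine Finset.sum_congr rfl fun k hk => ?_
          rw [if_pos (Finset.mem_range.1 hk)]
        · refine Finset.sum_congr rfl fun k _ => ?_
          rw [if_neg (by omega), Nat.add_sub_cancel_left, pow_add]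
          push_cast
          ring
      rw [e1, e2]
      have hpar := parallelogram_law_with_norm ℝ (trigPoly (2 ^ n) (fun k => p k) t)
        (unitExp t ^ (2 ^ n) * trigPoly (2 ^ n) (fun k => q k) t)
      rw [norm_mul, norm_pow, norm_unitExp, one_pow, one_mul] at hpar
      rw [pow_succ 2 (n + 1), ← h t]
      linarith

/-- Signs whose trigonometric polynomial is flat: bounded by a multiple of its `L²` norm, hence also
comparable to it on a set of measure bounded below. This set is taken away from the integers, where
the Dirichlet kernel is bounded. -/
structure FlatSigns (N : ℕ) (ε : ℕ → ℝ) : Prop where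
  abs_eq : ∀ k, |ε k| = 1
  norm_sq_le : ∀ t, ‖trigPoly N (fun k => ε k) t‖ ^ 2 ≤ 2 * N
  volume_ge : ENNReal.ofReal (1 / 4) ≤
    volume {t : ℝ | t ∈ Icc (1 / 8 : ℝ) (7 / 8) ∧ (N : ℝ) ≤ ‖trigPoly N (fun k => ε k) t‖ ^ 2}

/-- The sum of the squares of a Rudin-Shapiro pair is constant, so at every point one of the two is
large, and therefore one of them is large on a set of measure at least `1 / 4`. -/
theorem exists_flatSigns (n : ℕ) : ∃ ε, FlatSigns (2 ^ n) ε := by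
  obtain ⟨p, q, hp, hq, h⟩ := exists_rudinShapiro n
  set G : (ℕ → ℝ) → Set ℝ := fun r =>
    {t : ℝ | t ∈ Icc (1 / 8 : ℝ) (7 / 8) ∧
      ((2 ^ n : ℕ) : ℝ) ≤ ‖trigPoly (2 ^ n) (fun k => r k) t‖ ^ 2} with hG
  have hcov : Icc (1 / 8 : ℝ) (7 / 8) ⊆ G p ∪ G q := by
    intro t ht
    by_contra hn
    simp only [hG, mem_union, mem_ofPred_eq, ht, true_and, not_or, not_le] at hn
    have := h t
    push_cast at hn
    rw [pow_succ (2 : ℝ) n] at this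
    linarith [hn.1, hn.2]
  have hvol : ENNReal.ofReal (3 / 4) ≤ volume (G p) + volume (G q) := by
    have := (measure_mono hcov).trans (measure_union_le (μ := volume) (G p) (G q))
    rwa [Real.volume_Icc, show (7 / 8 : ℝ) - 1 / 8 = 3 / 4 by norm_num] at this
  have hsq : ∀ t, ‖trigPoly (2 ^ n) (fun k => p k) t‖ ^ 2 ≤ 2 * ((2 ^ n : ℕ) : ℝ) ∧
      ‖trigPoly (2 ^ n) (fun k => q k) t‖ ^ 2 ≤ 2 * ((2 ^ n : ℕ) : ℝ) := fun t => by
    have := h t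
    rw [pow_succ (2 : ℝ) n] at this
    push_cast
    constructor
    · nlinarith [sq_nonneg ‖trigPoly (2 ^ n) (fun k => (q k : ℂ)) t‖]
    · nlinarith [sq_nonneg ‖trigPoly (2 ^ n) (fun k => (p k : ℂ)) t‖]
  by_cases hcase : ENNReal.ofReal (1 / 4) ≤ volume (G p)
  · exact ⟨p, hp, fun t => (hsq t).1, hcase⟩
  · refine ⟨q, hq, fun t => (hsq t).2, ?_⟩
    by_contra hn
    rw [not_le] at hcase hn
    have h1 := hvol.trans_lt (ENNReal.add_lt_add hcase hn)
    rw [← ENNReal.ofReal_add (by norm_num) (by norm_num),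
      ENNReal.ofReal_lt_ofReal_iff (by norm_num)] at h1
    norm_num at h1

/-- The Dirichlet kernel. -/
def dirichlet (N : ℕ) : ℝ → ℂ := trigPoly N fun _ => 1

theorem norm_dirichlet_le (N : ℕ) (t : ℝ) : ‖dirichlet N t‖ ≤ N := by
  unfold dirichlet trigPoly
  refine (norm_sum_le _ _).trans ?_
  simp [norm_unitExp]

theorem norm_dirichlet_le_inv (N : ℕ) {t : ℝ} (h0 : 0 < t) (h1 : t < 1) :
    ‖dirichlet N t‖ ≤ (2 * min t (1 - t))⁻¹ := by
  have hm : 0 < min t (1 - t) := lt_min h0 (by linarith)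
  have hgeom : dirichlet N t * (unitExp t - 1) = unitExp t ^ N - 1 := by
    rw [dirichlet, trigPoly]
    simp only [one_mul]
    exact geom_sum_mul _ _
  have hup : ‖unitExp t ^ N - 1‖ ≤ 2 := by
    refine (norm_sub_le _ _).trans ?_
    rw [norm_pow, norm_unitExp]
    norm_num
  have hlow : 4 * min t (1 - t) ≤ ‖unitExp t - 1‖ := by
    have e1 : ‖unitExp t - 1‖ = 2 * |Real.sin (Real.pi * t)| := by
      rw [unitExp, mul_comm, Complex.norm_exp_I_mul_ofReal_sub_one, norm_mul, Real.norm_eq_abs,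
        Real.norm_eq_abs, abs_two]
      congr 3
      ring
    have hsin : 2 * min t (1 - t) ≤ Real.sin (Real.pi * t) := by
      have hpi := Real.pi_pos
      rcases le_total t (1 / 2) with ht | ht
      · rw [min_eq_left (by linarith)]
        have := Real.mul_le_sin (x := Real.pi * t) (by positivity) (by nlinarith)
        refine le_trans (le_of_eq ?_) this
        field_simp
      · rw [min_eq_right (by linarith)]
        have := Real.mul_le_sin (x := Real.pi * (1 - t))
          (mul_nonneg hpi.le (by linarith)) (by nlinarith)
        rw [mul_sub, mul_one, Real.sin_pi_sub] at this
        refine le_trans (le_of_eq ?_) this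
        field_simp
    rw [e1]
    have := le_abs_self (Real.sin (Real.pi * t))
    linarith
  have h2 : ‖dirichlet N t‖ * (4 * min t (1 - t)) ≤ 2 := by
    calc _ ≤ ‖dirichlet N t‖ * ‖unitExp t - 1‖ := by gcongr
      _ = ‖unitExp t ^ N - 1‖ := by rw [← norm_mul, hgeom]
      _ ≤ 2 := hup
  rw [← one_div, le_div_iff₀ (by positivity)]
  linarith

theorem half_le_norm_dirichlet (N : ℕ) {t : ℝ} (h0 : 0 ≤ t) (h1 : 8 * N * t ≤ 1) :
    (N : ℝ) / 2 ≤ ‖dirichlet N t‖ := by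
  refine le_trans ?_ (Complex.re_le_norm _)
  rw [dirichlet, trigPoly, Complex.re_sum]
  have h2 : ∀ k ∈ Finset.range N, (1 / 2 : ℝ) ≤ (1 * unitExp t ^ k).re := by
    intro k hk
    have hk' : (k : ℝ) ≤ N := by exact_mod_cast (Finset.mem_range.1 hk).le
    rw [one_mul, unitExp_pow, unitExp, Complex.exp_ofReal_mul_I_re]
    have h3 := Real.one_sub_sq_div_two_le_cos (x := 2 * Real.pi * (k * t))
    have hx0 : 0 ≤ 2 * Real.pi * (k * t) := by positivity
    have hx1 : 2 * Real.pi * (k * t) ≤ 1 := by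
      have : (k : ℝ) * t ≤ 1 / 8 := by nlinarith
      nlinarith [Real.pi_le_four, Real.pi_pos]
    nlinarith
  refine le_trans (le_of_eq ?_) (Finset.sum_le_sum h2)
  simp [div_eq_mul_inv]

/-- For `0 < q < 1`, interpolating `|D_N(t)| ≤ N` with `|D_N(t)| ≤ 1 / (2 dist(t, ℤ))` bounds the
`r + q`-th moment of `D_N` by a multiple of `N^r`. -/
theorem exists_lintegral_dirichlet_le {q r : ℝ} (hq0 : 0 < q) (hq : q < 1) (hr : 0 ≤ r) :
    ∃ K : ℝ, 0 < K ∧ ∀ N : ℕ, ∫⁻ t in Ico (0 : ℝ) 1, ENNReal.ofReal (‖dirichlet N t‖ ^ (r + q)) ≤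
      ENNReal.ofReal (K * (N : ℝ) ^ r) := by
  have hi1 : IntervalIntegrable (fun t : ℝ => t ^ (-q)) volume 0 1 :=
    intervalIntegral.intervalIntegrable_rpow' (by linarith)
  have hi2 : IntervalIntegrable (fun t : ℝ => (1 - t) ^ (-q)) volume 0 1 := by
    have := (hi1.comp_sub_left 1).symm
    simpa using this
  have hi : IntegrableOn (fun t : ℝ => t ^ (-q) + (1 - t) ^ (-q)) (Ioc 0 1) :=
    (hi1.add hi2).1
  set I := ∫ t in Ioc (0 : ℝ) 1, (t ^ (-q) + (1 - t) ^ (-q))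
  have hnn : ∀ t ∈ Ioc (0 : ℝ) 1, 0 ≤ t ^ (-q) + (1 - t) ^ (-q) := fun t ht =>
    add_nonneg (Real.rpow_nonneg ht.1.le _) (Real.rpow_nonneg (by linarith [ht.2]) _)
  have hI : 0 ≤ I := setIntegral_nonneg measurableSet_Ioc hnn
  refine ⟨I + 1, by positivity, fun N => ?_⟩
  have hpt : ∀ t ∈ Ioo (0 : ℝ) 1, ‖dirichlet N t‖ ^ (r + q) ≤
      (N : ℝ) ^ r * (t ^ (-q) + (1 - t) ^ (-q)) := by
    intro t ht
    have hm : 0 < min t (1 - t) := lt_min ht.1 (by linarith [ht.2])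
    rw [Real.rpow_add_of_nonneg (norm_nonneg _) hr hq0.le]
    refine mul_le_mul (Real.rpow_le_rpow (norm_nonneg _) (norm_dirichlet_le N t) hr) ?_
      (Real.rpow_nonneg (norm_nonneg _) _) (Real.rpow_nonneg (Nat.cast_nonneg _) _)
    calc ‖dirichlet N t‖ ^ q ≤ ((min t (1 - t))⁻¹) ^ q := by
          refine Real.rpow_le_rpow (norm_nonneg _)
            ((norm_dirichlet_le_inv N ht.1 ht.2).trans ?_) hq0.le
          gcongr
          linarith
      _ = (min t (1 - t)) ^ (-q) := by rw [Real.rpow_neg hm.le, Real.inv_rpow hm.le]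
      _ ≤ t ^ (-q) + (1 - t) ^ (-q) := by
          have a1 : 0 ≤ t ^ (-q) := Real.rpow_nonneg ht.1.le _
          have a2 : 0 ≤ (1 - t) ^ (-q) := Real.rpow_nonneg (by linarith [ht.2]) _
          rcases min_choice t (1 - t) with h | h <;> rw [h] <;> linarith
  calc ∫⁻ t in Ico (0 : ℝ) 1, ENNReal.ofReal (‖dirichlet N t‖ ^ (r + q))
      = ∫⁻ t in Ioo (0 : ℝ) 1, ENNReal.ofReal (‖dirichlet N t‖ ^ (r + q)) := by
        rw [Measure.restrict_congr_set Ioo_ae_eq_Ico]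
    _ ≤ ∫⁻ t in Ioo (0 : ℝ) 1, ENNReal.ofReal ((N : ℝ) ^ r * (t ^ (-q) + (1 - t) ^ (-q))) :=
        setLIntegral_mono' measurableSet_Ioo fun t ht => ENNReal.ofReal_le_ofReal (hpt t ht)
    _ = ∫⁻ t in Ioc (0 : ℝ) 1, ENNReal.ofReal ((N : ℝ) ^ r * (t ^ (-q) + (1 - t) ^ (-q))) := by
        rw [Measure.restrict_congr_set Ioo_ae_eq_Ioc]
    _ = ENNReal.ofReal ((N : ℝ) ^ r * I) := by
        rw [← ofReal_integral_eq_lintegral_ofReal (hi.const_mul _), integral_const_mul]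
        filter_upwards [ae_restrict_mem measurableSet_Ioc] with t ht
        exact mul_nonneg (Real.rpow_nonneg (Nat.cast_nonneg _) _) (hnn t ht)
    _ ≤ ENNReal.ofReal ((I + 1) * (N : ℝ) ^ r) := by
        refine ENNReal.ofReal_le_ofReal ?_
        have : (0 : ℝ) ≤ (N : ℝ) ^ r := Real.rpow_nonneg (Nat.cast_nonneg _) _
        nlinarith

/-! ### Periodic functions on boxes -/

theorem setLIntegral_Ico_of_periodic {f : ℝ → ℝ≥0∞} (hf : Function.Periodic f 1) (m : ℤ) (n : ℕ) :
    ∫⁻ t in Ico (m : ℝ) (m + n), f t = n * ∫⁻ t in Ico (0 : ℝ) 1, f t := by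
  have hone : ∀ a : ℤ, ∫⁻ t in Ico (a : ℝ) (a + 1), f t = ∫⁻ t in Ico (0 : ℝ) 1, f t := fun a => by
    have h1 := (measurePreserving_add_right volume (a : ℝ)).setLIntegral_comp_preimage_emb
      (measurableEmbedding_addRight (a : ℝ)) f (Ico (a : ℝ) (a + 1))
    have h2 : (fun x : ℝ => x + a) ⁻¹' Ico (a : ℝ) (a + 1) = Ico 0 1 := by
      ext x
      simp [add_comm (a : ℝ) 1]
    rw [h2] at h1
    rw [← h1]
    refine lintegral_congr fun t => ?_
    have := hf.int_mul a t
    simpa using this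
  induction n with
  | zero => simp
  | succ n ih =>
    have hsplit : Ico (m : ℝ) (m + (n + 1 : ℕ)) =
        Ico (m : ℝ) (m + n) ∪ Ico ((m + n : ℤ) : ℝ) ((m + n : ℤ) + 1) := by
      push_cast
      rw [Ico_union_Ico_eq_Ico (by simp) (by simp), add_assoc]
    rw [hsplit, lintegral_union measurableSet_Ico, ih, hone]
    · push_cast
      ring
    · rw [Set.disjoint_left]
      intro t h1 h2
      have h3 := h2.1
      push_cast at h3
      exact absurd h1.2 (not_lt.2 h3)

theorem measurePreserving_coords :
    MeasurePreserving (fun x : Plane => (x 0, x 1)) volume (volume : Measure (ℝ × ℝ)) :=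
  (volume_preserving_finTwoArrow ℝ).comp (PiLp.volume_preserving_ofLp (Fin 2))

theorem setLIntegral_box {F : ℝ → ℝ≥0∞} (hF : Measurable F) {I J : Set ℝ} (hI : MeasurableSet I)
    (hJ : MeasurableSet J) :
    ∫⁻ x in {x : Plane | x 0 ∈ I ∧ x 1 ∈ J}, F (x 1) = volume I * ∫⁻ t in J, F t := by
  have h1 := measurePreserving_coords.setLIntegral_comp_preimage (hI.prod hJ)
    (f := fun p : ℝ × ℝ => F p.2) (hF.comp measurable_snd)
  have h2 : (fun x : Plane => (x 0, x 1)) ⁻¹' I ×ˢ J = {x : Plane | x 0 ∈ I ∧ x 1 ∈ J} := rfl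
  rw [h2] at h1
  have h3 : AEMeasurable (fun p : ℝ × ℝ => F p.2)
      ((volume.restrict I).prod (volume.restrict J)) := (hF.comp measurable_snd).aemeasurable
  rw [h1, Measure.volume_eq_prod, ← Measure.prod_restrict, lintegral_prod _ h3]
  simp [mul_comm]

/-- The half-open square `[a, b)²`. -/
def square (a b : ℝ) : Set Plane := {x | x 0 ∈ Ico a b ∧ x 1 ∈ Ico a b}

theorem measurableSet_square (a b : ℝ) : MeasurableSet (square a b) :=
  (measurableSet_Ico.preimage (by fun_prop)).inter (measurableSet_Ico.preimage (by fun_prop))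

theorem setLIntegral_square {f : ℝ → ℝ≥0∞} (hf : Function.Periodic f 1) (hm : Measurable f) (m : ℤ)
    (n : ℕ) : ∫⁻ x in square m (m + n), f (x 1) = (n : ℝ≥0∞) ^ 2 * ∫⁻ t in Ico (0 : ℝ) 1, f t := by
  rw [square, setLIntegral_box hm measurableSet_Ico measurableSet_Ico,
    setLIntegral_Ico_of_periodic hf, Real.volume_Ico]
  simp only [add_sub_cancel_left, ENNReal.ofReal_natCast]
  ring

theorem volume_square_inter {S : Set ℝ} (hS : MeasurableSet S) (hper : ∀ t, t + 1 ∈ S ↔ t ∈ S)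
    (n : ℕ) : volume {x : Plane | x ∈ square 0 n ∧ x 1 ∈ S} =
      (n : ℝ≥0∞) ^ 2 * volume (Ico (0 : ℝ) 1 ∩ S) := by
  have hp : Function.Periodic (S.indicator (1 : ℝ → ℝ≥0∞)) 1 := fun t => by
    by_cases h : t ∈ S
    · rw [indicator_of_mem h, indicator_of_mem ((hper t).2 h)]; rfl
    · rw [indicator_of_notMem h, indicator_of_notMem (fun h' => h ((hper t).1 h'))]
  have hmS : MeasurableSet {x : Plane | x 1 ∈ S} := hS.preimage (by fun_prop)
  have h1 := setLIntegral_square hp (measurable_one.indicator hS) 0 n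
  rw [lintegral_indicator_one hS, Measure.restrict_apply hS, inter_comm] at h1
  rw [← h1]
  have h2 : ∀ x : Plane, S.indicator (1 : ℝ → ℝ≥0∞) (x 1) =
      {x : Plane | x 1 ∈ S}.indicator (1 : Plane → ℝ≥0∞) x := fun x => rfl
  simp only [h2]
  rw [lintegral_indicator_one hmS, Measure.restrict_apply hmS, inter_comm]
  simp only [Int.cast_zero, zero_add]
  rfl

/-! ### Distributional estimates -/

/-- `t |{|T_Ω f| > t}|^{1/p} ≤ C ‖f‖_p` for all Schwartz functions `f` and all levels `t > 0` that
are exceeded on a set of positive measure. For `p = ∞` the exponent `1 / p.toReal` is `0`, and this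
says `|T_Ω f| ≤ C ‖f‖_∞` almost everywhere. -/
def DistribBound (Ω : Circ → ℝ) (p : ℝ≥0∞) (C : ℝ≥0) : Prop :=
  ∀ (f : 𝓢(Plane, ℂ)) (t : ℝ), 0 < t → volume {x : Plane | t < ‖roughSI Ω f x‖} ≠ 0 →
    ENNReal.ofReal t * volume {x : Plane | t < ‖roughSI Ω f x‖} ^ (1 / p.toReal) ≤
      C * eLpNorm f p volume

theorem Admissible.exists_distribBound {Ω : Circ → ℝ} {M : ℝ} (h : Admissible Ω M) {p : ℝ≥0∞}
    (hp : 1 ≤ p) (hb : BoundedOnLp Ω p) : ∃ C, DistribBound Ω p C := by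
  obtain ⟨C, hC⟩ := hb
  refine ⟨C, fun f t ht hne => le_trans ?_ (hC f)⟩
  have hm : MeasurableSet {x : Plane | t < ‖roughSI Ω f x‖} :=
    (isOpen_lt continuous_const (h.continuous_roughSI f).norm).measurableSet
  have h1 := eLpNorm_indicator_const' (c := t) hm hne (zero_lt_one.trans_le hp).ne'
  rw [Real.enorm_eq_ofReal ht.le] at h1
  rw [← h1]
  refine eLpNorm_mono fun x => ?_
  by_cases hx : x ∈ {x : Plane | t < ‖roughSI Ω f x‖}
  · rw [indicator_of_mem hx, Real.norm_of_nonneg ht.le]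
    exact le_of_lt hx
  · rw [indicator_of_notMem hx, norm_zero]
    exact norm_nonneg _

theorem WeakTypeOneOne.exists_distribBound {Ω : Circ → ℝ} (h : WeakTypeOneOne Ω) :
    ∃ C, DistribBound Ω 1 C := by
  obtain ⟨C, hC⟩ := h
  refine ⟨C, fun f t ht _ => ?_⟩
  have := hC f ⟨t, ht.le⟩ ht
  rw [ENNReal.toReal_one, div_one, ENNReal.rpow_one]
  rwa [ENNReal.ofReal_eq_coe_nnreal ht.le]

/-- If the image of `f` exceeds `t` on a periodic subset, of density `v`, of the square of side
`n + 1`, and the norm of `f` is bounded in terms of the area of that square, the area cancels from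
the distributional bound. -/
theorem DistribBound.mul_rpow_le {Ω : Circ → ℝ} {p : ℝ≥0∞} {C : ℝ≥0} (h : DistribBound Ω p C)
    {f : 𝓢(Plane, ℂ)} {n : ℕ} {t v w : ℝ} {D : ℝ≥0} (ht : 0 < t) (hv : 0 < v) (hw : 0 ≤ w)
    {S : Set ℝ} (hS : MeasurableSet S) (hper : ∀ t, t + 1 ∈ S ↔ t ∈ S)
    (hvS : ENNReal.ofReal v ≤ volume (Ico (0 : ℝ) 1 ∩ S))
    (hf : ∀ x ∈ square 0 (n + 1 : ℕ), x 1 ∈ S → t < ‖roughSI Ω f x‖)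
    (hfp : eLpNorm f p volume ≤
      D * (((n + 1 : ℕ) : ℝ≥0∞) ^ 2 * ENNReal.ofReal w) ^ (1 / p.toReal)) :
    t * v ^ (1 / p.toReal) ≤ C * D * w ^ (1 / p.toReal) := by
  set a := 1 / p.toReal with ha
  have ha0 : 0 ≤ a := by positivity
  set l : ℝ≥0∞ := ((n + 1 : ℕ) : ℝ≥0∞) ^ 2 with hl
  have hl0 : l ≠ 0 := pow_ne_zero _ (Nat.cast_ne_zero.2 n.succ_ne_zero)
  have hlt : l ≠ ∞ := ENNReal.pow_ne_top (ENNReal.natCast_ne_top _)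
  have h1 : l * ENNReal.ofReal v ≤ volume {x : Plane | t < ‖roughSI Ω f x‖} := by
    refine (mul_le_mul_right hvS l).trans ?_
    rw [hl, ← volume_square_inter hS hper]
    exact measure_mono fun x hx => hf x hx.1 hx.2
  have h2 : l * ENNReal.ofReal v ≠ 0 := mul_ne_zero hl0 (by simpa using hv)
  have h3 := h f t ht (fun h0 => h2 (le_antisymm (h1.trans h0.le) zero_le))
  have h4 : ENNReal.ofReal t * (l * ENNReal.ofReal v) ^ a ≤
      C * (D * (l * ENNReal.ofReal w) ^ a) :=
    (mul_le_mul_right (ENNReal.rpow_le_rpow h1 ha0) _).trans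
      (h3.trans (mul_le_mul_right hfp _))
  rw [ENNReal.mul_rpow_of_nonneg _ _ ha0, ENNReal.mul_rpow_of_nonneg _ _ ha0,
    ENNReal.ofReal_rpow_of_nonneg hv.le ha0, ENNReal.ofReal_rpow_of_nonneg hw ha0] at h4
  have hla0 : l ^ a ≠ 0 := (ENNReal.rpow_pos (pos_iff_ne_zero.2 hl0) hlt).ne'
  have hlat : l ^ a ≠ ∞ := ENNReal.rpow_ne_top_of_nonneg ha0 hlt
  have h5 : l ^ a * ENNReal.ofReal (t * v ^ a) ≤ l ^ a * ENNReal.ofReal (C * D * w ^ a) := by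
    rw [ENNReal.ofReal_mul ht.le, ENNReal.ofReal_mul (by positivity),
      ENNReal.ofReal_mul (by positivity), ENNReal.ofReal_coe_nnreal, ENNReal.ofReal_coe_nnreal]
    calc _ = ENNReal.ofReal t * (l ^ a * ENNReal.ofReal (v ^ a)) := by ring
      _ ≤ _ := h4
      _ = _ := by ring
  rw [ENNReal.mul_le_mul_iff_right hla0 hlat] at h5
  exact (ENNReal.ofReal_le_ofReal_iff (by positivity)).1 h5

/-! ### Wave packets -/

/-- The `k`-th frequency `(R, k + 1)` of a block. -/
def freq (R : ℝ) (k : ℕ) : Plane := !₂[R, (k : ℝ) + 1]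

theorem char_freq (R : ℝ) (k : ℕ) (x : Plane) :
    char x (freq R k) = char x (freq R 0) * unitExp (x 1) ^ k := by
  rw [unitExp_pow, char, char, unitExp, ← Complex.exp_add, inner_plane, inner_plane]
  congr 1
  simp [freq]
  ring

/-- The function `bump(x / (n + 1)) ∑_{k < N} b_k exp(2πi ⟨x, (R, k + 1)⟩)`. -/
def wavePacket (R : ℝ) (N : ℕ) (b : ℕ → ℂ) (n : ℕ) : 𝓢(Plane, ℂ) :=
  ∑ k ∈ Finset.range N, b k • modBump n (freq R k)

theorem wavePacket_apply (R : ℝ) (N : ℕ) (b : ℕ → ℂ) (n : ℕ) (x : Plane) :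
    wavePacket R N b n x =
      (bumpFn (((n : ℝ) + 1)⁻¹ • x) : ℂ) * char x (freq R 0) * trigPoly N b (x 1) := by
  simp only [wavePacket, sum_apply, smul_apply, smul_eq_mul, modBump_apply, trigPoly,
    Finset.mul_sum]
  refine Finset.sum_congr rfl fun k _ => ?_
  rw [char_freq R k]
  ring

theorem norm_wavePacket_le (R : ℝ) (N : ℕ) (b : ℕ → ℂ) (n : ℕ) (x : Plane) :
    ‖wavePacket R N b n x‖ ≤ ‖trigPoly N b (x 1)‖ := by
  rw [wavePacket_apply, norm_mul, norm_mul, norm_char, mul_one, Complex.norm_real,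
    Real.norm_of_nonneg bumpFn.nonneg]
  exact mul_le_of_le_one_left (norm_nonneg _) bumpFn.le_one

/-- The square `[-3(n+1), 3(n+1))²`, written so that the averages of periodic functions over it are
those over a period. -/
def bigSquare (n : ℕ) : Set Plane :=
  square ((-3 * (n + 1) : ℤ) : ℝ) ((-3 * (n + 1) : ℤ) + (6 * (n + 1) : ℕ))

theorem measurableSet_bigSquare (n : ℕ) : MeasurableSet (bigSquare n) := measurableSet_square _ _

theorem abs_apply_le_norm (x : Plane) (i : Fin 2) : |x i| ≤ ‖x‖ := PiLp.norm_apply_le x i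

theorem wavePacket_eq_zero (R : ℝ) (N : ℕ) (b : ℕ → ℂ) {n : ℕ} {x : Plane}
    (hx : x ∉ bigSquare n) : wavePacket R N b n x = 0 := by
  rw [wavePacket_apply]
  have hL : (0 : ℝ) < (n : ℝ) + 1 := by positivity
  have h0 : bumpFn (((n : ℝ) + 1)⁻¹ • x) = 0 := by
    refine bumpFn.zero_of_le_dist ?_
    rw [dist_zero_right, norm_smul, Real.norm_of_nonneg (by positivity)]
    change (3 : ℝ) ≤ _
    by_contra! h
    rw [inv_mul_lt_iff₀ hL] at h
    apply hx
    have h1 := fun i => abs_lt.1 ((abs_apply_le_norm x i).trans_lt h)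
    simp only [bigSquare, square, mem_ofPred_eq, mem_Ico]
    push_cast
    exact ⟨⟨by linarith [(h1 0).1], by linarith [(h1 0).2]⟩,
      ⟨by linarith [(h1 1).1], by linarith [(h1 1).2]⟩⟩
  rw [h0]
  simp

theorem bump_eq_one {n : ℕ} {x : Plane} (hx : x ∈ square 0 (n + 1 : ℕ)) :
    bumpFn (((n : ℝ) + 1)⁻¹ • x) = 1 := by
  have hL : (0 : ℝ) < (n : ℝ) + 1 := by positivity
  refine bumpFn.one_of_mem_closedBall ?_
  rw [mem_closedBall_zero_iff, norm_smul, Real.norm_of_nonneg (by positivity)]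
  change _ ≤ (2 : ℝ)
  rw [inv_mul_le_iff₀ hL]
  simp only [square, mem_ofPred_eq, mem_Ico] at hx
  push_cast at hx
  obtain ⟨⟨a1, a2⟩, ⟨b1, b2⟩⟩ := hx
  refine abs_le_of_sq_le_sq' ?_ (by positivity) |>.2
  rw [norm_sq_plane]
  nlinarith

theorem eLpNorm_wavePacket_le_of_bound (R : ℝ) (N : ℕ) {b : ℕ → ℂ} (n : ℕ) (p : ℝ≥0∞) {B : ℝ≥0}
    (hB : ∀ t, ‖trigPoly N b t‖ ≤ B) : eLpNorm (wavePacket R N b n) p volume ≤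
      B * (((n + 1 : ℕ) : ℝ≥0∞) ^ 2 * ENNReal.ofReal 36) ^ (1 / p.toReal) := by
  have h1 : (bigSquare n).indicator (wavePacket R N b n) = wavePacket R N b n :=
    indicator_eq_self.2 fun x hx => by
      by_contra h
      exact hx (wavePacket_eq_zero R N b h)
  have hvol : volume (bigSquare n) = ((n + 1 : ℕ) : ℝ≥0∞) ^ 2 * ENNReal.ofReal 36 := by
    have := setLIntegral_square (f := fun _ => 1) (fun _ => rfl) measurable_const
      (-3 * (n + 1)) (6 * (n + 1))
    simp only [setLIntegral_one, Real.volume_Ico] at this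
    rw [bigSquare, this, show ENNReal.ofReal 36 = 36 by norm_num]
    push_cast
    simp
    ring
  rw [← h1, eLpNorm_indicator_eq_eLpNorm_restrict (measurableSet_bigSquare n)]
  refine (eLpNorm_le_of_ae_bound (C := B) (ae_of_all _ fun x =>
    (norm_wavePacket_le R N b n x).trans (hB _))).trans_eq ?_
  rw [Measure.restrict_apply_univ, hvol, ENNReal.ofReal_coe_nnreal, mul_comm, one_div]

theorem eLpNorm_wavePacket_le_of_lintegral (R : ℝ) (N : ℕ) {b : ℕ → ℂ} (n : ℕ) {p : ℝ≥0∞}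
    (hp0 : p ≠ 0) (hp : p ≠ ∞) {K : ℝ}
    (hK : ∫⁻ t in Ico (0 : ℝ) 1, ENNReal.ofReal (‖trigPoly N b t‖ ^ p.toReal) ≤
      ENNReal.ofReal K) : eLpNorm (wavePacket R N b n) p volume ≤
      (1 : ℝ≥0) * (((n + 1 : ℕ) : ℝ≥0∞) ^ 2 * ENNReal.ofReal (36 * K)) ^ (1 / p.toReal) := by
  have hpos : 0 < p.toReal := ENNReal.toReal_pos hp0 hp
  rw [eLpNorm_eq_lintegral_rpow_enorm_toReal hp0 hp, ENNReal.coe_one, one_mul]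
  refine ENNReal.rpow_le_rpow ?_ (by positivity)
  have hm : Measurable fun t => ENNReal.ofReal (‖trigPoly N b t‖ ^ p.toReal) :=
    ((continuous_trigPoly N b).norm.measurable.pow_const _).ennreal_ofReal
  have hper : Function.Periodic (fun t => ENNReal.ofReal (‖trigPoly N b t‖ ^ p.toReal)) 1 :=
    fun t => by simp only [trigPoly_periodic N b t]
  calc ∫⁻ x, ‖wavePacket R N b n x‖ₑ ^ p.toReal
      ≤ ∫⁻ x, (bigSquare n).indicator
          (fun x => ENNReal.ofReal (‖trigPoly N b (x 1)‖ ^ p.toReal)) x := by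
        refine lintegral_mono fun x => ?_
        by_cases hx : x ∈ bigSquare n
        · rw [indicator_of_mem hx, ← ENNReal.ofReal_rpow_of_nonneg (norm_nonneg _) hpos.le,
            ← ofReal_norm]
          exact ENNReal.rpow_le_rpow (ENNReal.ofReal_le_ofReal (norm_wavePacket_le R N b n x))
            hpos.le
        · rw [wavePacket_eq_zero R N b hx]
          simp [hpos]
    _ = ((6 * (n + 1) : ℕ) : ℝ≥0∞) ^ 2 *
          ∫⁻ t in Ico (0 : ℝ) 1, ENNReal.ofReal (‖trigPoly N b t‖ ^ p.toReal) := by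
        rw [lintegral_indicator (measurableSet_bigSquare n)]
        exact setLIntegral_square hper hm _ _
    _ ≤ ((6 * (n + 1) : ℕ) : ℝ≥0∞) ^ 2 * ENNReal.ofReal K := by gcongr
    _ = ((n + 1 : ℕ) : ℝ≥0∞) ^ 2 * ENNReal.ofReal (36 * K) := by
        rw [ENNReal.ofReal_mul (by norm_num), show ENNReal.ofReal 36 = 36 by norm_num]
        push_cast
        ring

/-- The symbol of `Ω` imitates, on a progression of frequencies `(R, 1), …, (R, N)` with
`N = 2 ^ l ^ 2`, a flat choice of signs: `symb Ω (R, k + 1) = A + 2 ^ (-l) ε_k + O(1 / N)`. -/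
def HasLevel (Ω : Circ → ℝ) (M : ℝ) (l : ℕ) : Prop :=
  ∃ (R A : ℝ) (ε : ℕ → ℝ), |A| ≤ M ∧ FlatSigns (2 ^ l ^ 2) ε ∧ ∀ k < 2 ^ l ^ 2,
    ContinuousAt (symb Ω) (freq R k) ∧
      |symb Ω (freq R k) - (A + (1 / 2) ^ l * ε k)| ≤ 1 / 2 ^ l ^ 2

/-- On the square where the bump is `1`, the image of a wave packet is, up to an error `2`, another
wave packet. -/
theorem Admissible.eventually_le_norm_roughSI {Ω : Circ → ℝ} {M : ℝ} (h : Admissible Ω M)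
    {N : ℕ} {R A c : ℝ} {ε : ℕ → ℝ}
    (hc : ∀ k < N, ContinuousAt (symb Ω) (freq R k))
    (hs : ∀ k < N, |symb Ω (freq R k) - (A + c * ε k)| ≤ 1 / N) {b : ℕ → ℂ}
    (hb : ∀ k, ‖b k‖ ≤ 1) : ∃ n : ℕ, ∀ x ∈ square 0 (n + 1 : ℕ),
      ‖A * trigPoly N b (x 1) + c * trigPoly N (fun k => ε k * b k) (x 1)‖ - 2 ≤
        ‖roughSI Ω (wavePacket R N b n) x‖ := by
  obtain ⟨n, hn⟩ := (h.eventually_norm_roughSI_sub_le (Finset.range N) b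
    (fun k hk => hc k (Finset.mem_range.1 hk)) one_pos).exists
  refine ⟨n, fun x hx => ?_⟩
  have h1 := hn x
  simp only [modBump_apply, bump_eq_one hx, Complex.ofReal_one, one_mul] at h1
  set Y := ∑ k ∈ Finset.range N, b k * (symb Ω (freq R k) * char x (freq R k)) with hY
  set Z := A * trigPoly N b (x 1) + c * trigPoly N (fun k => ε k * b k) (x 1) with hZ
  have h2 : ‖Y - char x (freq R 0) * Z‖ ≤ 1 := by
    have e1 : Y - char x (freq R 0) * Z = ∑ k ∈ Finset.range N,
        b k * ((symb Ω (freq R k) - (A + c * ε k) : ℝ) : ℂ) * char x (freq R k) := by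
      rw [hY, hZ, trigPoly, trigPoly, Finset.mul_sum, Finset.mul_sum, ← Finset.sum_add_distrib,
        Finset.mul_sum, ← Finset.sum_sub_distrib]
      refine Finset.sum_congr rfl fun k _ => ?_
      rw [char_freq R k]
      push_cast
      ring
    rw [e1]
    calc _ ≤ ∑ k ∈ Finset.range N, (1 / N : ℝ) := by
          refine (norm_sum_le _ _).trans (Finset.sum_le_sum fun k hk => ?_)
          rw [norm_mul, norm_mul, norm_char, mul_one, Complex.norm_real]
          calc _ ≤ 1 * (1 / N : ℝ) :=
                mul_le_mul (hb k) (hs k (Finset.mem_range.1 hk)) (abs_nonneg _) zero_le_one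
            _ = _ := one_mul _
      _ ≤ 1 := by
          rw [Finset.sum_const, Finset.card_range, nsmul_eq_mul, mul_one_div]
          exact div_self_le_one _
  have h3 : ‖Z‖ = ‖char x (freq R 0) * Z‖ := by rw [norm_mul, norm_char, one_mul]
  have h4 := norm_sub_norm_le (char x (freq R 0) * Z) Y
  have h5 := norm_sub_norm_le Y (roughSI Ω (wavePacket R N b n) x)
  rw [norm_sub_rev] at h4 h5
  rw [← wavePacket] at h1
  rw [h3]
  linarith

/-! ### Failure of the bounds for `p ≠ 2` -/

theorem trigPoly_fract (N : ℕ) (b : ℕ → ℂ) (t : ℝ) :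
    trigPoly N b (Int.fract t) = trigPoly N b t := by
  have := (trigPoly_periodic N b).sub_int_mul_eq (x := t) ⌊t⌋
  rwa [mul_one] at this

/-- For `p < 2` the Dirichlet kernel is much smaller in `L^p` than a flat polynomial, while the
operator maps the first one to a function that contains the second one with coefficient `2 ^ (-l)`.
-/
theorem DistribBound.exists_level_le_of_lt_two {Ω : Circ → ℝ} {M : ℝ} (h : Admissible Ω M)
    {p : ℝ≥0∞} {C : ℝ≥0} (hd : DistribBound Ω p C) (hp1 : 1 ≤ p) (hp : p < 2) :
    ∃ K s : ℝ, s < 1 / 2 ∧ ∀ l, HasLevel Ω M l →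
      (1 / 2) ^ l * √((2 ^ l ^ 2 : ℕ) : ℝ) ≤ K * ((2 ^ l ^ 2 : ℕ) : ℝ) ^ s := by
  have hpt : p ≠ ∞ := (hp.trans ENNReal.ofNat_lt_top).ne
  have hP1 : 1 ≤ p.toReal := by
    rw [← ENNReal.toReal_one]; exact ENNReal.toReal_mono hpt hp1
  have hP2 : p.toReal < 2 := by
    rw [← ENNReal.toReal_ofNat 2]; exact ENNReal.toReal_strict_mono (by simp) hp
  set P := p.toReal with hP
  set a := 1 / P with ha
  have ha0 : 0 < a := by positivity
  have ha1 : a ≤ 1 := by rw [ha, div_le_one (by linarith)]; exact hP1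
  have ha2 : 1 / 2 < a := by rw [ha]; gcongr
  have haP : P * a = 1 := by rw [ha]; field_simp
  -- The moment `P` is split as `r + q` with `q < 1`, such that `r / P = 3 / 4 - 1 / (2P) < 1 / 2`.
  obtain ⟨K, hK0, hK⟩ := exists_lintegral_dirichlet_le (q := P / 4 + 1 / 2)
    (r := P * (3 / 4) - 1 / 2) (by linarith) (by linarith) (by linarith)
  have hM : 0 ≤ M := (abs_nonneg _).trans (h.abs_symb_le 0)
  refine ⟨4 * C * (36 * K) ^ a + 4 * M + 3, 3 / 4 - a / 2, by linarith, fun l hl => ?_⟩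
  obtain ⟨R, A, ε, hA, hε, hs⟩ := hl
  set N : ℕ := 2 ^ l ^ 2 with hN
  have hN1 : (1 : ℝ) ≤ N := by exact_mod_cast Nat.one_le_two_pow
  set s := 3 / 4 - a / 2 with hs_def
  have hNs : 1 ≤ (N : ℝ) ^ s := Real.one_le_rpow hN1 (by linarith)
  set c : ℝ := (1 / 2) ^ l with hc
  have hc0 : 0 ≤ c := by positivity
  suffices hmain : c * √N - 4 * M - 3 ≤ 4 * C * (36 * K) ^ a * (N : ℝ) ^ s by
    nlinarith [mul_nonneg hM (sub_nonneg.2 hNs)]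
  have hrhs : 0 ≤ 4 * C * (36 * K) ^ a * (N : ℝ) ^ s := by positivity
  rcases le_or_gt (c * √N - 4 * M - 3) 0 with ht | ht
  · exact ht.trans hrhs
  obtain ⟨n, hn⟩ := h.eventually_le_norm_roughSI (c := c) (ε := ε) (A := A)
    (fun k hk => (hs k hk).1)
    (fun k hk => by have := (hs k hk).2; rw [hN]; push_cast; exact this)
    (b := fun _ => 1) (fun k => by simp)
  set S : Set ℝ := {t | Int.fract t ∈ Icc (1 / 8 : ℝ) (7 / 8) ∧
    (N : ℝ) ≤ ‖trigPoly N (fun k => ε k) t‖ ^ 2} with hS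
  have hSm : MeasurableSet S :=
    (measurableSet_Icc.preimage measurable_fract).inter
      (measurableSet_le measurable_const ((continuous_trigPoly N _).norm.pow 2).measurable)
  have hper : ∀ t, t + 1 ∈ S ↔ t ∈ S := fun t => by
    simp only [hS, mem_ofPred_eq, Int.fract_add_one, trigPoly_periodic N _ t]
  have hvS : ENNReal.ofReal (1 / 4) ≤ volume (Ico (0 : ℝ) 1 ∩ S) := by
    refine hε.volume_ge.trans (measure_mono fun t ht => ?_)
    have h1 : t ∈ Ico (0 : ℝ) 1 := ⟨by linarith [ht.1.1], by linarith [ht.1.2]⟩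
    refine ⟨h1, ?_, ht.2⟩
    rw [Int.fract_eq_self.2 h1]
    exact ht.1
  have hf : ∀ x ∈ square 0 (n + 1 : ℕ), x 1 ∈ S →
      c * √N - 4 * M - 3 < ‖roughSI Ω (wavePacket R N (fun _ => 1) n) x‖ := by
    intro x hx hxS
    have h1 := hn x hx
    simp only [mul_one] at h1
    have h2 : ‖trigPoly N (fun _ => 1) (x 1)‖ ≤ 4 := by
      rw [← trigPoly_fract]
      have h3 := norm_dirichlet_le_inv N (t := Int.fract (x 1)) (by linarith [hxS.1.1])
        (by linarith [hxS.1.2])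
      refine h3.trans ?_
      have h4 : 1 / 8 ≤ min (Int.fract (x 1)) (1 - Int.fract (x 1)) :=
        le_min hxS.1.1 (by linarith [hxS.1.2])
      calc _ ≤ (2 * (1 / 8 : ℝ))⁻¹ := by gcongr
        _ = 4 := by norm_num
    have h3 : √N ≤ ‖trigPoly N (fun k => ε k) (x 1)‖ := Real.sqrt_le_iff.2 ⟨norm_nonneg _, hxS.2⟩
    have h4 : ‖(A : ℂ) * trigPoly N (fun _ => 1) (x 1)‖ ≤ M * 4 := by
      rw [norm_mul, Complex.norm_real]
      exact mul_le_mul hA h2 (norm_nonneg _) hM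
    have h5 : c * √N ≤ ‖(c : ℂ) * trigPoly N (fun k => ε k) (x 1)‖ := by
      rw [norm_mul, Complex.norm_real, Real.norm_of_nonneg hc0]
      gcongr
    have h6 := norm_sub_le_norm_add ((c : ℂ) * trigPoly N (fun k => ε k) (x 1))
      ((A : ℂ) * trigPoly N (fun _ => 1) (x 1))
    rw [add_comm] at h6
    linarith
  have hfp := eLpNorm_wavePacket_le_of_lintegral R N (b := fun _ => 1) n
    (zero_lt_one.trans_le hp1).ne' hpt (K := K * (N : ℝ) ^ (P * (3 / 4) - 1 / 2)) (by
      have := hK N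
      rwa [show P * (3 / 4) - 1 / 2 + (P / 4 + 1 / 2) = P by ring] at this)
  have hres := hd.mul_rpow_le ht (by norm_num) (by positivity) hSm hper hvS hf hfp
  rw [← hP, ← ha, NNReal.coe_one, mul_one, ← mul_assoc, Real.mul_rpow (by positivity)
    (by positivity), ← Real.rpow_mul (by positivity),
    show (P * (3 / 4) - 1 / 2) * a = s by rw [hs_def]; linear_combination (3 / 4) * haP] at hres
  have h4 : (1 / 4 : ℝ) ≤ (1 / 4) ^ a := by
    simpa using Real.rpow_le_rpow_of_exponent_ge (by norm_num : (0 : ℝ) < 1 / 4) (by norm_num) ha1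
  have h5 := mul_le_mul_of_nonneg_left h4 ht.le
  linarith

/-- For `p > 2` a flat polynomial is much smaller in `L^p` than the Dirichlet kernel, while the
operator maps the first one to a function that contains the second one with coefficient `2 ^ (-l)`.
-/
theorem DistribBound.exists_level_le_of_two_lt {Ω : Circ → ℝ} {M : ℝ} (h : Admissible Ω M)
    {p : ℝ≥0∞} {C : ℝ≥0} (hd : DistribBound Ω p C) (hp : 2 < p) :
    ∃ K s : ℝ, s < 1 / 2 ∧ ∀ l, HasLevel Ω M l →
      (1 / 2) ^ l * √((2 ^ l ^ 2 : ℕ) : ℝ) ≤ K * ((2 ^ l ^ 2 : ℕ) : ℝ) ^ s := by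
  set a := 1 / p.toReal with ha
  have ha0 : 0 ≤ a := by positivity
  have ha2 : a < 1 / 2 := by
    rcases eq_or_ne p ∞ with h0 | h0
    · rw [ha, h0]; norm_num
    · have : 2 < p.toReal := by
        rw [← ENNReal.toReal_ofNat 2]; exact ENNReal.toReal_strict_mono h0 hp
      rw [ha]
      gcongr
  have hM : 0 ≤ M := (abs_nonneg _).trans (h.abs_symb_le 0)
  refine ⟨4 * C * 288 ^ a + 4 * M + 6, a, ha2, fun l hl => ?_⟩
  obtain ⟨R, A, ε, hA, hε, hs⟩ := hl
  set N : ℕ := 2 ^ l ^ 2 with hN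
  have hN1 : (1 : ℝ) ≤ N := by exact_mod_cast Nat.one_le_two_pow
  have hz : 1 ≤ (N : ℝ) ^ a := Real.one_le_rpow hN1 ha0
  set c : ℝ := (1 / 2) ^ l with hc
  have hc0 : 0 ≤ c := by positivity
  set y := √(N : ℝ) with hy
  have hy1 : 1 ≤ y := Real.one_le_sqrt.2 hN1
  have hyy : y * y = N := Real.mul_self_sqrt (by positivity)
  suffices hmain : c * N / 2 - 2 * M * y - 3 ≤ y * (2 * C * 288 ^ a * (N : ℝ) ^ a) by
    have h1 : y * (c * y / 2 - 2 * M - 3) ≤ y * (2 * C * 288 ^ a * (N : ℝ) ^ a) := by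
      refine le_trans ?_ hmain
      rw [← hyy]
      nlinarith
    have h2 := le_of_mul_le_mul_left h1 (by linarith)
    nlinarith [mul_nonneg hM (sub_nonneg.2 hz)]
  have hrhs : 0 ≤ y * (2 * C * 288 ^ a * (N : ℝ) ^ a) := by positivity
  rcases le_or_gt (c * N / 2 - 2 * M * y - 3) 0 with ht | ht
  · exact ht.trans hrhs
  have hεε : (fun k => (ε k : ℂ) * ε k) = fun _ => 1 := funext fun k => by
    rw [← Complex.ofReal_mul, ← abs_mul_abs_self, hε.abs_eq]
    simp
  obtain ⟨n, hn⟩ := h.eventually_le_norm_roughSI (c := c) (ε := ε) (A := A)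
    (fun k hk => (hs k hk).1)
    (fun k hk => by have := (hs k hk).2; rw [hN]; push_cast; exact this)
    (b := fun k => ε k) (fun k => by
      rw [Complex.norm_real, Real.norm_eq_abs, hε.abs_eq])
  have hflat : ∀ t, ‖trigPoly N (fun k => ε k) t‖ ≤ 2 * y := fun t => by
    refine abs_le_of_sq_le_sq' ?_ (by positivity) |>.2
    have := hε.norm_sq_le t
    nlinarith
  set S : Set ℝ := {t | Int.fract t ≤ 1 / (8 * N)} with hS
  have hSm : MeasurableSet S := measurableSet_le measurable_fract measurable_const
  have hper : ∀ t, t + 1 ∈ S ↔ t ∈ S := fun t => by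
    simp only [hS, mem_ofPred_eq, Int.fract_add_one]
  have hvS : ENNReal.ofReal (1 / (8 * N)) ≤ volume (Ico (0 : ℝ) 1 ∩ S) := by
    have h1 : volume (Ico (0 : ℝ) (1 / (8 * N))) = ENNReal.ofReal (1 / (8 * N)) := by
      rw [Real.volume_Ico, sub_zero]
    rw [← h1]
    refine measure_mono fun t ht => ?_
    have h2 : t < 1 := ht.2.trans_le (by rw [div_le_one (by positivity)]; linarith)
    refine ⟨⟨ht.1, h2⟩, ?_⟩
    rw [hS, mem_ofPred_eq, Int.fract_eq_self.2 ⟨ht.1, h2⟩]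
    exact ht.2.le
  have hf : ∀ x ∈ square 0 (n + 1 : ℕ), x 1 ∈ S →
      c * N / 2 - 2 * M * y - 3 < ‖roughSI Ω (wavePacket R N (fun k => ε k) n) x‖ := by
    intro x hx hxS
    have h1 := hn x hx
    rw [hεε] at h1
    have h2 : (N : ℝ) / 2 ≤ ‖trigPoly N (fun _ => 1) (x 1)‖ := by
      rw [← trigPoly_fract]
      refine half_le_norm_dirichlet N (Int.fract_nonneg _) ?_
      have h3 : Int.fract (x 1) ≤ 1 / (8 * N) := hxS
      rw [le_div_iff₀ (by positivity)] at h3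
      linarith
    have h4 : ‖(A : ℂ) * trigPoly N (fun k => ε k) (x 1)‖ ≤ M * (2 * y) := by
      rw [norm_mul, Complex.norm_real]
      exact mul_le_mul hA (hflat _) (norm_nonneg _) hM
    have h5 : c * (N / 2) ≤ ‖(c : ℂ) * trigPoly N (fun _ => 1) (x 1)‖ := by
      rw [norm_mul, Complex.norm_real, Real.norm_of_nonneg hc0]
      gcongr
    have h6 := norm_sub_le_norm_add ((c : ℂ) * trigPoly N (fun _ => 1) (x 1))
      ((A : ℂ) * trigPoly N (fun k => ε k) (x 1))
    rw [add_comm] at h6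
    linarith
  have hfp := eLpNorm_wavePacket_le_of_bound R N (b := fun k => ε k) n p
    (B := (2 * y).toNNReal) (fun t => by
      rw [Real.coe_toNNReal _ (by positivity)]
      exact hflat t)
  have hres := hd.mul_rpow_le ht (by positivity) (by norm_num) hSm hper hvS hf hfp
  rw [← ha, Real.div_rpow zero_le_one (by positivity), Real.one_rpow, mul_one_div,
    div_le_iff₀ (by positivity)] at hres
  refine hres.trans_eq ?_
  rw [show (288 : ℝ) = 36 * 8 by norm_num, Real.mul_rpow (by norm_num) (by positivity),
    Real.mul_rpow (by norm_num) (by norm_num)]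
  rw [Real.coe_toNNReal _ (by positivity)]
  ring

theorem Admissible.not_distribBound {Ω : Circ → ℝ} {M : ℝ} (h : Admissible Ω M)
    (hl : ∃ᶠ l in atTop, HasLevel Ω M l) {p : ℝ≥0∞} (hp1 : 1 ≤ p) (hp2 : p ≠ 2) (C : ℝ≥0) :
    ¬ DistribBound Ω p C := by
  intro hd
  obtain ⟨K, s, hs, hK⟩ : ∃ K s : ℝ, s < 1 / 2 ∧ ∀ l, HasLevel Ω M l →
      (1 / 2) ^ l * √((2 ^ l ^ 2 : ℕ) : ℝ) ≤ K * ((2 ^ l ^ 2 : ℕ) : ℝ) ^ s := by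
    rcases lt_or_gt_of_ne hp2 with hlt | hgt
    · exact hd.exists_level_le_of_lt_two h hp1 hlt
    · exact hd.exists_level_le_of_two_lt h hgt
  -- The inequality forces `2 ^ (l (δ l - 1)) ≤ K` with `δ = 1 / 2 - s > 0`.
  set δ := 1 / 2 - s with hδ
  have hδ0 : 0 < δ := by linarith
  have hcast : Tendsto (fun l : ℕ => (l : ℝ)) atTop atTop := tendsto_natCast_atTop_atTop
  have hlim : Tendsto (fun l : ℕ => (l : ℝ) * (δ * l - 1)) atTop atTop :=
    hcast.atTop_mul_atTop₀ (tendsto_atTop_add_const_right _ (-1) (hcast.const_mul_atTop hδ0))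
  have hlim2 := (Real.tendsto_exp_atTop.comp (hlim.const_mul_atTop (Real.log_pos one_lt_two)))
  obtain ⟨l, hlev, hbig⟩ := (hl.and_eventually (hlim2.eventually_gt_atTop K)).exists
  have h1 := hK l hlev
  have h2 : Real.exp (Real.log 2 * ((l : ℝ) * (δ * l - 1))) = 2 ^ ((l : ℝ) * (δ * l - 1)) := by
    rw [Real.rpow_def_of_pos two_pos]
  simp only [Function.comp_apply, h2] at hbig
  have h3 : ((2 ^ l ^ 2 : ℕ) : ℝ) = 2 ^ ((l : ℝ) ^ 2) := by
    push_cast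
    rw [← Real.rpow_natCast]
    push_cast
    rfl
  rw [h3, Real.sqrt_eq_rpow, ← Real.rpow_mul zero_le_two, ← Real.rpow_mul zero_le_two,
    one_div, inv_pow, ← Real.rpow_natCast, ← Real.rpow_neg zero_le_two,
    ← Real.rpow_add two_pos] at h1
  have h4 : -(l : ℝ) + (l : ℝ) ^ 2 * (1 / 2) = (l : ℝ) * (δ * l - 1) + (l : ℝ) ^ 2 * s := by
    rw [hδ]; ring
  rw [← one_div, h4, Real.rpow_add two_pos] at h1
  exact absurd (le_of_mul_le_mul_right h1 (by positivity)) (not_le.2 hbig)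

/-! ### Convex series of functions -/

section ConvexSeries

variable {α : Type*} [MeasurableSpace α] {μ : Measure α} {F : ℕ → α → ℝ} {c : ℕ → ℝ} {B : ℝ}

theorem lintegral_tsum_enorm_le (hF : ∀ i, Integrable (F i) μ) (hB : ∀ i, ∫ a, |F i a| ∂μ ≤ B)
    (hc : ∀ i, 0 ≤ c i) (hs : Summable c) (hs1 : ∑' i, c i ≤ 1) :
    ∫⁻ a, ∑' i, ‖c i * F i a‖ₑ ∂μ ≤ ENNReal.ofReal B := by
  have hB0 : 0 ≤ B := (integral_nonneg fun a => abs_nonneg _).trans (hB 0)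
  rw [lintegral_tsum fun i => ((hF i).const_mul (c i)).aestronglyMeasurable.enorm]
  have h1 : ∀ i, ∫⁻ a, ‖c i * F i a‖ₑ ∂μ ≤ ENNReal.ofReal (c i * B) := fun i => by
    have := ofReal_integral_norm_eq_lintegral_enorm ((hF i).const_mul (c i))
    rw [← this]
    refine ENNReal.ofReal_le_ofReal ?_
    simp only [norm_mul, Real.norm_eq_abs, abs_of_nonneg (hc i), integral_const_mul]
    exact mul_le_mul_of_nonneg_left (hB i) (hc i)
  refine (ENNReal.tsum_le_tsum h1).trans ?_
  rw [← ENNReal.ofReal_tsum_of_nonneg (fun i => mul_nonneg (hc i) hB0) (hs.mul_right B),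
    tsum_mul_right]
  exact ENNReal.ofReal_le_ofReal (mul_le_of_le_one_left hB0 hs1)

theorem ae_summable_abs (hF : ∀ i, Integrable (F i) μ) (hB : ∀ i, ∫ a, |F i a| ∂μ ≤ B)
    (hc : ∀ i, 0 ≤ c i) (hs : Summable c) (hs1 : ∑' i, c i ≤ 1) :
    ∀ᵐ a ∂μ, Summable fun i => |c i * F i a| := by
  have h1 := ae_lt_top' (AEMeasurable.tsum fun i =>
    ((hF i).const_mul (c i)).aestronglyMeasurable.enorm)
    ((lintegral_tsum_enorm_le hF hB hc hs hs1).trans_lt ENNReal.ofReal_lt_top).ne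
  filter_upwards [h1] with a ha
  refine (ENNReal.summable_toReal ha.ne).congr fun i => ?_
  rw [toReal_enorm, Real.norm_eq_abs]

theorem integrable_tsum_mul (hF : ∀ i, Integrable (F i) μ) (hB : ∀ i, ∫ a, |F i a| ∂μ ≤ B)
    (hc : ∀ i, 0 ≤ c i) (hs : Summable c) (hs1 : ∑' i, c i ≤ 1) :
    Integrable (fun a => ∑' i, c i * F i a) μ := by
  refine ⟨aestronglyMeasurable_of_tendsto_ae atTop
    (f := fun (n : ℕ) a => ∑ i ∈ Finset.range n, c i * F i a) (fun n => ?_) ?_, ?_⟩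
  · exact Finset.aestronglyMeasurable_fun_sum _ fun i _ =>
      ((hF i).const_mul (c i)).aestronglyMeasurable
  · filter_upwards [ae_summable_abs hF hB hc hs hs1] with a ha
    exact ha.of_abs.hasSum.tendsto_sum_nat
  · refine lt_of_le_of_lt (lintegral_mono fun a => enorm_tsum_le_tsum_enorm)
      ((lintegral_tsum_enorm_le hF hB hc hs hs1).trans_lt ENNReal.ofReal_lt_top)

theorem integral_abs_tsum_mul_le (hF : ∀ i, Integrable (F i) μ) (hB : ∀ i, ∫ a, |F i a| ∂μ ≤ B)
    (hc : ∀ i, 0 ≤ c i) (hs : Summable c) (hs1 : ∑' i, c i ≤ 1) :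
    ∫ a, |∑' i, c i * F i a| ∂μ ≤ B := by
  have hB0 : 0 ≤ B := (integral_nonneg fun a => abs_nonneg _).trans (hB 0)
  have h1 := ofReal_integral_norm_eq_lintegral_enorm (integrable_tsum_mul hF hB hc hs hs1)
  have h2 := (lintegral_mono (μ := μ) fun a => enorm_tsum_le_tsum_enorm
    (f := fun i => c i * F i a)).trans (lintegral_tsum_enorm_le hF hB hc hs hs1)
  rw [← h1] at h2
  exact (ENNReal.ofReal_le_ofReal_iff hB0).1 h2

theorem hasSum_mul_integral (hF : ∀ i, Integrable (F i) μ) (hB : ∀ i, ∫ a, |F i a| ∂μ ≤ B)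
    (hc : ∀ i, 0 ≤ c i) (hs : Summable c) :
    HasSum (fun i => c i * ∫ a, F i a ∂μ) (∫ a, ∑' i, c i * F i a ∂μ) := by
  have h1 := hasSum_integral_of_summable_integral_norm (μ := μ) (F := fun i a => c i * F i a)
    (fun i => (hF i).const_mul (c i)) ?_
  · simpa only [integral_const_mul] using h1
  · refine Summable.of_nonneg_of_le (fun i => integral_nonneg fun a => norm_nonneg _)
      (fun i => ?_) (hs.mul_right B)
    simp only [norm_mul, Real.norm_eq_abs, abs_of_nonneg (hc i), integral_const_mul]
    exact mul_le_mul_of_nonneg_left (hB i) (hc i)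

end ConvexSeries

theorem Admissible.integrable_mul_logKer {Ω : Circ → ℝ} {M : ℝ} (h : Admissible Ω M) (ξ : Plane) :
    Integrable (fun θ => Ω θ * logKer ξ θ) arcLength := by
  refine (h.integrable_mul ξ).mono (h.integrable.aestronglyMeasurable.mul
    (measurable_logKer_right ξ).aestronglyMeasurable) (ae_of_all _ fun θ => ?_)
  rw [norm_mul, norm_mul, Real.norm_eq_abs, Real.norm_eq_abs |Ω θ|, abs_abs]

theorem Admissible.integral_abs_mul_logKer_le {Ω : Circ → ℝ} {M : ℝ} (h : Admissible Ω M)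
    (ξ : Plane) :
    ∫ θ, |Ω θ * logKer ξ θ| ∂arcLength ≤ M := by
  refine le_trans (le_of_eq ?_) (h.integral_le ξ)
  simp only [abs_mul, abs_of_nonneg (logKer_nonneg ξ _)]

section AdmissibleSeries

variable {Om : ℕ → Circ → ℝ} {c : ℕ → ℝ} {M : ℝ} (hadm : ∀ i, Admissible (Om i) M)
  (hc : ∀ i, 0 ≤ c i) (hs : Summable c) (hs1 : ∑' i, c i ≤ 1)

include hadm hc hs

theorem hasSum_symb (ξ : Plane) :
    HasSum (fun i => c i * symb (Om i) ξ) (symb (fun θ => ∑' i, c i * Om i θ) ξ) := by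
  have := hasSum_mul_integral (fun i => (hadm i).integrable_mul_logKer ξ)
    (fun i => (hadm i).integral_abs_mul_logKer_le ξ) hc hs
  simpa only [symb, ← mul_assoc, tsum_mul_right] using this

theorem continuousAt_symb_tsum (hcont : ∀ i, ∀ ξ ≠ 0, ContinuousAt (symb (Om i)) ξ) {ξ : Plane}
    (hξ : ξ ≠ 0) : ContinuousAt (symb fun θ => ∑' i, c i * Om i θ) ξ := by
  have h1 : (symb fun θ => ∑' i, c i * Om i θ) = fun ξ => ∑' i, c i * symb (Om i) ξ :=
    funext fun ξ => (hasSum_symb hadm hc hs ξ).tsum_eq.symm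
  rw [h1]
  refine (continuousOn_tsum (s := {0}ᶜ) (u := fun i => c i * M) (fun i ζ hζ =>
    ((hcont i ζ hζ).continuousWithinAt.const_mul (c i))) (hs.mul_right M)
    fun i ζ _ => ?_).continuousAt (isOpen_compl_singleton.mem_nhds hξ)
  rw [norm_mul, Real.norm_of_nonneg (hc i)]
  exact mul_le_mul_of_nonneg_left ((hadm i).abs_symb_le ζ) (hc i)

include hs1

theorem admissible_tsum {B : ℝ} (hB : ∀ i, ∫ θ, |Om i θ| ∂arcLength ≤ B) :
    Admissible (fun θ => ∑' i, c i * Om i θ) M where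
  even θ := by simp only [(hadm _).even]
  integrable := integrable_tsum_mul (fun i => (hadm i).integrable) hB hc hs hs1
  integral_eq_zero := by
    rw [← (hasSum_mul_integral (fun i => (hadm i).integrable) hB hc hs).tsum_eq]
    simp [(hadm _).integral_eq_zero]
  integrable_mul ξ := by
    have := (integrable_tsum_mul (fun i => (hadm i).integrable_mul_logKer ξ)
      (fun i => (hadm i).integral_abs_mul_logKer_le ξ) hc hs hs1).abs
    simpa only [← mul_assoc, tsum_mul_right, abs_mul, abs_of_nonneg (logKer_nonneg ξ _)] using this
  integral_le ξ := by
    have := integral_abs_tsum_mul_le (fun i => (hadm i).integrable_mul_logKer ξ)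
      (fun i => (hadm i).integral_abs_mul_logKer_le ξ) hc hs hs1
    simpa only [← mul_assoc, tsum_mul_right, abs_mul, abs_of_nonneg (logKer_nonneg ξ _)] using this

/-- By Jensen's inequality a convex series of functions with bounded `∫ Φ(|Ω_i|)` is in `Φ(L)`. -/
theorem memPhiL_tsum {Φ : ℝ → ℝ} (hΦ : IsYoungFunction Φ) {B : ℝ}
    (hB : ∀ i, ∫ θ, |Om i θ| ∂arcLength ≤ B) {D : ℝ}
    (hD : ∀ i, ∫⁻ θ, ENNReal.ofReal (Φ |Om i θ|) ∂arcLength ≤ ENNReal.ofReal D) :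
    MemPhiL Φ fun θ => ∑' i, c i * Om i θ := by
  refine ⟨(integrable_tsum_mul (fun i => (hadm i).integrable) hB hc hs hs1).aestronglyMeasurable,
    ?_⟩
  have hm : ∀ i, AEMeasurable (fun θ => ENNReal.ofReal (c i * Φ |Om i θ|)) arcLength := fun i =>
    ((hΦ.measurable_comp_abs.comp_aemeasurable
      (hadm i).integrable.aestronglyMeasurable.aemeasurable).const_mul (c i)).ennreal_ofReal
  have hpt : ∀ᵐ θ ∂arcLength, ENNReal.ofReal (Φ |∑' i, c i * Om i θ|) ≤
      ∑' i, ENNReal.ofReal (c i * Φ |Om i θ|) := by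
    filter_upwards [ae_summable_abs (fun i => (hadm i).integrable) hB hc hs hs1] with θ hθ
    have h1 : |∑' i, c i * Om i θ| ≤ ∑' i, |c i * Om i θ| := by
      simpa only [Real.norm_eq_abs] using norm_tsum_le_tsum_norm (f := fun i => c i * Om i θ) hθ
    have h2 : HasSum (fun i => c i * |Om i θ|) (∑' i, |c i * Om i θ|) := by
      have := hθ.hasSum
      simpa only [abs_mul, abs_of_nonneg (hc _)] using this
    exact (ENNReal.ofReal_le_ofReal (hΦ.mono (abs_nonneg _) h1)).trans
      (hΦ.ofReal_le_tsum hc (fun i => abs_nonneg _) hs.hasSum hs1 h2)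
  calc ∫⁻ θ, ENNReal.ofReal (Φ |∑' i, c i * Om i θ|) ∂arcLength
      ≤ ∫⁻ θ, ∑' i, ENNReal.ofReal (c i * Φ |Om i θ|) ∂arcLength := lintegral_mono_ae hpt
    _ = ∑' i, ∫⁻ θ, ENNReal.ofReal (c i * Φ |Om i θ|) ∂arcLength := lintegral_tsum hm
    _ ≤ ∑' i, ENNReal.ofReal (c i) * ENNReal.ofReal D := by
        refine ENNReal.tsum_le_tsum fun i => ?_
        simp only [ENNReal.ofReal_mul (hc i)]
        rw [lintegral_const_mul' _ _ ENNReal.ofReal_ne_top]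
        gcongr
        exact hD i
    _ < ∞ := by
        rw [ENNReal.tsum_mul_right, ← ENNReal.ofReal_tsum_of_nonneg hc hs]
        exact ENNReal.mul_lt_top ENNReal.ofReal_lt_top ENNReal.ofReal_lt_top

end AdmissibleSeries

/-! ### Gliding hump -/

/-- A level `l`, the frequencies `(R, 1), …, (R, 2 ^ l ^ 2)`, signs attached to them, and a function
on the circle. -/
structure Block where
  level : ℕ
  pos : ℝ
  sign : ℕ → ℝ
  fn : Circ → ℝ

/-- The number of frequencies of a block. -/
def Block.size (x : Block) : ℕ := 2 ^ x.level ^ 2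

/-- The function of the block has uniformly controlled size, and its symbol interpolates the signs,
which are flat, at the frequencies of the block. -/
structure Block.IsGood (Φ : ℝ → ℝ) (D : ℝ) (x : Block) : Prop where
  one_le_level : 1 ≤ x.level
  flat : FlatSigns x.size x.sign
  pos_pos : 0 < x.pos
  admissible : Admissible x.fn 4
  integral_abs_le : ∫ θ, |x.fn θ| ∂arcLength ≤ 1
  continuousAt : ∀ ξ ≠ 0, ContinuousAt (symb x.fn) ξ
  lintegral_le : ∫⁻ θ, ENNReal.ofReal (Φ |x.fn θ|) ∂arcLength ≤ ENNReal.ofReal D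
  abs_symb_sub_le : ∀ k < x.size, |symb x.fn (freq x.pos k) - x.sign k| ≤ 1 / x.size

/-- The horizontal unit vector, which is the limit of the directions of `(R, k + 1)` as `R → ∞`. -/
def horiz : Plane := !₂[1, 0]

/-- The symbols of two blocks do not interact: the later one is small at the frequencies of the
earlier one, and the earlier one is nearly constant on the frequencies of the later one. -/
structure Block.Before (x y : Block) : Prop where
  level_lt : x.level < y.level
  abs_symb_le : ∀ k < x.size, |symb y.fn (freq x.pos k)| ≤ 1 / x.size
  abs_symb_sub_le : ∀ k < y.size, |symb x.fn (freq y.pos k) - symb x.fn horiz| ≤ 1 / y.size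

theorem horiz_ne_zero : horiz ≠ 0 := fun h => by
  have := congrArg (fun x : Plane => x 0) h
  simp [horiz] at this

theorem freq_ne_zero (R : ℝ) (k : ℕ) : freq R k ≠ 0 := fun h => by
  have h1 := congrArg (fun x : Plane => x 1) h
  have h2 : (k : ℝ) + 1 = 0 := by simpa [freq] using h1
  have h3 : (0 : ℝ) ≤ k := Nat.cast_nonneg k
  linarith

theorem cross_freq (R S : ℝ) (j k : ℕ) :
    cross (freq R j) (freq S k) = R * (k + 1) - (j + 1) * S := by
  simp [cross, freq]

theorem cross_smul_smul (a b : ℝ) (x y : Plane) : cross (a • x) (b • y) = a * b * cross x y := by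
  simp only [cross, PiLp.smul_apply, smul_eq_mul]
  ring

theorem cross_normalize_ne_zero {x y : Plane} (hx : x ≠ 0) (hy : y ≠ 0) (h : cross x y ≠ 0) :
    cross (‖x‖⁻¹ • x) (‖y‖⁻¹ • y) ≠ 0 := by
  rw [cross_smul_smul]
  exact mul_ne_zero (mul_ne_zero (inv_ne_zero (norm_ne_zero_iff.2 hx))
    (inv_ne_zero (norm_ne_zero_iff.2 hy))) h

theorem tendsto_symb_freq {Ω : Circ → ℝ} (h : ContinuousAt (symb Ω) horiz) (k : ℕ) :
    Tendsto (fun R : ℝ => symb Ω (freq R k)) atTop (𝓝 (symb Ω horiz)) := by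
  have h1 : Tendsto (fun R : ℝ => horiz + R⁻¹ • (!₂[0, (k : ℝ) + 1] : Plane)) atTop
      (𝓝 horiz) := by
    have := (tendsto_inv_atTop_zero (𝕜 := ℝ)).smul_const (!₂[0, (k : ℝ) + 1] : Plane)
    simpa using this.const_add horiz
  refine (h.tendsto.comp h1).congr' ?_
  filter_upwards [eventually_gt_atTop (0 : ℝ)] with R hR
  have h2 : horiz + R⁻¹ • (!₂[0, (k : ℝ) + 1] : Plane) = R⁻¹ • freq R k := by
    ext i
    fin_cases i <;> simp [horiz, freq, hR.ne']
  rw [Function.comp_apply, h2, symb_smul Ω (inv_pos.2 hR)]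

theorem Block.size_pos (x : Block) : 0 < x.size := by unfold Block.size; positivity

/-- A new block can be chosen beyond finitely many given ones. First its position `R` is taken so
far out that the earlier symbols are nearly constant on its frequencies and that none of these is
parallel to an earlier frequency; then its function is made small at the earlier frequencies. -/
theorem exists_next_block {Φ : ℝ → ℝ} (hΦ : IsYoungFunction Φ)
    (hΨ : Tendsto (fun t : ℝ => t * Real.log (Real.exp 1 + t) / Φ t) atTop atTop)
    (s : Finset Block) (hs : ∀ x ∈ s, x.IsGood Φ (1 + Φ 1 * arcLength.real univ)) :
    ∃ y : Block, y.IsGood Φ (1 + Φ 1 * arcLength.real univ) ∧ ∀ x ∈ s, x.Before y := by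
  classical
  set l := s.sup Block.level + 1 with hl
  obtain ⟨ε, hε⟩ := exists_flatSigns (l ^ 2)
  set N : ℕ := 2 ^ l ^ 2 with hN
  have hNpos : 0 < N := by positivity
  have hτ : (0 : ℝ) < 1 / N := by positivity
  obtain ⟨R, hR0, hRs⟩ : ∃ R : ℝ, 0 < R ∧ ∀ x ∈ s, x.pos * N < R ∧
      ∀ k ∈ Finset.range N, |symb x.fn (freq R k) - symb x.fn horiz| ≤ 1 / N := by
    refine ((eventually_gt_atTop (0 : ℝ)).and ((eventually_all_finset s).2 fun x hx =>
      (eventually_gt_atTop _).and ((eventually_all_finset _).2 fun k _ => ?_))).exists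
    have h1 := ((tendsto_symb_freq ((hs x hx).continuousAt _ horiz_ne_zero) k).sub_const
      (symb x.fn horiz)).abs
    rw [sub_self, abs_zero] at h1
    exact h1.eventually_le_const hτ
  have : Nonempty (Fin N) := ⟨⟨0, hNpos⟩⟩
  have hmem : ∀ x ∈ s, x.size ≤ N := fun x hx => by
    have h1 : x.level ≤ l := (Finset.le_sup (f := Block.level) hx).trans (Nat.le_succ _)
    exact Nat.pow_le_pow_right two_pos (Nat.pow_le_pow_left h1 2)
  obtain ⟨Ω, hm, ⟨B, hB⟩, heven, hmean, habs, hlog, hY, hat, hoff⟩ := exists_block hΦ hΨ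
    (ι := Fin N) (e := fun i => ‖freq R i‖⁻¹ • freq R i) (ε := fun i => ε i)
    (E := s.biUnion fun x => (Finset.range x.size).image fun k =>
      ‖freq x.pos k‖⁻¹ • freq x.pos k)
    (fun i => norm_normalize (freq_ne_zero _ _))
    (fun i j hij => cross_normalize_ne_zero (freq_ne_zero _ _) (freq_ne_zero _ _) (by
      rw [cross_freq]
      have h1 : (i : ℝ) ≠ (j : ℝ) := fun h => hij (Fin.ext (by exact_mod_cast h))
      have h2 : R * ((j : ℝ) + 1) - (i + 1) * R = R * (j - i) := by ring
      rw [h2]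
      exact mul_ne_zero hR0.ne' (sub_ne_zero.2 h1.symm)))
    (fun i => hε.abs_eq i)
    (fun ξ hξ => by
      simp only [Finset.mem_biUnion, Finset.mem_image, Finset.mem_range] at hξ
      obtain ⟨x, hx, k, hk, rfl⟩ := hξ
      refine ⟨norm_normalize (freq_ne_zero _ _), fun i =>
        cross_normalize_ne_zero (freq_ne_zero _ _) (freq_ne_zero _ _) (ne_of_lt ?_)⟩
      rw [cross_freq, sub_neg]
      have h1 : ((i : ℕ) : ℝ) + 1 ≤ N := by exact_mod_cast i.2
      have h2 : (0 : ℝ) ≤ k := Nat.cast_nonneg k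
      have h3 := mul_le_mul_of_nonneg_left h1 (hs x hx).pos_pos.le
      nlinarith [(hRs x hx).1])
    hτ
  simp only [symb_normalize] at hat
  have hint : Integrable Ω arcLength :=
    Integrable.of_bound hm.aestronglyMeasurable B (ae_of_all _ hB)
  refine ⟨⟨l, R, ε, Ω⟩, ⟨Nat.le_add_left 1 _, hε, hR0, ⟨heven, hint, hmean, fun ξ => ?_, hlog⟩,
    habs, fun ξ hξ => continuousAt_symb hm hB hξ, hY, fun k hk => hat ⟨k, hk⟩⟩, fun x hx =>
    ⟨Nat.lt_succ_of_le (Finset.le_sup (f := Block.level) hx), fun k hk => ?_,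
      fun k hk => (hRs x hx).2 k (Finset.mem_range.2 hk)⟩⟩
  · exact (integrable_logKer ξ).bdd_mul hm.abs.aestronglyMeasurable (c := B)
      (ae_of_all _ fun θ => by rw [Real.norm_eq_abs, abs_abs]; exact hB θ)
  · have h1 := hoff (‖freq x.pos k‖⁻¹ • freq x.pos k) (by
      simp only [Finset.mem_biUnion, Finset.mem_image, Finset.mem_range]
      exact ⟨x, hx, k, hk, rfl⟩)
    rw [symb_normalize] at h1
    refine h1.trans ?_
    have := hmem x hx
    have := x.size_pos
    gcongr

/-- The convex series of a sequence of non-interacting blocks has all of their levels. -/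
theorem hasLevel_tsum {Φ : ℝ → ℝ} {D : ℝ} {x : ℕ → Block} (hx : ∀ i, (x i).IsGood Φ D)
    (hbef : ∀ i j, i < j → (x i).Before (x j))
    (hs : Summable fun i => (1 / 2 : ℝ) ^ (x i).level)
    (hs1 : ∑' i, (1 / 2 : ℝ) ^ (x i).level ≤ 1) (j : ℕ) :
    HasLevel (fun θ => ∑' i, (1 / 2) ^ (x i).level * (x i).fn θ) 4 (x j).level := by
  set c : ℕ → ℝ := fun i => (1 / 2 : ℝ) ^ (x i).level with hc_def
  have hc : ∀ i, 0 ≤ c i := fun i => by positivity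
  have hadm := fun i => (hx i).admissible
  -- the limiting values of the earlier symbols at the frequencies of the block `j`
  set a : ℕ → ℝ := fun i => if i < j then symb (x i).fn horiz else 0 with ha_def
  have ha4 : ∀ i, |a i| ≤ 4 := fun i => by
    simp only [ha_def]
    split_ifs
    · exact (hadm i).abs_symb_le _
    · simp
  have hca : Summable fun i => c i * a i :=
    Summable.of_norm_bounded (hs.mul_right 4) fun i => by
      rw [norm_mul, Real.norm_of_nonneg (hc i)]
      exact mul_le_mul_of_nonneg_left (ha4 i) (hc i)
  have hbound : ∀ {u : ℕ → ℝ} {U B : ℝ}, 0 ≤ B → HasSum (fun i => c i * u i) U →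
      (∀ i, |u i| ≤ B) → |U| ≤ B := by
    intro u U B hB0 hU hu
    have h1 : ‖U‖ ≤ (∑' i, c i) * B := hU.norm_le_of_bounded (hs.hasSum.mul_right B) fun i => by
      rw [norm_mul, Real.norm_of_nonneg (hc i)]
      exact mul_le_mul_of_nonneg_left (hu i) (hc i)
    exact h1.trans (mul_le_of_le_one_left hB0 hs1)
  refine ⟨(x j).pos, ∑' i, c i * a i, (x j).sign, hbound (by norm_num) hca.hasSum ha4, (hx j).flat,
    fun k hk => ⟨continuousAt_symb_tsum hadm hc hs (fun i => (hx i).continuousAt)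
      (freq_ne_zero _ _), ?_⟩⟩
  set ξ := freq (x j).pos k
  have hsj : ((2 : ℝ) ^ (x j).level ^ 2) = (x j).size := by simp [Block.size]
  rw [hsj]
  have h1 := hasSum_symb hadm hc hs ξ
  have h2 : HasSum (fun i => c i * if i = j then (x j).sign k else 0) (c j * (x j).sign k) := by
    simpa using hasSum_single (f := fun i => c i * if i = j then (x j).sign k else 0) j
      (fun i hi => by simp [hi])
  have h3 := h1.sub (hca.hasSum.add h2)
  refine hbound (u := fun i => symb (x i).fn ξ - (a i + if i = j then (x j).sign k else 0))
    (by positivity) ?_ fun i => ?_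
  · simpa only [mul_sub, mul_add] using h3
  · rcases lt_trichotomy i j with h | h | h
    · simp only [ha_def, h, h.ne, if_true, if_false, add_zero]
      exact (hbef i j h).abs_symb_sub_le k hk
    · subst h
      simp only [ha_def, lt_irrefl, if_true, if_false, zero_add]
      exact (hx i).abs_symb_sub_le k hk
    · simp only [ha_def, h.not_gt, h.ne', if_false, add_zero, sub_zero]
      exact (hbef j i h).abs_symb_le k hk

theorem exists_admissible_hasLevel {Φ : ℝ → ℝ} (hΦ : IsYoungFunction Φ)
    (hΨ : Tendsto (fun t : ℝ => t * Real.log (Real.exp 1 + t) / Φ t) atTop atTop) :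
    ∃ Ω : Circ → ℝ, MemPhiL Φ Ω ∧ Admissible Ω 4 ∧ ∃ᶠ l in atTop, HasLevel Ω 4 l := by
  obtain ⟨x, hx, hbef⟩ := exists_seq_of_forall_finset_exists
    (Block.IsGood Φ (1 + Φ 1 * arcLength.real univ)) Block.Before (exists_next_block hΦ hΨ)
  have hlev : ∀ i, i + 1 ≤ (x i).level := by
    intro i
    induction i with
    | zero => exact (hx 0).one_le_level
    | succ i ih => exact ih.trans_lt (hbef i (i + 1) i.lt_succ_self).level_lt
  set c : ℕ → ℝ := fun i => (1 / 2 : ℝ) ^ (x i).level with hc_def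
  have hc : ∀ i, 0 ≤ c i := fun i => by positivity
  have hle : ∀ i, c i ≤ 1 / 2 / 2 ^ i := fun i => by
    have h1 : c i ≤ (1 / 2 : ℝ) ^ (i + 1) :=
      pow_le_pow_of_le_one (by norm_num) (by norm_num) (hlev i)
    refine h1.trans_eq ?_
    rw [pow_succ, one_div_pow]
    ring
  have hs : Summable c := Summable.of_nonneg_of_le hc hle (summable_geometric_two' 1)
  have hs1 : ∑' i, c i ≤ 1 :=
    (hs.tsum_le_tsum hle (summable_geometric_two' 1)).trans_eq (tsum_geometric_two' 1)
  refine ⟨fun θ => ∑' i, c i * (x i).fn θ,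
    memPhiL_tsum (fun i => (hx i).admissible) hc hs hs1 hΦ (fun i => (hx i).integral_abs_le)
      fun i => (hx i).lintegral_le,
    admissible_tsum (fun i => (hx i).admissible) hc hs hs1 fun i => (hx i).integral_abs_le, ?_⟩
  rw [frequently_atTop]
  exact fun l => ⟨_, (Nat.le_succ l).trans (hlev l), hasLevel_tsum hx hbef hs hs1 l⟩

end RoughSI

theorem theorem2p1 (Φ : ℝ → ℝ) (hΦ : RoughSI.IsYoungFunction Φ)
    (hΨ : Tendsto (fun t : ℝ => t * Real.log (Real.exp 1 + t) / Φ t) atTop atTop) :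
    ∃ Ω : RoughSI.Circ → ℝ,
      RoughSI.MemPhiL Φ Ω ∧
      (∀ θ, Ω (-θ) = Ω θ) ∧
      Integrable Ω RoughSI.arcLength ∧
      ∫ θ, Ω θ ∂(RoughSI.arcLength) = 0 ∧
      (∀ (f : 𝓢(RoughSI.Plane, ℂ)) (x : RoughSI.Plane), RoughSI.PVExists Ω f x) ∧
      (∀ p : ℝ≥0∞, 1 ≤ p → (RoughSI.BoundedOnLp Ω p ↔ p = 2)) ∧
      RoughSI.BoundedOnLp Ω 2 ∧
      ¬ RoughSI.WeakTypeOneOne Ω := by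
  obtain ⟨Ω, hmem, hadm, hlev⟩ := RoughSI.exists_admissible_hasLevel hΦ hΨ
  refine ⟨Ω, hmem, hadm.even, hadm.integrable, hadm.integral_eq_zero, hadm.pvExists,
    fun p hp => ⟨fun hb => ?_, fun h => h ▸ hadm.boundedOnLp_two⟩, hadm.boundedOnLp_two,
    fun hw => ?_⟩
  · by_contra hp2
    obtain ⟨C, hC⟩ := hadm.exists_distribBound hp hb
    exact hadm.not_distribBound hlev hp hp2 C hC
  · obtain ⟨C, hC⟩ := hw.exists_distribBound
    exact hadm.not_distribBound hlev le_rfl (by norm_num) C hC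

end
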